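/- Let $\lambda,\mu,c,\varepsilon>0$ and $p(u)=c+\varepsilon u$. Let $(\tau_k)_{k\ge 0}$ be i.i.d. interarrival times and $(X_k)_{k\ge 0}$ i.i.d. claim sizes, all independent, let $N(t)=\#\{k\ge 0:\tau_0+\dots+\tau_k\le t\}$, and let the surplus with $U(0)=u\ge 0$ solve, almost surely for all $t\ge 0$, $$U(t)=u+\int_0^t p(U(s))\,ds-\sum_{k<N(t)}X_k .$$ Let $T_u=\inf\{t\ge 0:U(t)<0\}$ and $\psi(u)=\mathbb P(T_u<\infty)$. Write $f\sim g$ for $f(u)/g(u)\to 1$ as $u\to\infty$. Solutions of ODEs are understood on $[0,\infty)$ (one-sided derivatives at $0$), $M(a,b,z)$ and $U(a,b,z)$ are the Kummer functions, $I_\nu,K_\nu$ the modified Bessel functions of real order $\nu$, and $\Gamma(x,\eta)=\int_x^\infty t^{\eta-1}e^{-t}dt$. For functions $q_1,q_0$ put $$\rho_\pm=\tfrac12\bigl(-q_1\pm\sqrt{q_1^2-4q_0}\bigr),\quad \rho_\pm^{(1)}=\frac{-\rho_\pm'}{2\rho_\pm+q_1},\quad E_\pm[q_1,q_0;u_0](y)=\exp\int_{u_0}^y\bigl(\rho_\pm(z)+\rho^{(1)}_\pm(z)\bigr)dz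 .$$ **A. Erlang$(2,\lambda)$ interarrival times (density $\lambda^2te^{-\lambda t}$), Exp$(\mu)$ claims.** Consider the equations $$p^2h''+(3\varepsilon p-2\lambda p+\mu p^2)h'+\bigl((\lambda-\varepsilon)^2+\mu\varepsilon p-2\lambda\mu p\bigr)h=0,\tag{1}$$ $$p^2h''+(2\varepsilon p-2\lambda p+\mu p^2)h'+\bigl(\lambda^2-2\lambda\varepsilon-2\lambda\mu p\bigr)h=0,\tag{2}$$ where (2) is (1) without the terms $\varepsilon p h'$ and $(\varepsilon^2+\mu\varepsilon p)h$; let $(q_1,q_0)$ and $(\bar q_1,\bar q_0)$ be the coefficients of (1) and (2) after division by $p^2$. Let $r=\sqrt{1+4\lambda/\varepsilon}$ and $a=1+\frac{\varepsilon+2\lambda+\varepsilon r}{2\varepsilon}$. 1. The solutions of (1) are exactly $C_1h_M+C_2h_U$, where $h_M(u)=e^{-\mu u}p(u)^{\lambda/\varepsilon-1}M\bigl(1+\frac\lambda\varepsilon,1,\frac{\mu p(u)}\varepsilon\bigr)$ is not integrable on $(0,\infty)$ and $h_U(u)=e^{-\mu u}p(u)^{\lambda/\varepsilon-1}U\bigl(1+\frac\lambda\varepsilon,1,\frac{\mu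 p(u)}\varepsilon\bigr)$ is integrable. 2. The solutions of (2) are exactly $C_1k_M+C_2k_U$, where $k_M(u)=e^{-\mu u}p(u)^{-\frac12+\frac\lambda\varepsilon+\frac r2}M\bigl(a,1+r,\frac{\mu p(u)}\varepsilon\bigr)\to\infty$ as $u\to\infty$, and $k_U$, defined in the same way with $U$ in place of $M$, tends to $0$ and is integrable on $(0,\infty)$. 3. For $u\ge 0$, $$\int_u^\infty \frac{e^{-\mu y}}{p(y)^{2}}dy=\frac1\varepsilon\Bigl(\frac{e^{-\mu u}}{p(u)}-\mu\int_u^\infty\frac{e^{-\mu v}}{p(v)}dv\Bigr)=\frac1\varepsilon\Bigl(\frac{e^{-\mu u}}{p(u)}-\frac\mu\varepsilon e^{\mu c/\varepsilon}\,\Gamma\bigl(\tfrac{\mu p(u)}{\varepsilon},0\bigr)\Bigr).$$ 4. $E_-[\bar q_1,\bar q_0;0](y)\sim\kappa e^{-\mu y}p(y)^{-2}$ for some $\kappa>0$; the same holds for $E_-[q_1,q_0;u_0]$ for each $u_0\ge 0$ such that $q_1^2-4q_0>0$ on $[u_0,\infty)$. 5. The ruin probability $\psi$ is smooth on $[0,\infty)$,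 tends to $0$ at $\infty$, satisfies on $[0,\infty)$ the equation $\bigl[(\frac d{du}+\mu)(-p\frac d{du}+\lambda)^2-\lambda^2\mu\bigr]\psi=0$, and $h=\psi'$ solves (1). There is a constant $C>0$, depending only on $\lambda,\mu,c,\varepsilon$, with $$\psi(u)=C\int_u^\infty h_U(v)\,dv\quad(u\ge 0),\qquad \psi(u)\sim C\Bigl(\frac\mu\varepsilon\Bigr)^{-1-\lambda/\varepsilon}\int_u^\infty e^{-\mu y}(c+\varepsilon y)^{-2}dy .$$ For some constant $C'>0$, both $\psi(u)\sim C'\int_u^\infty k_U(v)\,dv$ and $\psi(u)\sim C'(\mu/\varepsilon)^{-a}\int_u^\infty e^{-\mu y}(c+\varepsilon y)^{-2}dy$. Finally $\psi(u)\sim C_3\int_u^\infty E_-[\bar q_1,\bar q_0;0](y)\,dy$ for some $C_3>0$, and likewise (with another $C_3>0$) with $E_-[q_1,q_0;u_0]$ for each $u_0$ as in 4. **B. Exp$(\lambda)$ interarrival times, Erlang$(2,\mu)$ claims (density $\mu^2xe^{-\mu x}$).** Consider $$p\,h''+(2\varepsilon+2\mu p-\lambda)h'+(2\mu\varepsilon+\mu^2p-2\mu\lambda)h=0,\tag{3}$$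 and let $\tilde q_1,\tilde q_0$ be its coefficients after division by $p$. 1. The solutions of (3) are exactly $C_1h_I+C_2h_K$, where $$h_I(u)=e^{-\frac\mu\varepsilon(c+\varepsilon u)}(c+\varepsilon u)^{-\frac12+\frac{\lambda}{2\varepsilon}}\,I_{-1+\lambda/\varepsilon}\Bigl(2\sqrt{(u+\tfrac c\varepsilon)\tfrac{\lambda\mu}{\varepsilon}}\Bigr)$$ and $h_K$ is the same with $K_{-1+\lambda/\varepsilon}$ in place of $I_{-1+\lambda/\varepsilon}$; both are integrable on $(0,\infty)$. 2. For each choice of sign there is $\kappa>0$ with $E_\pm[\tilde q_1,\tilde q_0;0](y)\sim\kappa\, e^{-\mu y\pm\frac2\varepsilon\sqrt{\lambda\mu(c+\varepsilon y)}}(c+\varepsilon y)^{-\frac34+\frac\lambda{2\varepsilon}}$. 3. The ruin probability $\psi$ is smooth on $[0,\infty)$, tends to $0$ at $\infty$, satisfies on $[0,\infty)$ the equation $\bigl[(\frac d{du}+\mu)^2(-p\frac d{du}+\lambda)-\lambda\mu^2\bigr]\psi=0$, and $h=\psi'$ solves (3). There are constants $C_1>0$ and $C_2\in\mathbb R$,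 depending only on $\lambda,\mu,c,\varepsilon$, with $\psi(u)=C_1\int_u^\infty h_I(v)\,dv+C_2\int_u^\infty h_K(v)\,dv$ for all $u\ge 0$, and $$\psi(u)\sim C_1\sqrt{\tfrac\varepsilon2}\,\frac{e^{-\mu c/\varepsilon}}{\sqrt{2\pi\sqrt{\lambda\mu}}}\int_u^\infty e^{-\mu y+\frac2\varepsilon\sqrt{\lambda\mu(c+\varepsilon y)}}(c+\varepsilon y)^{-\frac34+\frac\lambda{2\varepsilon}}dy+C_2\sqrt{\tfrac\varepsilon2}\sqrt{\frac{\pi}{2\sqrt{\lambda\mu}}}\,e^{-\mu c/\varepsilon}\int_u^\infty e^{-\mu y-\frac2\varepsilon\sqrt{\lambda\mu(c+\varepsilon y)}}(c+\varepsilon y)^{-\frac34+\frac\lambda{2\varepsilon}}dy .$$ Moreover $\psi(u)\sim C_3\int_u^\infty E_-[\tilde q_1,\tilde q_0;0](y)\,dy+C_4\int_u^\infty E_+[\tilde q_1,\tilde q_0;0](y)\,dy$ for some constants $C_3\in\mathbb R$, $C_4>0$. -/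

import Mathlib

open Real Set Filter Topology MeasureTheory ProbabilityTheory Asymptotics
open scoped NNReal ENNReal ContDiff

noncomputable section

/-! ### The surplus process and the ruin probability -/

/-- The number of claims up to time `t` when the interarrival times are `τ 0, τ 1, …`:
the `k`-th claim (counted from `0`) arrives at time `τ 0 + ⋯ + τ k`. -/
def claimCount (τ : ℕ → ℝ) (t : ℝ) : ℕ :=
  Set.ncard {k : ℕ | ∑ j ∈ Finset.range (k + 1), τ j ≤ t}

/-- A renewal risk model with surplus-dependent premium rate `p`: independent interarrival times
`τ k` with law `νT` and claim sizes `X k` with law `νX`, and for each initial surplus `u ≥ 0` a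
process `U u` that solves `U(t) = u + ∫₀ᵗ p(U(s)) ds - ∑_{k < N(t)} X k`. -/
structure IsRiskModel {Ω : Type*} [MeasurableSpace Ω] (P : Measure Ω) (p : ℝ → ℝ)
    (νT νX : Measure ℝ) (τ X : ℕ → Ω → ℝ) (U : ℝ → ℝ → Ω → ℝ) : Prop where
  measurable_interarrival : ∀ k, Measurable (τ k)
  measurable_claim : ∀ k, Measurable (X k)
  law_interarrival : ∀ k, P.map (τ k) = νT
  law_claim : ∀ k, P.map (X k) = νX
  indep : iIndepFun (Sum.elim τ X) P
  surplus_eq : ∀ u, 0 ≤ u → ∀ᵐ w ∂P, ∀ t, 0 ≤ t →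
    IntervalIntegrable (fun s => p (U u s w)) volume 0 t ∧
    U u t w = u + (∫ s in (0 : ℝ)..t, p (U u s w))
      - ∑ k ∈ Finset.range (claimCount (fun j => τ j w) t), X k w

/-- The time of ruin `inf {t ≥ 0 | V t < 0}` of a path `V`, equal to `∞` if there is no ruin. -/
def ruinTime (V : ℝ → ℝ) : ℝ≥0∞ :=
  ⨅ (t : ℝ≥0) (_ : V t < 0), (t : ℝ≥0∞)

/-- The ruin probability `P(T_u < ∞)` as a function of the initial surplus `u`. -/
def ruinProb {Ω : Type*} [MeasurableSpace Ω] (P : Measure Ω) (U : ℝ → ℝ → Ω → ℝ) (u : ℝ) : ℝ :=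
  P.real {w | ruinTime (fun t => U u t w) < ⊤}

/-! ### Differential operators and linear equations on `[0, ∞)` -/

/-- The derivative on `[0, ∞)`, one-sided at `0`. -/
def D₀ (f : ℝ → ℝ) (u : ℝ) : ℝ := derivWithin f (Ici 0) u

/-- The operator `-p(u) d/du + lam`. -/
def premiumOp (lam : ℝ) (p f : ℝ → ℝ) (u : ℝ) : ℝ := -(p u) * D₀ f u + lam * f u

/-- The operator `d/du + μ`. -/
def shiftOp (μ : ℝ) (f : ℝ → ℝ) (u : ℝ) : ℝ := D₀ f u + μ * f u

/-- `h` is twice differentiable on `[0, ∞)` (one-sidedly at `0`) and satisfies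
`a₂ h'' + a₁ h' + a₀ h = 0` there. -/
def SolvesODE (a₂ a₁ a₀ h : ℝ → ℝ) : Prop :=
  ∃ h' h'' : ℝ → ℝ, ∀ u, 0 ≤ u →
    HasDerivWithinAt h (h' u) (Ici 0) u ∧ HasDerivWithinAt h' (h'' u) (Ici 0) u ∧
    a₂ u * h'' u + a₁ u * h' u + a₀ u * h u = 0

/-! ### Special functions -/

/-- Kummer's function `M(a, b, z) = ∑ (a)ₙ zⁿ / ((b)ₙ n!)`. -/
def kummerM (a b z : ℝ) : ℝ :=
  ∑' n : ℕ, (ascPochhammer ℝ n).eval a / (ascPochhammer ℝ n).eval b * z ^ n / (n.factorial : ℝ)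

/-- Kummer's (Tricomi's) function `U(a, b, z)` for `a > 0` and `z > 0`, by its integral
representation `Γ(a)⁻¹ ∫₀^∞ e^{-zt} t^{a-1} (1+t)^{b-a-1} dt`. -/
def kummerU (a b z : ℝ) : ℝ :=
  (Real.Gamma a)⁻¹ *
    ∫ t in Ioi (0 : ℝ), exp (-(z * t)) * t ^ (a - 1) * (1 + t) ^ (b - a - 1)

/-- The modified Bessel function of the first kind, of real order `ν`, for `x > 0`. -/
def besselI (ν x : ℝ) : ℝ :=
  ∑' m : ℕ, (x / 2) ^ (2 * (m : ℝ) + ν) / ((m.factorial : ℝ) * Real.Gamma ((m : ℝ) + ν + 1))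

/-- The modified Bessel function of the second kind, of real order `ν`, for `x > 0`, by its
integral representation `∫₀^∞ e^{-x cosh t} cosh(νt) dt`. -/
def besselK (ν x : ℝ) : ℝ :=
  ∫ t in Ioi (0 : ℝ), exp (-(x * cosh t)) * cosh (ν * t)

/-- The upper incomplete gamma function `Γ(x, η) = ∫ₓ^∞ t^{η-1} e^{-t} dt`. -/
def upperGamma (x η : ℝ) : ℝ := ∫ t in Ioi x, t ^ (η - 1) * exp (-t)

/-! ### Linear premium -/

/-- The linear premium `p(u) = c + εu`. -/
def linPremium (c ε u : ℝ) : ℝ := c + ε * u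

/-- `e^{-μu} (c+εu)^s M(a, b, μ(c+εu)/ε)`. -/
def kummerSolM (μ c ε s a b u : ℝ) : ℝ :=
  exp (-(μ * u)) * linPremium c ε u ^ s * kummerM a b (μ * linPremium c ε u / ε)

/-- `e^{-μu} (c+εu)^s U(a, b, μ(c+εu)/ε)`. -/
def kummerSolU (μ c ε s a b u : ℝ) : ℝ :=
  exp (-(μ * u)) * linPremium c ε u ^ s * kummerU a b (μ * linPremium c ε u / ε)

/-- `e^{-(μ/ε)(c+εu)} (c+εu)^{-1/2+λ/(2ε)} I_{-1+λ/ε}(2 √((u+c/ε)λμ/ε))`. -/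
def besselSolI (lam μ c ε u : ℝ) : ℝ :=
  exp (-(μ / ε * linPremium c ε u)) * linPremium c ε u ^ (-1 / 2 + lam / (2 * ε)) *
    besselI (-1 + lam / ε) (2 * √((u + c / ε) * lam * μ / ε))

/-- `e^{-(μ/ε)(c+εu)} (c+εu)^{-1/2+λ/(2ε)} K_{-1+λ/ε}(2 √((u+c/ε)λμ/ε))`. -/
def besselSolK (lam μ c ε u : ℝ) : ℝ :=
  exp (-(μ / ε * linPremium c ε u)) * linPremium c ε u ^ (-1 / 2 + lam / (2 * ε)) *
    besselK (-1 + lam / ε) (2 * √((u + c / ε) * lam * μ / ε))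

/-- `e^{-μy} (c+εy)^{-2}`. -/
def expTail (μ c ε y : ℝ) : ℝ := exp (-(μ * y)) * linPremium c ε y ^ (-2 : ℝ)

/-- `e^{-μy + σ(2/ε)√(λμ(c+εy))} (c+εy)^{-3/4+λ/(2ε)}`, used with `σ = 1` and `σ = -1`. -/
def sqrtTail (σ lam μ c ε y : ℝ) : ℝ :=
  exp (-(μ * y) + σ * (2 / ε * √(lam * μ * linPremium c ε y))) *
    linPremium c ε y ^ (-3 / 4 + lam / (2 * ε))

/-! ### The asymptotic formula for general premiums -/

/-- The discriminant `q₁² - 4 q₀`. -/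
def charDiscr (q₁ q₀ : ℝ → ℝ) (u : ℝ) : ℝ := q₁ u ^ 2 - 4 * q₀ u

/-- The root `ρ(u) = (-q₁ + σ √(q₁² - 4 q₀)) / 2` of `ρ² + q₁ ρ + q₀ = 0`, with `σ = ±1`. -/
def charRoot (σ : ℝ) (q₁ q₀ : ℝ → ℝ) (u : ℝ) : ℝ := (-q₁ u + σ * √(charDiscr q₁ q₀ u)) / 2

/-- The first correction `ρ⁽¹⁾(u) = -ρ'(u) / (2 ρ(u) + q₁(u))`. -/
def charCorrection (σ : ℝ) (q₁ q₀ : ℝ → ℝ) (u : ℝ) : ℝ :=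
  -deriv (charRoot σ q₁ q₀) u / (2 * charRoot σ q₁ q₀ u + q₁ u)

/-- `exp (∫_{u₀}^y (ρ(z) + ρ⁽¹⁾(z)) dz)`. -/
def expRoot (σ : ℝ) (q₁ q₀ : ℝ → ℝ) (u₀ y : ℝ) : ℝ :=
  exp (∫ z in u₀..y, (charRoot σ q₁ q₀ z + charCorrection σ q₁ q₀ z))

end

/-!
The proof has three layers: from the risk process to a renewal equation, from there to a linear
differential equation for `ψ'` with explicit solutions, and from these to the asymptotics.

*From the process to a renewal equation.* Between claims the surplus follows the flow of
`y' = c + εy`, which increases, so ruin can occur only at a claim. Hence the ruin probability is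
the increasing limit `ruinFun` of the iterates of the transition operator `ruinOp` from claim to
claim, applied to the indicator of the negative half-line (`ruinProb_eq_ruinFun`). It depends on the
two laws alone, so all constants can be chosen before the model is given. Monotone convergence gives
the renewal equation `toReal_ruinFun_eq`. Since the premium rate grows with the surplus,
`min(1, e^{-δ(z - u⋆)})` is a supersolution for large `u⋆`, whence `ψ → 0` (`tendsto_ruinFun`).

*From the renewal equation to explicit solutions.* With the interarrival time replaced by the level
that the flow has reached, the renewal equation becomes a tail integral with a power (and, for Erlang
times, a logarithm) of the premium as kernel; the mean over the claim becomes an integral with an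
exponential kernel. Differentiating both turns it into a first-order linear system for `ψ` and the
ruin probabilities at the intermediate stages of the Erlang laws (`exists_system_erlang_times`,
`exists_system_erlang_claims`). Smoothness, the third-order operator equation and the second-order
equation for `ψ'` follow from the system. After factoring out `e^{-μu} p(u)^s` the second-order
equations are Kummer's equation, respectively the equation of `z^{-ν/2} I_ν(2√(Lz))`, in the variable
`μ p(u) / ε` (`expPowMul_ode`, `expPowMul_ode_bessel`). The functions `M` and `I_ν` satisfy them by
termwise differentiation of the series, `U` and `K_ν` by differentiation under the integral sign;
that two solutions span is Wronski's argument (`solvesODE_iff_exists_eq_add`).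

*Which solution `ψ'` is.* For Erlang interarrival times the solution with `M` is not integrable, while
`ψ` is bounded, so `ψ'` is a multiple of the solution with `U`. For Erlang claims both solutions are
integrable, and the solution with `I` dominates. Its coefficient has the right sign because `ψ ≥ 0`.
It does not vanish: the probability `G` of ruin at a surplus `u` with a claim due at once has
`G'(0) = 0`, as the density of an Erlang law vanishes at zero, and this forces
`c ψ''(0) = (λ - ε) ψ'(0)`, which no nonzero multiple of the solution with `K` satisfies
(`exists_eq_integral_besselSol`).

*Asymptotics.* Those of `U`, `I_ν` and `K_ν` are found by substitution in their integral
representations and dominated convergence. For `I_ν` the representation is Poisson's integral,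
whose weight is bounded for `ν ≥ 1/2`; the recurrence in the order reaches the other `ν > -1`. For `E_±` the
exponent is the derivative of the logarithm of the claimed equivalent up to an integrable error
(`exists_exp_integral_isEquivalent`). Finally `isEquivalent_integral_Ioi` carries equivalences over
to tail integrals.
-/

/-! ### Second-order linear equations on a half-line -/

/-- A function on `[0, ∞)` whose one-sided derivative vanishes is constant. -/
lemma eq_of_hasDerivWithinAt_Ici_zero {f : ℝ → ℝ}
    (hf : ∀ u, 0 ≤ u → HasDerivWithinAt f 0 (Ici 0) u) {u : ℝ} (hu : 0 ≤ u) : f u = f 0 := by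
  have := (convex_Ici (0 : ℝ)).norm_image_sub_le_of_norm_hasDerivWithin_le (f := f)
    (f' := fun _ => 0) (C := 0) (x := 0) (y := u) (fun x hx => hf x hx) (by simp)
    (mem_Ici.2 le_rfl) hu
  simpa [sub_eq_zero] using this

/-- Two solutions whose Wronskian has no zero on `[0, ∞)` span the solution space: by Abel's
identity, the quotients of Wronskians in Cramer's rule are constant. -/
lemma solvesODE_iff_exists_eq_add {a₂ a₁ a₀ f f' f'' g g' g'' : ℝ → ℝ}
    (ha : ∀ u, 0 ≤ u → a₂ u ≠ 0)
    (hf : ∀ u, 0 ≤ u → HasDerivWithinAt f (f' u) (Ici 0) u ∧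
      HasDerivWithinAt f' (f'' u) (Ici 0) u ∧ a₂ u * f'' u + a₁ u * f' u + a₀ u * f u = 0)
    (hg : ∀ u, 0 ≤ u → HasDerivWithinAt g (g' u) (Ici 0) u ∧
      HasDerivWithinAt g' (g'' u) (Ici 0) u ∧ a₂ u * g'' u + a₁ u * g' u + a₀ u * g u = 0)
    (hW : ∀ u, 0 ≤ u → f u * g' u - f' u * g u ≠ 0) (h : ℝ → ℝ) :
    SolvesODE a₂ a₁ a₀ h ↔ ∃ C₁ C₂ : ℝ, ∀ u, 0 ≤ u → h u = C₁ * f u + C₂ * g u := by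
  constructor
  · rintro ⟨h', h'', hh⟩
    set c₁ : ℝ → ℝ := fun u => (h u * g' u - h' u * g u) / (f u * g' u - f' u * g u)
    set c₂ : ℝ → ℝ := fun u => (f u * h' u - f' u * h u) / (f u * g' u - f' u * g u)
    have h1 : ∀ u, 0 ≤ u → HasDerivWithinAt c₁ 0 (Ici 0) u := by
      intro u hu
      obtain ⟨F1, F2, F3⟩ := hf u hu
      obtain ⟨G1, G2, G3⟩ := hg u hu
      obtain ⟨H1, H2, H3⟩ := hh u hu
      refine (((H1.mul G2).sub (H2.mul G1)).div ((F1.mul G2).sub (F2.mul G1)) (hW u hu)).congr_deriv ?_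
      rw [div_eq_zero_iff]
      left
      refine mul_left_cancel₀ (ha u hu) ?_
      simp only [Pi.mul_apply, Pi.sub_apply]
      linear_combination (f u * g' u - f' u * g u) * (h u * G3 - g u * H3)
        - (h u * g' u - h' u * g u) * (f u * G3 - g u * F3)
    have h2 : ∀ u, 0 ≤ u → HasDerivWithinAt c₂ 0 (Ici 0) u := by
      intro u hu
      obtain ⟨F1, F2, F3⟩ := hf u hu
      obtain ⟨G1, G2, G3⟩ := hg u hu
      obtain ⟨H1, H2, H3⟩ := hh u hu
      refine (((F1.mul H2).sub (F2.mul H1)).div ((F1.mul G2).sub (F2.mul G1)) (hW u hu)).congr_deriv ?_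
      rw [div_eq_zero_iff]
      left
      refine mul_left_cancel₀ (ha u hu) ?_
      simp only [Pi.mul_apply, Pi.sub_apply]
      linear_combination (f u * g' u - f' u * g u) * (f u * H3 - h u * F3)
        - (f u * h' u - f' u * h u) * (f u * G3 - g u * F3)
    refine ⟨c₁ 0, c₂ 0, fun u hu => ?_⟩
    rw [← eq_of_hasDerivWithinAt_Ici_zero h1 hu, ← eq_of_hasDerivWithinAt_Ici_zero h2 hu]
    have := hW u hu
    simp only [c₁, c₂]
    rw [div_mul_eq_mul_div, div_mul_eq_mul_div, ← add_div, eq_div_iff this]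
    ring
  · rintro ⟨C₁, C₂, hC⟩
    refine ⟨fun u => C₁ * f' u + C₂ * g' u, fun u => C₁ * f'' u + C₂ * g'' u, fun u hu => ?_⟩
    obtain ⟨F1, F2, F3⟩ := hf u hu
    obtain ⟨G1, G2, G3⟩ := hg u hu
    refine ⟨((F1.const_mul C₁).add (G1.const_mul C₂)).congr_of_mem (fun x hx => hC x hx) hu,
      (F2.const_mul C₁).add (G2.const_mul C₂), ?_⟩
    rw [hC u hu]
    linear_combination C₁ * F3 + C₂ * G3

/-! ### Integrals over a half-line -/

lemma integral_Ioi_eq_sub {f : ℝ → ℝ} {a b : ℝ} (hab : a ≤ b) (hf : IntegrableOn f (Ioi a)) :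
    ∫ x in Ioi b, f x = (∫ x in Ioi a, f x) - ∫ x in a..b, f x := by
  rw [intervalIntegral.integral_of_le hab, ← Ioc_union_Ioi_eq_Ioi hab,
    setIntegral_union (Set.Ioc_disjoint_Ioi le_rfl) measurableSet_Ioi
      (hf.mono_set Ioc_subset_Ioi_self) (hf.mono_set (Ioi_subset_Ioi hab))]
  ring

/-- The tail integral of a continuous integrable function has that function, with a minus sign, as
its derivative. -/
lemma hasDerivWithinAt_integral_Ioi {f : ℝ → ℝ} (hf : IntegrableOn f (Ioi 0))
    (hc : ContinuousOn f (Ici 0)) {u : ℝ} (hu : 0 ≤ u) :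
    HasDerivWithinAt (fun u => ∫ x in Ioi u, f x) (-f u) (Ici 0) u := by
  set g : ℝ → ℝ := fun x => f (max x 0)
  have hg : Continuous g := by
    have := hc.comp_continuous (f := fun x : ℝ => max x 0) (by fun_prop)
      (fun x => mem_Ici.2 (le_max_right x 0))
    exact this
  have h1 : HasDerivAt (fun u => (∫ x in Ioi 0, f x) - ∫ x in (0 : ℝ)..u, g x) (-g u) u :=
    (intervalIntegral.integral_hasDerivAt_right (hg.intervalIntegrable _ _)
      (hg.stronglyMeasurableAtFilter _ _) hg.continuousAt).const_sub _
  have h2 : g u = f u := by simp [g, hu]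
  rw [h2] at h1
  refine h1.hasDerivWithinAt.congr_of_mem (fun x hx => ?_) hu
  rw [integral_Ioi_eq_sub hx hf]
  congr 1
  refine intervalIntegral.integral_congr fun y hy => ?_
  rw [uIcc_of_le hx] at hy
  simp [g, hy.1]

lemma integral_Ioi_pos {f : ℝ → ℝ} {u : ℝ} (hf : IntegrableOn f (Ioi u))
    (hpos : ∀ x ∈ Ioi u, 0 < f x) : 0 < ∫ x in Ioi u, f x := by
  rw [setIntegral_pos_iff_support_of_nonneg_ae
    ((ae_restrict_mem measurableSet_Ioi).mono fun x hx => (hpos x hx).le) hf]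
  have : Function.support f ∩ Ioi u = Ioi u :=
    inter_eq_right.2 fun x hx => (hpos x hx).ne'
  rw [this]
  simp

/-- Tail integrals inherit `o`: if `f = o(g)` at infinity with `g ≥ 0` integrable, then
`∫_u^∞ f = o(∫_u^∞ g)`. -/
lemma isLittleO_integral_Ioi {f g : ℝ → ℝ} {a : ℝ} (hg : IntegrableOn g (Ioi a))
    (hg0 : ∀ x, a ≤ x → 0 ≤ g x) (h : f =o[atTop] g) :
    (fun u => ∫ x in Ioi u, f x) =o[atTop] fun u => ∫ x in Ioi u, g x := by
  rw [isLittleO_iff]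
  intro δ hδ
  have h1 := (isLittleO_iff.1 h hδ)
  obtain ⟨b, hb⟩ := eventually_atTop.1 h1
  filter_upwards [eventually_ge_atTop b, eventually_ge_atTop a] with u hu hua
  have hgu : IntegrableOn g (Ioi u) := hg.mono_set (Ioi_subset_Ioi hua)
  have hg1 : 0 ≤ ∫ x in Ioi u, g x :=
    setIntegral_nonneg measurableSet_Ioi fun x hx => hg0 x (hua.trans (le_of_lt hx))
  calc ‖∫ x in Ioi u, f x‖ ≤ ∫ x in Ioi u, δ * g x := by
        refine norm_integral_le_of_norm_le (hgu.const_mul δ) ?_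
        refine (ae_restrict_mem measurableSet_Ioi).mono fun x hx => ?_
        have hx' : u < x := hx
        have := hb x (hu.trans hx'.le)
        rwa [Real.norm_of_nonneg (hg0 x (hua.trans hx'.le))] at this
    _ = δ * ‖∫ x in Ioi u, g x‖ := by
        rw [integral_const_mul, Real.norm_of_nonneg hg1]

/-- A continuous function asymptotically equivalent to an integrable one is integrable near
infinity. -/
lemma exists_integrableOn_Ioi_of_isEquivalent {f g : ℝ → ℝ} {a : ℝ} (hg : IntegrableOn g (Ioi a))
    (hfm : ContinuousOn f (Ici a)) (h : f ~[atTop] g) : ∃ b, a ≤ b ∧ IntegrableOn f (Ioi b) := by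
  obtain ⟨C, hC⟩ := h.isBigO.bound
  obtain ⟨b, hb⟩ := eventually_atTop.1 hC
  refine ⟨max a b, le_max_left _ _, ?_⟩
  refine Integrable.mono' ((hg.mono_set (Ioi_subset_Ioi (le_max_left a b))).norm.const_mul C)
    ((hfm.mono ?_).aestronglyMeasurable measurableSet_Ioi) ?_
  · exact fun x hx => (le_max_left a b).trans (le_of_lt hx)
  · refine (ae_restrict_mem measurableSet_Ioi).mono fun x hx => ?_
    exact hb x ((le_max_right a b).trans (le_of_lt hx))

lemma integrableOn_Ioi_of_isEquivalent {f g : ℝ → ℝ} {a : ℝ} (hg : IntegrableOn g (Ioi a))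
    (hfm : ContinuousOn f (Ici a)) (h : f ~[atTop] g) : IntegrableOn f (Ioi a) := by
  obtain ⟨b, hab, hb⟩ := exists_integrableOn_Ioi_of_isEquivalent hg hfm h
  rw [← Ioc_union_Ioi_eq_Ioi hab]
  exact ((hfm.mono Icc_subset_Ici_self).integrableOn_Icc.mono_set Ioc_subset_Icc_self).union hb

/-- Asymptotically equivalent functions have asymptotically equivalent tail integrals. -/
lemma isEquivalent_integral_Ioi {f g : ℝ → ℝ} {a : ℝ} (hg : IntegrableOn g (Ioi a))
    (hg0 : ∀ x, a ≤ x → 0 ≤ g x) (hfm : ContinuousOn f (Ici a)) (h : f ~[atTop] g) :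
    (fun u => ∫ x in Ioi u, f x) ~[atTop] fun u => ∫ x in Ioi u, g x := by
  have hf := integrableOn_Ioi_of_isEquivalent hg hfm h
  have h1 : (fun u => ∫ x in Ioi u, (f - g) x) =o[atTop] fun u => ∫ x in Ioi u, g x :=
    isLittleO_integral_Ioi hg hg0 h
  refine h1.congr' ?_ EventuallyEq.rfl
  filter_upwards [eventually_ge_atTop a] with u hua
  exact integral_sub (hf.mono_set (Ioi_subset_Ioi hua)) (hg.mono_set (Ioi_subset_Ioi hua))

/-- If `f` differs from the derivative of `g` by an integrable function, then `exp (∫ f)` is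
asymptotic to a positive multiple of `exp g`. -/
lemma exists_exp_integral_isEquivalent {f g g' R : ℝ → ℝ} {a C : ℝ}
    (hf : ContinuousOn f (Ici a)) (hg : ∀ x, a ≤ x → HasDerivAt g (g' x) x)
    (hg' : ContinuousOn g' (Ici a)) (hR : IntegrableOn R (Ioi a))
    (hb : ∀ᶠ x in atTop, |f x - g' x| ≤ C * R x) :
    ∃ κ : ℝ, 0 < κ ∧ (fun y => exp (∫ z in a..y, f z)) ~[atTop] fun y => κ * exp (g y) := by
  have hfg : ContinuousOn (fun x => f x - g' x) (Ici a) := hf.sub hg'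
  have hint : IntegrableOn (fun x => f x - g' x) (Ioi a) := by
    obtain ⟨b, hb⟩ := eventually_atTop.1 hb
    rw [← Ioc_union_Ioi_eq_Ioi (le_max_left a b)]
    refine ((hfg.mono Icc_subset_Ici_self).integrableOn_Icc.mono_set Ioc_subset_Icc_self).union ?_
    refine Integrable.mono' ((hR.mono_set (Ioi_subset_Ioi (le_max_left a b))).const_mul C)
      ((hfg.mono ?_).aestronglyMeasurable measurableSet_Ioi) ?_
    · exact fun x hx => (le_max_left a b).trans (le_of_lt hx)
    · refine (ae_restrict_mem measurableSet_Ioi).mono fun x hx => ?_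
      exact hb x ((le_max_right a b).trans (le_of_lt hx))
  have hlim := intervalIntegral_tendsto_integral_Ioi a hint tendsto_id
  set l := ∫ x in Ioi a, (f x - g' x)
  refine ⟨exp (l - g a), exp_pos _, ?_⟩
  have hlim2 : Tendsto (fun y => exp ((∫ x in a..y, (f x - g' x)) - l)) atTop (𝓝 1) := by
    have := (continuous_exp.tendsto _).comp (hlim.sub_const l)
    simpa [Function.comp_def] using this
  refine isEquivalent_of_tendsto_one ?_
  refine hlim2.congr' ?_
  filter_upwards [eventually_ge_atTop a] with y hy
  have hsub : Set.uIcc a y ⊆ Ici a := by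
    rw [uIcc_of_le hy]; exact Icc_subset_Ici_self
  have i1 : IntervalIntegrable f volume a y := (hf.mono hsub).intervalIntegrable
  have i2 : IntervalIntegrable g' volume a y := (hg'.mono hsub).intervalIntegrable
  have e : ∫ x in a..y, g' x = g y - g a :=
    intervalIntegral.integral_eq_sub_of_hasDerivAt (fun x hx => hg x (hsub hx)) i2
  rw [intervalIntegral.integral_sub i1 i2, e, Pi.div_apply, ← exp_add, ← exp_sub]
  congr 1
  ring

/-! ### Entire power series with positive coefficients -/

/-- The sum of the power series with coefficients `c`. -/
noncomputable def powSum (c : ℕ → ℝ) (z : ℝ) : ℝ := ∑' n, c n * z ^ n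

/-- The coefficients of the derived power series. -/
noncomputable def derivCoeff (c : ℕ → ℝ) (n : ℕ) : ℝ := (n + 1) * c (n + 1)

/-- Coefficients that are positive and decrease superexponentially, so that the series converges
everywhere by the ratio test. -/
structure EntireCoeff (c : ℕ → ℝ) : Prop where
  pos : ∀ n, 0 < c n
  ratio : Tendsto (fun n => c (n + 1) / c n) atTop (𝓝 0)

lemma EntireCoeff.derivCoeff {c : ℕ → ℝ} (h : EntireCoeff c) : EntireCoeff (derivCoeff c) := by
  refine ⟨fun n => mul_pos (by positivity) (h.pos _), ?_⟩
  have h1 : Tendsto (fun n : ℕ => ((n : ℝ) + 1 + 1) / ((n : ℝ) + 1)) atTop (𝓝 1) := by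
    have h2 := (tendsto_one_div_add_atTop_nhds_zero_nat (𝕜 := ℝ)).const_add 1
    rw [add_zero] at h2
    refine h2.congr fun n => ?_
    have : (n : ℝ) + 1 ≠ 0 := by positivity
    field_simp
  have h3 := h1.mul (h.ratio.comp (tendsto_add_atTop_nat 1))
  rw [mul_zero] at h3
  refine h3.congr fun n => ?_
  simp only [_root_.derivCoeff, Function.comp]
  push_cast
  rw [div_mul_div_comm]

lemma EntireCoeff.summable {c : ℕ → ℝ} (h : EntireCoeff c) (z : ℝ) :
    Summable fun n => c n * z ^ n := by
  rcases eq_or_ne z 0 with rfl | hz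
  · refine summable_of_ne_finset_zero (s := {0}) fun n hn => ?_
    rw [zero_pow (by simpa using hn), mul_zero]
  refine summable_of_ratio_test_tendsto_lt_one zero_lt_one
    (Eventually.of_forall fun n => mul_ne_zero (h.pos n).ne' (pow_ne_zero _ hz)) ?_
  have := h.ratio.mul_const |z|
  rw [zero_mul] at this
  refine this.congr fun n => ?_
  have h1 := (h.pos n).ne'
  have h2 := abs_ne_zero.2 hz
  simp only [norm_mul, norm_pow, Real.norm_eq_abs, abs_of_pos (h.pos _)]
  field_simp
  ring

lemma EntireCoeff.hasSum {c : ℕ → ℝ} (h : EntireCoeff c) (z : ℝ) :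
    HasSum (fun n => c n * z ^ n) (powSum c z) := (h.summable z).hasSum

/-- Termwise differentiation; the differentiated series is dominated by its value at `|z| + 1` on the
unit ball around `z`. -/
lemma EntireCoeff.hasDerivAt {c : ℕ → ℝ} (h : EntireCoeff c) (z : ℝ) :
    HasDerivAt (powSum c) (powSum (_root_.derivCoeff c) z) z := by
  set R := |z| + 1 with hR
  have hu : Summable fun n : ℕ => c n * (n * R ^ (n - 1)) := by
    rw [← summable_nat_add_iff 1]
    refine (h.derivCoeff.summable R).congr fun n => ?_
    simp only [_root_.derivCoeff]
    push_cast
    ring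
  have hz : z ∈ Metric.ball (0 : ℝ) R := by simp [hR]
  have key := hasDerivAt_tsum_of_isPreconnected (t := Metric.ball (0 : ℝ) R)
    (g := fun n y => c n * y ^ n) (g' := fun n y => c n * (n * y ^ (n - 1)))
    (u := fun n : ℕ => c n * (n * R ^ (n - 1))) (y₀ := z) (y := z) hu
    Metric.isOpen_ball (convex_ball _ _).isPreconnected
    (fun n y _ => (hasDerivAt_pow n y).const_mul (c n)) (fun n y hy => ?_) hz (h.summable z) hz
  · refine key.congr_deriv ?_
    have hs : Summable fun n : ℕ => c n * (n * z ^ (n - 1)) := by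
      rw [← summable_nat_add_iff 1]
      refine (h.derivCoeff.summable z).congr fun n => ?_
      simp only [_root_.derivCoeff]
      push_cast
      ring
    rw [hs.tsum_eq_zero_add]
    simp only [CharP.cast_eq_zero, zero_mul, mul_zero, zero_add, Nat.add_sub_cancel]
    refine tsum_congr fun n => ?_
    simp only [_root_.derivCoeff]
    push_cast
    ring
  · have hy' : |y| ≤ R := by simpa using (Metric.mem_ball.1 hy).le
    rw [norm_mul, norm_mul, norm_pow, Real.norm_of_nonneg (h.pos n).le, Real.norm_natCast,
      Real.norm_eq_abs]
    have := (h.pos n).le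
    gcongr

lemma EntireCoeff.powSum_pos {c : ℕ → ℝ} (h : EntireCoeff c) {z : ℝ} (hz : 0 ≤ z) :
    0 < powSum c z := by
  refine (h.summable z).tsum_pos (fun n => mul_nonneg (h.pos n).le (pow_nonneg hz n)) 0 ?_
  simpa using h.pos 0

lemma EntireCoeff.hasSum_natCast_mul {c : ℕ → ℝ} (h : EntireCoeff c) (z : ℝ) :
    HasSum (fun n : ℕ => n * c n * z ^ n) (z * powSum (_root_.derivCoeff c) z) := by
  rw [← hasSum_nat_add_iff' 1]
  simp only [Finset.range_one, Finset.sum_singleton, CharP.cast_eq_zero, zero_mul, sub_zero]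
  refine ((h.derivCoeff.hasSum z).mul_left z).congr_fun fun n => ?_
  simp only [_root_.derivCoeff]
  push_cast
  ring

/-- A two-term recursion for the coefficients is a second-order equation for the sum. -/
lemma EntireCoeff.powSum_ode {c : ℕ → ℝ} (h : EntireCoeff c) {b α β : ℝ}
    (hrec : ∀ n : ℕ, ((n : ℝ) + 1) * (n + b) * c (n + 1) = (α * n + β) * c n) (z : ℝ) :
    z * powSum (_root_.derivCoeff (_root_.derivCoeff c)) z + b * powSum (_root_.derivCoeff c) z
      = α * (z * powSum (_root_.derivCoeff c) z) + β * powSum c z := by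
  have h1 := (h.derivCoeff.hasSum_natCast_mul z).add ((h.derivCoeff.hasSum z).mul_left b)
  have h2 := ((h.hasSum_natCast_mul z).mul_left α).add ((h.hasSum z).mul_left β)
  refine h1.unique (h2.congr_fun fun n => ?_)
  simp only [_root_.derivCoeff]
  linear_combination z ^ n * hrec n

lemma entireCoeff_of_recursion {c : ℕ → ℝ} {b α β : ℝ} (hb : 0 < b) (hpos : ∀ n, 0 < c n)
    (hrec : ∀ n : ℕ, ((n : ℝ) + 1) * (n + b) * c (n + 1) = (α * n + β) * c n) :
    EntireCoeff c := by
  refine ⟨hpos, ?_⟩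
  have h1 : Tendsto (fun n : ℕ => ((n : ℝ) + b)⁻¹) atTop (𝓝 0) :=
    tendsto_inv_atTop_zero.comp (tendsto_atTop_add_const_right _ b tendsto_natCast_atTop_atTop)
  have h2 := ((h1.const_mul (β - α * b)).const_add α).mul
    (tendsto_one_div_add_atTop_nhds_zero_nat (𝕜 := ℝ))
  rw [mul_zero] at h2
  refine h2.congr fun n => ?_
  have h3 : (n : ℝ) + b ≠ 0 := by positivity
  have h4 : (n : ℝ) + 1 ≠ 0 := by positivity
  have h5 := (hpos n).ne'
  have h6 : c (n + 1) = (α * n + β) * c n / (((n : ℝ) + 1) * (n + b)) := by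
    rw [eq_div_iff (mul_ne_zero h4 h3), ← hrec n]
    ring
  rw [h6]
  field_simp
  ring

/-! ### Laplace-type integrals -/

/-- The weights `w` for which `∫₀^∞ e^{-xφ(t)} w(t) dt` converges for all `x > 0`. -/
def LaplaceIntegrable (φ w : ℝ → ℝ) : Prop :=
  ∀ x, 0 < x → IntegrableOn (fun t => exp (-(x * φ t)) * w t) (Ioi 0)

/-- The factor `φ` is absorbed by half of the exponential: `φ e^{-xφ/2} ≤ 2 / x`. -/
lemma LaplaceIntegrable.mul_phase {φ w : ℝ → ℝ} (hφ : Measurable φ)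
    (hφ0 : ∀ t, 0 < t → 0 ≤ φ t) (hw : LaplaceIntegrable φ w) :
    LaplaceIntegrable φ (fun t => φ t * w t) := by
  intro x hx
  have h1 := (hw (x / 2) (by positivity)).norm.const_mul (2 / x)
  refine Integrable.mono' h1 ?_ ?_
  · have h2 := (hw x hx).aestronglyMeasurable.mul
      (hφ.aestronglyMeasurable (μ := volume.restrict (Ioi 0)))
    refine h2.congr (Eventually.of_forall fun t => ?_)
    simp only [Pi.mul_apply]
    ring
  · refine (ae_restrict_mem measurableSet_Ioi).mono fun t ht => ?_
    have h3 := hφ0 t ht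
    have h4 : x / 2 * φ t ≤ exp (x / 2 * φ t) := by
      linarith [add_one_le_exp (x / 2 * φ t)]
    have h5 : exp (-(x * φ t)) = exp (-(x / 2 * φ t)) * exp (-(x / 2 * φ t)) := by
      rw [← exp_add]; congr 1; ring
    rw [norm_mul, norm_mul, norm_mul, Real.norm_of_nonneg (exp_pos _).le,
      Real.norm_of_nonneg (exp_pos _).le, Real.norm_of_nonneg h3, h5]
    have h6 : exp (-(x / 2 * φ t)) * φ t ≤ 2 / x := by
      rw [exp_neg, inv_mul_le_iff₀ (exp_pos _), ← mul_div_assoc, le_div_iff₀ hx]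
      linarith
    calc exp (-(x / 2 * φ t)) * exp (-(x / 2 * φ t)) * (φ t * ‖w t‖)
        = (exp (-(x / 2 * φ t)) * φ t) * (exp (-(x / 2 * φ t)) * ‖w t‖) := by ring
      _ ≤ 2 / x * (exp (-(x / 2 * φ t)) * ‖w t‖) := by gcongr

/-- Differentiation under the integral sign, the parameter staying above `x / 2`. -/
lemma LaplaceIntegrable.hasDerivAt {φ w : ℝ → ℝ} (hφ : Measurable φ)
    (hφ0 : ∀ t, 0 < t → 0 ≤ φ t) (hw : LaplaceIntegrable φ w) {x : ℝ} (hx : 0 < x) :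
    HasDerivAt (fun x => ∫ t in Ioi (0 : ℝ), exp (-(x * φ t)) * w t)
      (-∫ t in Ioi (0 : ℝ), exp (-(x * φ t)) * (φ t * w t)) x := by
  have hw' := hw.mul_phase hφ hφ0
  have := (hasDerivAt_integral_of_dominated_loc_of_deriv_le (μ := volume.restrict (Ioi (0 : ℝ)))
    (F := fun x t => exp (-(x * φ t)) * w t)
    (F' := fun x t => -(exp (-(x * φ t)) * (φ t * w t)))
    (bound := fun t => ‖exp (-(x / 2 * φ t)) * (φ t * w t)‖)
    (Metric.ball_mem_nhds x (half_pos hx)) ?_ (hw x hx) (hw' x hx).aestronglyMeasurable.neg ?_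
    (hw' (x / 2) (half_pos hx)).norm ?_).2
  · rwa [integral_neg] at this
  · filter_upwards [lt_mem_nhds hx] with y hy
    exact (hw y hy).aestronglyMeasurable
  · refine (ae_restrict_mem measurableSet_Ioi).mono fun t ht y hy => ?_
    have h3 := hφ0 t ht
    have hy' : x / 2 ≤ y := by
      rw [Metric.mem_ball, Real.dist_eq] at hy
      linarith [(abs_lt.1 hy).1]
    rw [norm_neg, norm_mul, norm_mul _ (φ t * w t), Real.norm_of_nonneg (exp_pos _).le,
      Real.norm_of_nonneg (exp_pos _).le]
    gcongr
  · refine Eventually.of_forall fun t y _ => ?_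
    have h1 : HasDerivAt (fun y : ℝ => -(y * φ t)) (-φ t) y := by
      simpa using! ((hasDerivAt_id y).mul_const (φ t)).neg
    exact (h1.exp.mul_const (w t)).congr_deriv (by ring)

/-! ### Kummer functions -/

/-- The coefficients of the power series `M(a, b, ·)`. -/
noncomputable def kummerCoeff (a b : ℝ) (n : ℕ) : ℝ :=
  (ascPochhammer ℝ n).eval a / (ascPochhammer ℝ n).eval b / (n.factorial : ℝ)

lemma kummerM_eq_powSum (a b : ℝ) : kummerM a b = powSum (kummerCoeff a b) := by
  funext z
  refine tsum_congr fun n => ?_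
  rw [kummerCoeff]
  ring

lemma kummerCoeff_recursion {a b : ℝ} (hb : 0 < b) (n : ℕ) :
    ((n : ℝ) + 1) * (n + b) * kummerCoeff a b (n + 1) = (1 * n + a) * kummerCoeff a b n := by
  have h1 := (ascPochhammer_pos n b hb).ne'
  have h2 : b + n ≠ 0 := by positivity
  have h3 : ((n.factorial : ℕ) : ℝ) ≠ 0 := by positivity
  have h4 : (n : ℝ) + 1 ≠ 0 := by positivity
  simp only [kummerCoeff, ascPochhammer_succ_eval, Nat.factorial_succ]
  push_cast
  field_simp
  ring

lemma entireCoeff_kummerCoeff {a b : ℝ} (ha : 0 < a) (hb : 0 < b) :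
    EntireCoeff (kummerCoeff a b) :=
  entireCoeff_of_recursion hb
    (fun n => div_pos (div_pos (ascPochhammer_pos n a ha) (ascPochhammer_pos n b hb))
      (by positivity)) (kummerCoeff_recursion hb)

/-- Compare the series termwise, with `(b)ₙ ≤ (a)ₙ`. -/
lemma exp_le_kummerM {a b z : ℝ} (hb : 0 < b) (hab : b ≤ a) (hz : 0 ≤ z) :
    exp z ≤ kummerM a b z := by
  have hpoch : ∀ n : ℕ, (ascPochhammer ℝ n).eval b ≤ (ascPochhammer ℝ n).eval a := by
    intro n
    induction n with
    | zero => simp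
    | succ n ih =>
      rw [ascPochhammer_succ_eval, ascPochhammer_succ_eval]
      exact mul_le_mul ih (by linarith) (by positivity) (ascPochhammer_pos n a (by linarith)).le
  have h1 : HasSum (fun n : ℕ => z ^ n / (n.factorial : ℝ)) (exp z) := by
    rw [Real.exp_eq_exp_ℝ]
    exact NormedSpace.expSeries_div_hasSum_exp z
  rw [kummerM_eq_powSum]
  refine hasSum_le (fun n => ?_) h1 ((entireCoeff_kummerCoeff (hb.trans_le hab) hb).hasSum z)
  rw [kummerCoeff, div_mul_eq_mul_div]
  have h2 : 1 ≤ (ascPochhammer ℝ n).eval a / (ascPochhammer ℝ n).eval b := by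
    rw [one_le_div (ascPochhammer_pos n b hb)]
    exact hpoch n
  gcongr
  exact le_mul_of_one_le_left (pow_nonneg hz n) h2

/-- The weight of the integral representation of `U(a, b, ·)`. -/
noncomputable def kummerWeight (a b t : ℝ) : ℝ := t ^ (a - 1) * (1 + t) ^ (b - a - 1)

/-- The Laplace transform of `t ^ k` times the weight of `U(a, b, ·)`. -/
noncomputable def kummerLaplace (k : ℕ) (a b z : ℝ) : ℝ :=
  ∫ t in Ioi (0 : ℝ), exp (-(z * t)) * (t ^ k * kummerWeight a b t)

lemma kummerU_eq (a b z : ℝ) : kummerU a b z = (Real.Gamma a)⁻¹ * kummerLaplace 0 a b z := by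
  simp only [kummerU, kummerLaplace, kummerWeight, pow_zero, one_mul, mul_assoc]

lemma kummerWeight_pos {a b t : ℝ} (ht : 0 < t) : 0 < kummerWeight a b t :=
  mul_pos (rpow_pos_of_pos ht _) (rpow_pos_of_pos (by linarith) _)

lemma measurable_kummerWeight (a b : ℝ) : Measurable (kummerWeight a b) := by
  unfold kummerWeight; fun_prop

lemma integrableOn_exp_neg_mul_rpow {z s : ℝ} (hz : 0 < z) (hs : -1 < s) :
    IntegrableOn (fun t : ℝ => exp (-(z * t)) * t ^ s) (Ioi 0) := by
  have := integrableOn_rpow_mul_exp_neg_mul_rpow hs one_pos hz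
  refine this.congr_fun (fun t _ => ?_) measurableSet_Ioi
  simp only [rpow_one]
  rw [mul_comm, neg_mul]

lemma laplaceIntegrable_kummerWeight {a b : ℝ} (ha : 0 < a) (hab : b ≤ a + 1) (k : ℕ) :
    LaplaceIntegrable (fun t => t) (fun t => t ^ k * kummerWeight a b t) := by
  induction k with
  | zero =>
    intro z hz
    refine Integrable.mono' (integrableOn_exp_neg_mul_rpow hz (s := a - 1) (by linarith)) ?_ ?_
    · have := measurable_kummerWeight a b
      exact Measurable.aestronglyMeasurable (by fun_prop)
    · refine (ae_restrict_mem measurableSet_Ioi).mono fun t (ht : 0 < t) => ?_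
      simp only [pow_zero, one_mul]
      rw [Real.norm_of_nonneg (mul_nonneg (exp_pos _).le (kummerWeight_pos ht).le)]
      refine mul_le_mul_of_nonneg_left ?_ (exp_pos _).le
      exact mul_le_of_le_one_right (rpow_pos_of_pos ht _).le
        (rpow_le_one_of_one_le_of_nonpos (by linarith) (by linarith))
  | succ k ih =>
    have := ih.mul_phase measurable_id (fun t ht => ht.le)
    refine fun z hz => (this z hz).congr_fun (fun t _ => ?_) measurableSet_Ioi
    simp only [id]
    ring

lemma hasDerivAt_kummerLaplace {a b z : ℝ} (ha : 0 < a) (hab : b ≤ a + 1) (hz : 0 < z) (k : ℕ) :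
    HasDerivAt (kummerLaplace k a b) (-kummerLaplace (k + 1) a b z) z := by
  refine ((laplaceIntegrable_kummerWeight ha hab k).hasDerivAt measurable_id
    (fun t ht => ht.le) hz).congr_deriv ?_
  rw [kummerLaplace]
  congr 1
  refine integral_congr_ae (Eventually.of_forall fun t => ?_)
  simp only [id]
  ring

lemma kummerLaplace_pos {a b z : ℝ} (ha : 0 < a) (hab : b ≤ a + 1) (hz : 0 < z) (k : ℕ) :
    0 < kummerLaplace k a b z :=
  integral_Ioi_pos (laplaceIntegrable_kummerWeight ha hab k z hz) fun _ ht =>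
    mul_pos (exp_pos _) (mul_pos (pow_pos ht k) (kummerWeight_pos ht))

/-- Kummer's equation for the Laplace transforms: the integral over `(0, ∞)` of the derivative of
`e^{-zt} t^a (1+t)^{b-a}` vanishes. -/
lemma kummerLaplace_ode {a b z : ℝ} (ha : 0 < a) (hab : b ≤ a + 1) (hz : 0 < z) :
    z * kummerLaplace 2 a b z - (b - z) * kummerLaplace 1 a b z - a * kummerLaplace 0 a b z
      = 0 := by
  have hi : ∀ k : ℕ, IntegrableOn (fun t : ℝ => exp (-(z * t)) * (t ^ k * kummerWeight a b t))
      (Ioi 0) := fun k => laplaceIntegrable_kummerWeight ha hab k z hz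
  set F : ℝ → ℝ := fun t => exp (-(z * t)) * (t ^ a * (1 + t) ^ (b - a))
  set F' : ℝ → ℝ := fun t =>
    a * (exp (-(z * t)) * (t ^ 0 * kummerWeight a b t))
      + (b - z) * (exp (-(z * t)) * (t ^ 1 * kummerWeight a b t))
      - z * (exp (-(z * t)) * (t ^ 2 * kummerWeight a b t))
  have hF₁ : IntegrableOn (fun t => a * (exp (-(z * t)) * (t ^ 0 * kummerWeight a b t))
      + (b - z) * (exp (-(z * t)) * (t ^ 1 * kummerWeight a b t))) (Ioi 0) :=
    ((hi 0).const_mul a).add ((hi 1).const_mul (b - z))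
  have hF' : IntegrableOn F' (Ioi 0) := hF₁.sub ((hi 2).const_mul z)
  have hd : ∀ t ∈ Ioi (0 : ℝ), HasDerivAt F (F' t) t := by
    intro t ht
    have ht : 0 < t := ht
    have h1 : HasDerivAt (fun t : ℝ => -(z * t)) (-z) t := by
      simpa using! ((hasDerivAt_id t).const_mul z).neg
    have h2 : HasDerivAt (fun t : ℝ => t ^ a) (a * t ^ (a - 1)) t :=
      hasDerivAt_rpow_const (Or.inl ht.ne')
    have h3 : HasDerivAt (fun t : ℝ => (1 + t) ^ (b - a)) ((b - a) * (1 + t) ^ (b - a - 1)) t := by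
      have := ((hasDerivAt_id t).const_add 1).rpow_const (p := b - a)
        (Or.inl (by simp only [id]; positivity))
      simpa using! this
    refine (h1.exp.mul (h2.mul h3)).congr_deriv ?_
    have e1 : t ^ a = t ^ (a - 1) * t := by
      rw [← rpow_add_one ht.ne', sub_add_cancel]
    have e2 : (1 + t) ^ (b - a) = (1 + t) ^ (b - a - 1) * (1 + t) := by
      rw [← rpow_add_one (by positivity), sub_add_cancel]
    simp only [F', kummerWeight, Pi.mul_apply]
    rw [e1, e2]
    ring
  have hc : ContinuousWithinAt F (Ici 0) 0 := by
    refine ContinuousAt.continuousWithinAt ?_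
    refine ContinuousAt.mul (by fun_prop) (ContinuousAt.mul ?_ ?_)
    · exact continuousAt_rpow_const _ _ (Or.inr ha.le)
    · exact ContinuousAt.rpow_const (by fun_prop) (Or.inl (by norm_num))
  have hlim : Tendsto F atTop (𝓝 0) := by
    have h1 := (tendsto_rpow_mul_exp_neg_mul_atTop_nhds_zero a z hz).add
      (tendsto_rpow_mul_exp_neg_mul_atTop_nhds_zero (a + 1) z hz)
    rw [add_zero] at h1
    refine squeeze_zero' ?_ ?_ h1
    · filter_upwards [eventually_gt_atTop 0] with t ht
      exact mul_nonneg (exp_pos _).le (mul_nonneg (rpow_nonneg ht.le _) (rpow_nonneg (by linarith) _))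
    · filter_upwards [eventually_gt_atTop 0] with t ht
      have h2 : (1 + t) ^ (b - a) ≤ 1 + t := by
        calc (1 + t) ^ (b - a) ≤ (1 + t) ^ (1 : ℝ) :=
              rpow_le_rpow_of_exponent_le (by linarith) (by linarith)
          _ = 1 + t := rpow_one _
      have h3 := rpow_nonneg ht.le a
      calc F t ≤ exp (-(z * t)) * (t ^ a * (1 + t)) := by
            simp only [F]; gcongr
        _ = _ := by
            rw [rpow_add_one ht.ne', neg_mul]; ring
  have h0 : F 0 = 0 := by simp [F, zero_rpow ha.ne']
  have key := integral_Ioi_of_hasDerivAt_of_tendsto hc hd hF' hlim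
  rw [h0, sub_zero] at key
  have e : ∫ t in Ioi (0 : ℝ), F' t = a * kummerLaplace 0 a b z + (b - z) * kummerLaplace 1 a b z
      - z * kummerLaplace 2 a b z := by
    simp only [F']
    rw [integral_sub hF₁ ((hi 2).const_mul z),
      integral_add ((hi 0).const_mul a) ((hi 1).const_mul (b - z)), integral_const_mul,
      integral_const_mul, integral_const_mul]
    rfl
  rw [e] at key
  linarith

/-- `U(a, b, z) ~ z^{-a}` as `z → ∞`. -/
lemma tendsto_rpow_mul_kummerU {a b : ℝ} (ha : 0 < a) (hab : b ≤ a + 1) :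
    Tendsto (fun z => z ^ a * kummerU a b z) atTop (𝓝 1) := by
  have h1 : Tendsto (fun z : ℝ => ∫ x in Ioi (0 : ℝ),
      exp (-x) * x ^ (a - 1) * (1 + x / z) ^ (b - a - 1)) atTop (𝓝 (∫ x in Ioi (0 : ℝ),
      exp (-x) * x ^ (a - 1) * 1)) := by
    refine tendsto_integral_filter_of_dominated_convergence
      (fun x => exp (-x) * x ^ (a - 1)) ?_ ?_ ?_ ?_
    · exact Eventually.of_forall fun z => Measurable.aestronglyMeasurable (by fun_prop)
    · filter_upwards [eventually_gt_atTop 0] with z hz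
      refine (ae_restrict_mem measurableSet_Ioi).mono fun x (hx : 0 < x) => ?_
      have h2 : 0 ≤ x / z := by positivity
      rw [Real.norm_of_nonneg (by positivity)]
      exact mul_le_of_le_one_right (by positivity)
        (rpow_le_one_of_one_le_of_nonpos (by linarith) (by linarith))
    · exact Real.GammaIntegral_convergent ha
    · refine (ae_restrict_mem measurableSet_Ioi).mono fun x (hx : 0 < x) => ?_
      refine Tendsto.const_mul _ ?_
      have h3 : Tendsto (fun z : ℝ => 1 + x / z) atTop (𝓝 1) := by
        simpa using (tendsto_const_nhds.div_atTop tendsto_id).const_add (1 : ℝ)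
      simpa using h3.rpow_const (p := b - a - 1) (Or.inl one_ne_zero)
  simp only [mul_one] at h1
  rw [← Real.Gamma_eq_integral ha] at h1
  have h4 := h1.const_mul (Real.Gamma a)⁻¹
  rw [inv_mul_cancel₀ (Real.Gamma_pos_of_pos ha).ne'] at h4
  refine h4.congr' ?_
  filter_upwards [eventually_gt_atTop 0] with z hz
  rw [kummerU, mul_left_comm]
  congr 1
  have h5 := integral_comp_mul_left_Ioi
    (fun x : ℝ => exp (-x) * (x / z) ^ (a - 1) * (1 + x / z) ^ (b - a - 1)) 0 hz
  simp only [mul_zero, smul_eq_mul, mul_div_cancel_left₀ _ hz.ne'] at h5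
  rw [h5, ← mul_assoc, ← integral_const_mul]
  refine setIntegral_congr_fun measurableSet_Ioi fun x (hx : 0 < x) => ?_
  rw [div_rpow hx.le hz.le, rpow_sub_one hz.ne' a]
  have := rpow_pos_of_pos hz a
  field_simp

/-! ### Linear premium and Kummer-type solutions -/

lemma linPremium_pos {c ε u : ℝ} (hc : 0 < c) (hε : 0 < ε) (hu : 0 ≤ u) :
    0 < linPremium c ε u := by
  unfold linPremium; positivity

lemma hasDerivAt_linPremium (c ε u : ℝ) : HasDerivAt (linPremium c ε) ε u := by
  exact (((hasDerivAt_id u).const_mul ε).const_add c).congr_deriv (mul_one ε)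

lemma continuous_linPremium (c ε : ℝ) : Continuous (linPremium c ε) := by
  unfold linPremium; fun_prop

lemma tendsto_linPremium_atTop {c ε : ℝ} (hε : 0 < ε) :
    Tendsto (linPremium c ε) atTop atTop :=
  tendsto_atTop_add_const_left _ _ (tendsto_id.const_mul_atTop hε)

lemma hasDerivAt_linPremium_rpow {c ε u : ℝ} (s : ℝ) (hp : 0 < linPremium c ε u) :
    HasDerivAt (fun u => linPremium c ε u ^ s)
      (linPremium c ε u ^ s * (ε * s / linPremium c ε u)) u := by
  refine ((hasDerivAt_linPremium c ε u).rpow_const (p := s) (Or.inl hp.ne')).congr_deriv ?_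
  rw [rpow_sub_one hp.ne']
  ring

lemma hasDerivAt_exp_neg_mul (μ u : ℝ) :
    HasDerivAt (fun u => exp (-(μ * u))) (-μ * exp (-(μ * u))) u := by
  have h1 : HasDerivAt (fun u : ℝ => -(μ * u)) (-μ) u := by
    simpa using! ((hasDerivAt_id u).const_mul μ).neg
  exact h1.exp.congr_deriv (by ring)

/-- The function `e^{-μu} p^s F(μp/ε)`. -/
noncomputable def expPowMul (μ c ε s : ℝ) (F : ℝ → ℝ) (u : ℝ) : ℝ :=
  exp (-(μ * u)) * linPremium c ε u ^ s * F (μ * linPremium c ε u / ε)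

/-- The derivative of `e^{-μu} p^s F(μp/ε)`, when `F'` is the derivative of `F`. -/
noncomputable def expPowMulDeriv (μ c ε s : ℝ) (F F' : ℝ → ℝ) (u : ℝ) : ℝ :=
  exp (-(μ * u)) * linPremium c ε u ^ s *
    (μ * F' (μ * linPremium c ε u / ε)
      + (ε * s / linPremium c ε u - μ) * F (μ * linPremium c ε u / ε))

/-- The second derivative of `e^{-μu} p^s F(μp/ε)`. -/
noncomputable def expPowMulDeriv₂ (μ c ε s : ℝ) (F F' F'' : ℝ → ℝ) (u : ℝ) : ℝ :=
  exp (-(μ * u)) * linPremium c ε u ^ s *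
    (μ ^ 2 * F'' (μ * linPremium c ε u / ε)
      + 2 * μ * (ε * s / linPremium c ε u - μ) * F' (μ * linPremium c ε u / ε)
      + ((ε * s / linPremium c ε u - μ) ^ 2 - ε ^ 2 * s / linPremium c ε u ^ 2)
        * F (μ * linPremium c ε u / ε))

lemma hasDerivAt_comp_linPremium {μ c ε : ℝ} (hε : 0 < ε) {F : ℝ → ℝ} {d u : ℝ}
    (hF : HasDerivAt F d (μ * linPremium c ε u / ε)) :
    HasDerivAt (fun u => F (μ * linPremium c ε u / ε)) (μ * d) u := by
  have h1 : HasDerivAt (fun u => μ * linPremium c ε u / ε) μ u := by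
    refine (((hasDerivAt_linPremium c ε u).const_mul μ).div_const ε).congr_deriv ?_
    field_simp
  exact (hF.comp u h1).congr_deriv (by ring)

lemma hasDerivAt_expPowMul {μ c ε s : ℝ} (hε : 0 < ε) {F F' : ℝ → ℝ} {u : ℝ}
    (hp : 0 < linPremium c ε u)
    (hF : HasDerivAt F (F' (μ * linPremium c ε u / ε)) (μ * linPremium c ε u / ε)) :
    HasDerivAt (expPowMul μ c ε s F) (expPowMulDeriv μ c ε s F F' u) u := by
  refine (((hasDerivAt_exp_neg_mul μ u).mul (hasDerivAt_linPremium_rpow s hp)).mul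
    (hasDerivAt_comp_linPremium hε hF)).congr_deriv ?_
  simp only [expPowMulDeriv, Pi.mul_apply]
  ring

lemma hasDerivAt_expPowMulDeriv {μ c ε s : ℝ} (hε : 0 < ε) {F F' F'' : ℝ → ℝ} {u : ℝ}
    (hp : 0 < linPremium c ε u)
    (hF : HasDerivAt F (F' (μ * linPremium c ε u / ε)) (μ * linPremium c ε u / ε))
    (hF' : HasDerivAt F' (F'' (μ * linPremium c ε u / ε)) (μ * linPremium c ε u / ε)) :
    HasDerivAt (expPowMulDeriv μ c ε s F F') (expPowMulDeriv₂ μ c ε s F F' F'' u) u := by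
  have h1 : HasDerivAt (fun u => ε * s / linPremium c ε u - μ)
      (-(ε ^ 2 * s / linPremium c ε u ^ 2)) u := by
    refine (((hasDerivAt_linPremium c ε u).inv hp.ne').const_mul (ε * s)).sub_const μ |>.congr_deriv ?_
    field_simp
  refine (((hasDerivAt_exp_neg_mul μ u).mul (hasDerivAt_linPremium_rpow s hp)).mul
    (((hasDerivAt_comp_linPremium hε hF').const_mul μ).add
      (h1.mul (hasDerivAt_comp_linPremium hε hF)))).congr_deriv ?_
  simp only [expPowMulDeriv₂, Pi.mul_apply, Pi.add_apply]
  ring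

/-- Kummer's equation `zF'' + (b-z)F' - aF = 0` for `F` becomes
`p²h'' + (β p + μp²)h' + (γ₀ + γ₁p)h = 0` for `h = e^{-μu} p^s F(μp/ε)`. -/
lemma expPowMul_ode {μ c ε s a b β γ₀ γ₁ : ℝ} (hε : 0 < ε) {F F' F'' : ℝ → ℝ} {u : ℝ}
    (hp : 0 < linPremium c ε u) (hβ : β = ε * (b - 2 * s))
    (hγ₀ : ε ^ 2 * s ^ 2 - ε ^ 2 * s + β * ε * s + γ₀ = 0)
    (hγ₁ : γ₁ - β * μ - ε * s * μ = -(a * ε * μ))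
    (hF : ∀ z, 0 < z → z * F'' z + (b - z) * F' z - a * F z = 0) (hμ : 0 < μ) :
    linPremium c ε u ^ 2 * expPowMulDeriv₂ μ c ε s F F' F'' u
      + (β * linPremium c ε u + μ * linPremium c ε u ^ 2) * expPowMulDeriv μ c ε s F F' u
      + (γ₀ + γ₁ * linPremium c ε u) * expPowMul μ c ε s F u = 0 := by
  have h1 := hF (μ * linPremium c ε u / ε) (by positivity)
  simp only [expPowMulDeriv₂, expPowMulDeriv, expPowMul]
  set p := linPremium c ε u
  set G := F (μ * p / ε)
  set G' := F' (μ * p / ε)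
  set G'' := F'' (μ * p / ε)
  have h2 : ε * s / p * p = ε * s := div_mul_cancel₀ _ hp.ne'
  have h3 : ε ^ 2 * s / p ^ 2 * p ^ 2 = ε ^ 2 * s := div_mul_cancel₀ _ (pow_pos hp 2).ne'
  have h4 : μ * p * G'' + (b * ε - μ * p) * G' - a * ε * G = 0 := by
    have h5 : μ * p / ε * ε = μ * p := div_mul_cancel₀ _ hε.ne'
    linear_combination ε * h1 + (G' - G'') * h5
  have h6 : p ^ 2 * (μ ^ 2 * G'' + 2 * μ * (ε * s / p - μ) * G'
        + ((ε * s / p - μ) ^ 2 - ε ^ 2 * s / p ^ 2) * G)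
      + (β * p + μ * p ^ 2) * (μ * G' + (ε * s / p - μ) * G)
      + (γ₀ + γ₁ * p) * G = 0 := by
    have h7 : ε * s / p = ε * s * p⁻¹ := div_eq_mul_inv _ _
    have h8 : p * p⁻¹ = 1 := mul_inv_cancel₀ hp.ne'
    have e1 : p ^ 2 * (2 * μ * (ε * s / p - μ)) = 2 * μ * p * (ε * s - μ * p) := by
      linear_combination 2 * μ * p * h2
    have e2 : p ^ 2 * ((ε * s / p - μ) ^ 2 - ε ^ 2 * s / p ^ 2)
        = (ε * s - μ * p) ^ 2 - ε ^ 2 * s := by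
      linear_combination (ε * s / p * p + ε * s - 2 * μ * p) * h2 - h3
    have e3 : (β * p + μ * p ^ 2) * (ε * s / p - μ) = (β + μ * p) * (ε * s - μ * p) := by
      linear_combination (β + μ * p) * h2
    linear_combination G' * e1 + G * e2 + G * e3 + μ * p * h4 + μ * p * G' * hβ + G * hγ₀
      + p * G * hγ₁
  linear_combination exp (-(μ * u)) * p ^ s * h6

section KummerSolutions

variable {μ c ε s a b : ℝ}

/-- The derivative of `M(a, b, ·)`. -/
noncomputable def kummerMDeriv (a b : ℝ) : ℝ → ℝ := powSum (derivCoeff (kummerCoeff a b))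

/-- The second derivative of `M(a, b, ·)`. -/
noncomputable def kummerMDeriv₂ (a b : ℝ) : ℝ → ℝ :=
  powSum (derivCoeff (derivCoeff (kummerCoeff a b)))

/-- The derivative of `U(a, b, ·)`. -/
noncomputable def kummerUDeriv (a b z : ℝ) : ℝ := -((Real.Gamma a)⁻¹ * kummerLaplace 1 a b z)

/-- The second derivative of `U(a, b, ·)`. -/
noncomputable def kummerUDeriv₂ (a b z : ℝ) : ℝ := (Real.Gamma a)⁻¹ * kummerLaplace 2 a b z

lemma hasDerivAt_kummerM (ha : 0 < a) (hb : 0 < b) (z : ℝ) :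
    HasDerivAt (kummerM a b) (kummerMDeriv a b z) z := by
  rw [kummerM_eq_powSum]
  exact (entireCoeff_kummerCoeff ha hb).hasDerivAt z

lemma hasDerivAt_kummerMDeriv (ha : 0 < a) (hb : 0 < b) (z : ℝ) :
    HasDerivAt (kummerMDeriv a b) (kummerMDeriv₂ a b z) z :=
  (entireCoeff_kummerCoeff ha hb).derivCoeff.hasDerivAt z

lemma kummerM_ode (ha : 0 < a) (hb : 0 < b) (z : ℝ) :
    z * kummerMDeriv₂ a b z + (b - z) * kummerMDeriv a b z - a * kummerM a b z = 0 := by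
  have := (entireCoeff_kummerCoeff ha hb).powSum_ode (kummerCoeff_recursion hb) z
  rw [← kummerM_eq_powSum] at this
  simp only [kummerMDeriv, kummerMDeriv₂]
  linarith

lemma hasDerivAt_kummerU (ha : 0 < a) (hab : b ≤ a + 1) {z : ℝ} (hz : 0 < z) :
    HasDerivAt (kummerU a b) (kummerUDeriv a b z) z := by
  have : kummerU a b = fun z => (Real.Gamma a)⁻¹ * kummerLaplace 0 a b z :=
    funext fun z => kummerU_eq a b z
  rw [this]
  exact ((hasDerivAt_kummerLaplace ha hab hz 0).const_mul _).congr_deriv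
    (by simp [kummerUDeriv])

lemma hasDerivAt_kummerUDeriv (ha : 0 < a) (hab : b ≤ a + 1) {z : ℝ} (hz : 0 < z) :
    HasDerivAt (kummerUDeriv a b) (kummerUDeriv₂ a b z) z :=
  ((hasDerivAt_kummerLaplace ha hab hz 1).const_mul _).neg.congr_deriv (by simp [kummerUDeriv₂])

lemma kummerU_ode (ha : 0 < a) (hab : b ≤ a + 1) {z : ℝ} (hz : 0 < z) :
    z * kummerUDeriv₂ a b z + (b - z) * kummerUDeriv a b z - a * kummerU a b z = 0 := by
  rw [kummerU_eq]
  simp only [kummerUDeriv, kummerUDeriv₂]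
  linear_combination (Real.Gamma a)⁻¹ * kummerLaplace_ode ha hab hz

lemma kummerU_pos (ha : 0 < a) (hab : b ≤ a + 1) {z : ℝ} (hz : 0 < z) : 0 < kummerU a b z := by
  rw [kummerU_eq]
  exact mul_pos (inv_pos.2 (Real.Gamma_pos_of_pos ha)) (kummerLaplace_pos ha hab hz 0)

lemma kummerUDeriv_neg (ha : 0 < a) (hab : b ≤ a + 1) {z : ℝ} (hz : 0 < z) :
    kummerUDeriv a b z < 0 :=
  neg_lt_zero.2 (mul_pos (inv_pos.2 (Real.Gamma_pos_of_pos ha)) (kummerLaplace_pos ha hab hz 1))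

lemma kummerM_pos (ha : 0 < a) (hb : 0 < b) {z : ℝ} (hz : 0 ≤ z) : 0 < kummerM a b z := by
  rw [kummerM_eq_powSum]
  exact (entireCoeff_kummerCoeff ha hb).powSum_pos hz

lemma kummerMDeriv_pos (ha : 0 < a) (hb : 0 < b) {z : ℝ} (hz : 0 ≤ z) : 0 < kummerMDeriv a b z :=
  (entireCoeff_kummerCoeff ha hb).derivCoeff.powSum_pos hz

/-- The functions `e^{-μu} p^s M(a, b, μp/ε)` and `e^{-μu} p^s U(a, b, μp/ε)` span the solutions
of the equation that Kummer's equation becomes. -/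
lemma solvesODE_iff_kummerSol (hμ : 0 < μ) (hc : 0 < c) (hε : 0 < ε) (ha : 0 < a) (hb : 0 < b)
    (hab : b ≤ a + 1) {a₂ a₁ a₀ : ℝ → ℝ} {β γ₀ γ₁ : ℝ}
    (h₂ : ∀ u, a₂ u = linPremium c ε u ^ 2)
    (h₁ : ∀ u, a₁ u = β * linPremium c ε u + μ * linPremium c ε u ^ 2)
    (h₀ : ∀ u, a₀ u = γ₀ + γ₁ * linPremium c ε u) (hβ : β = ε * (b - 2 * s))
    (hγ₀ : ε ^ 2 * s ^ 2 - ε ^ 2 * s + β * ε * s + γ₀ = 0)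
    (hγ₁ : γ₁ - β * μ - ε * s * μ = -(a * ε * μ)) (h : ℝ → ℝ) :
    SolvesODE a₂ a₁ a₀ h ↔ ∃ C₁ C₂ : ℝ, ∀ u, 0 ≤ u →
      h u = C₁ * kummerSolM μ c ε s a b u + C₂ * kummerSolU μ c ε s a b u := by
  have hp : ∀ u, 0 ≤ u → 0 < linPremium c ε u := fun u hu => linPremium_pos hc hε hu
  have hz : ∀ u, 0 ≤ u → 0 < μ * linPremium c ε u / ε := fun u hu => by
    have := hp u hu
    positivity
  refine solvesODE_iff_exists_eq_add
    (f := kummerSolM μ c ε s a b)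
    (f' := expPowMulDeriv μ c ε s (kummerM a b) (kummerMDeriv a b))
    (f'' := expPowMulDeriv₂ μ c ε s (kummerM a b) (kummerMDeriv a b) (kummerMDeriv₂ a b))
    (g := kummerSolU μ c ε s a b)
    (g' := expPowMulDeriv μ c ε s (kummerU a b) (kummerUDeriv a b))
    (g'' := expPowMulDeriv₂ μ c ε s (kummerU a b) (kummerUDeriv a b) (kummerUDeriv₂ a b))
    (fun u hu => ?_) (fun u hu => ⟨?_, ?_, ?_⟩) (fun u hu => ⟨?_, ?_, ?_⟩) (fun u hu => ?_) h
  · rw [h₂]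
    exact (pow_pos (hp u hu) 2).ne'
  · exact (hasDerivAt_expPowMul hε (hp u hu) (hasDerivAt_kummerM ha hb _)).hasDerivWithinAt
  · exact (hasDerivAt_expPowMulDeriv hε (hp u hu) (hasDerivAt_kummerM ha hb _)
      (hasDerivAt_kummerMDeriv ha hb _)).hasDerivWithinAt
  · rw [h₂, h₁, h₀]
    exact expPowMul_ode hε (hp u hu) hβ hγ₀ hγ₁ (fun z _ => kummerM_ode ha hb z) hμ
  · exact (hasDerivAt_expPowMul hε (hp u hu) (hasDerivAt_kummerU ha hab (hz u hu))).hasDerivWithinAt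
  · exact (hasDerivAt_expPowMulDeriv hε (hp u hu) (hasDerivAt_kummerU ha hab (hz u hu))
      (hasDerivAt_kummerUDeriv ha hab (hz u hu))).hasDerivWithinAt
  · rw [h₂, h₁, h₀]
    exact expPowMul_ode hε (hp u hu) hβ hγ₀ hγ₁ (fun z hz => kummerU_ode ha hab hz) hμ
  · -- `M, M', U > 0` and `U' < 0` give the Wronskian a sign.
    have e : kummerSolM μ c ε s a b u
          * expPowMulDeriv μ c ε s (kummerU a b) (kummerUDeriv a b) u
        - expPowMulDeriv μ c ε s (kummerM a b) (kummerMDeriv a b) u * kummerSolU μ c ε s a b u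
        = -((exp (-(μ * u)) * linPremium c ε u ^ s) ^ 2 * μ
          * (kummerM a b (μ * linPremium c ε u / ε) * -kummerUDeriv a b (μ * linPremium c ε u / ε)
            + kummerMDeriv a b (μ * linPremium c ε u / ε)
              * kummerU a b (μ * linPremium c ε u / ε))) := by
      simp only [kummerSolM, kummerSolU, expPowMulDeriv]
      ring
    rw [e]
    have h1 := rpow_pos_of_pos (hp u hu) s
    have h2 := hz u hu
    have h3 := kummerM_pos ha hb h2.le
    have h4 := kummerMDeriv_pos ha hb h2.le
    have h5 := kummerU_pos ha hab h2
    have h6 := neg_pos.2 (kummerUDeriv_neg ha hab h2)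
    exact (neg_neg_of_pos (by positivity)).ne

lemma kummerSolU_pos (hμ : 0 < μ) (hc : 0 < c) (hε : 0 < ε) (ha : 0 < a) (hab : b ≤ a + 1) {u : ℝ}
    (hu : 0 ≤ u) : 0 < kummerSolU μ c ε s a b u := by
  have hp := linPremium_pos hc hε hu
  exact mul_pos (mul_pos (exp_pos _) (rpow_pos_of_pos hp _)) (kummerU_pos ha hab (by positivity))

lemma continuousOn_kummerSolU (hμ : 0 < μ) (hc : 0 < c) (hε : 0 < ε) (ha : 0 < a)
    (hab : b ≤ a + 1) : ContinuousOn (kummerSolU μ c ε s a b) (Ici 0) := fun u hu => by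
  have hp := linPremium_pos hc hε hu
  exact (hasDerivAt_expPowMul hε hp (hasDerivAt_kummerU ha hab
    (by positivity))).continuousAt.continuousWithinAt

lemma expTail_pos (μ : ℝ) (hc : 0 < c) (hε : 0 < ε) {u : ℝ} (hu : 0 ≤ u) :
    0 < expTail μ c ε u :=
  mul_pos (exp_pos _) (rpow_pos_of_pos (linPremium_pos hc hε hu) _)

lemma continuousOn_expTail (μ : ℝ) (hc : 0 < c) (hε : 0 < ε) :
    ContinuousOn (expTail μ c ε) (Ici 0) := fun _ hu =>
  (hasDerivAt_exp_neg_mul _ _).continuousAt.continuousWithinAt.mul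
    (hasDerivAt_linPremium_rpow _ (linPremium_pos hc hε hu)).continuousAt.continuousWithinAt

lemma integrableOn_exp_neg_mul_Ioi (hμ : 0 < μ) (u : ℝ) :
    IntegrableOn (fun y => exp (-(μ * y))) (Ioi u) := by
  simpa only [neg_mul] using exp_neg_integrableOn_Ioi u hμ

lemma integrableOn_expTail (hμ : 0 < μ) (hc : 0 < c) (hε : 0 < ε) :
    IntegrableOn (expTail μ c ε) (Ioi 0) := by
  refine Integrable.mono' ((integrableOn_exp_neg_mul_Ioi hμ 0).mul_const (c ^ (-2 : ℝ)))
    (((continuousOn_expTail μ hc hε).mono Ioi_subset_Ici_self).aestronglyMeasurable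
      measurableSet_Ioi) ?_
  refine (ae_restrict_mem measurableSet_Ioi).mono fun y (hy : 0 < y) => ?_
  rw [Real.norm_of_nonneg (expTail_pos μ hc hε hy.le).le, expTail]
  refine mul_le_mul_of_nonneg_left ?_ (exp_pos _).le
  refine rpow_le_rpow_of_nonpos hc ?_ (by norm_num)
  simp only [linPremium]
  nlinarith

/-- `U(a, b, z) ~ z^{-a}`, so the power of the premium becomes `s - a = -2`. -/
lemma kummerSolU_isEquivalent (hμ : 0 < μ) (hc : 0 < c) (hε : 0 < ε) (ha : 0 < a)
    (hab : b ≤ a + 1) (hs : s - a = -2) :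
    kummerSolU μ c ε s a b ~[atTop] fun y => (μ / ε) ^ (-a) * expTail μ c ε y := by
  refine isEquivalent_of_tendsto_one ?_
  have h1 : Tendsto (fun u => μ * linPremium c ε u / ε) atTop atTop := by
    have := (tendsto_linPremium_atTop (c := c) hε).const_mul_atTop (div_pos hμ hε)
    refine this.congr fun u => ?_
    ring
  refine ((tendsto_rpow_mul_kummerU ha hab).comp h1).congr' ?_
  filter_upwards [eventually_ge_atTop 0] with u hu
  have hp := linPremium_pos hc hε hu
  simp only [Function.comp, Pi.div_apply, kummerSolU, expTail, ← hs]
  rw [mul_div_right_comm μ, mul_rpow (by positivity) hp.le, rpow_neg (by positivity),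
    rpow_sub hp]
  have h2 := rpow_pos_of_pos hp s
  have h3 := rpow_pos_of_pos hp a
  have h4 := rpow_pos_of_pos (div_pos hμ hε) a
  have h5 := exp_pos (-(μ * u))
  field_simp

lemma integrableOn_kummerSolU (hμ : 0 < μ) (hc : 0 < c) (hε : 0 < ε) (ha : 0 < a)
    (hab : b ≤ a + 1) (hs : s - a = -2) : IntegrableOn (kummerSolU μ c ε s a b) (Ioi 0) :=
  integrableOn_Ioi_of_isEquivalent ((integrableOn_expTail hμ hc hε).const_mul _)
    (continuousOn_kummerSolU hμ hc hε ha hab) (kummerSolU_isEquivalent hμ hc hε ha hab hs)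

lemma tendsto_expTail (hμ : 0 < μ) (hε : 0 < ε) :
    Tendsto (expTail μ c ε) atTop (𝓝 0) := by
  have h1 : Tendsto (fun u => exp (-(μ * u))) atTop (𝓝 0) :=
    tendsto_exp_neg_atTop_nhds_zero.comp (tendsto_id.const_mul_atTop hμ)
  have h2 : Tendsto (fun u => linPremium c ε u ^ (-2 : ℝ)) atTop (𝓝 0) :=
    (tendsto_rpow_neg_atTop (by norm_num : (0 : ℝ) < 2)).comp (tendsto_linPremium_atTop hε)
  exact (h1.mul h2).trans_eq (by rw [mul_zero])

lemma tendsto_kummerSolU (hμ : 0 < μ) (hc : 0 < c) (hε : 0 < ε) (ha : 0 < a)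
    (hab : b ≤ a + 1) (hs : s - a = -2) : Tendsto (kummerSolU μ c ε s a b) atTop (𝓝 0) := by
  refine (kummerSolU_isEquivalent hμ hc hε ha hab hs).symm.tendsto_nhds ?_
  simpa using (tendsto_expTail hμ hε).const_mul ((μ / ε) ^ (-a))

lemma rpow_le_kummerSolM (hμ : 0 < μ) (hc : 0 < c) (hε : 0 < ε) (hb : 0 < b) (hab : b ≤ a) {u : ℝ}
    (hu : 0 ≤ u) : linPremium c ε u ^ s ≤ kummerSolM μ c ε s a b u := by
  have hp := linPremium_pos hc hε hu
  have h1 := exp_le_kummerM hb hab (z := μ * linPremium c ε u / ε) (by positivity)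
  have h2 : exp (μ * u) ≤ exp (μ * linPremium c ε u / ε) := by
    rw [exp_le_exp, le_div_iff₀ hε]
    simp only [linPremium]
    nlinarith [mul_pos hμ hc]
  have h3 := rpow_pos_of_pos hp s
  calc linPremium c ε u ^ s = exp (-(μ * u)) * linPremium c ε u ^ s * exp (μ * u) := by
        rw [exp_neg]
        field_simp
    _ ≤ _ := by
        unfold kummerSolM
        gcongr
        exact h2.trans h1

lemma tendsto_kummerSolM (hμ : 0 < μ) (hc : 0 < c) (hε : 0 < ε) (hb : 0 < b) (hab : b ≤ a)
    (hs : 0 < s) : Tendsto (kummerSolM μ c ε s a b) atTop atTop := by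
  refine tendsto_atTop_mono' _ ?_ ((tendsto_rpow_atTop hs).comp (tendsto_linPremium_atTop (c := c) hε))
  filter_upwards [eventually_ge_atTop 0] with u hu
  exact rpow_le_kummerSolM hμ hc hε hb hab hu

lemma continuousOn_kummerSolM (hc : 0 < c) (hε : 0 < ε) (ha : 0 < a) (hb : 0 < b) :
    ContinuousOn (kummerSolM μ c ε s a b) (Ici 0) := fun _ hu =>
  (hasDerivAt_expPowMul hε (linPremium_pos hc hε hu)
    (hasDerivAt_kummerM ha hb _)).continuousAt.continuousWithinAt

/-- By `exp_le_kummerM` the exponentials cancel, leaving at least a multiple of `p^s` with `s > -1`. -/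
lemma not_integrableOn_kummerSolM (hμ : 0 < μ) (hc : 0 < c) (hε : 0 < ε) (hb : 0 < b) (hab : b ≤ a)
    (hs : -1 < s) : ¬ IntegrableOn (kummerSolM μ c ε s a b) (Ioi 0) := by
  intro h
  have hp : ∀ u, 0 ≤ u → 0 < linPremium c ε u := fun u hu => linPremium_pos hc hε hu
  have hcont : ContinuousOn (fun u => linPremium c ε u ^ s) (Ici 0) := fun u hu =>
    (hasDerivAt_linPremium_rpow s (hp u hu)).continuousAt.continuousWithinAt
  have h1 : IntegrableOn (fun u => linPremium c ε u ^ s) (Ioi 0) := by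
    refine Integrable.mono' h ((hcont.mono Ioi_subset_Ici_self).aestronglyMeasurable
      measurableSet_Ioi) ?_
    refine (ae_restrict_mem measurableSet_Ioi).mono fun y (hy : 0 < y) => ?_
    rw [Real.norm_of_nonneg (rpow_nonneg (hp y hy.le).le _)]
    exact rpow_le_kummerSolM hμ hc hε hb hab hy.le
  have h2 := intervalIntegral_tendsto_integral_Ioi 0 h1 tendsto_id
  have hs' : 0 < s + 1 := by linarith
  have h3 : Tendsto (fun u => (linPremium c ε u ^ (s + 1) - linPremium c ε 0 ^ (s + 1))
      / (ε * (s + 1))) atTop atTop := by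
    refine Tendsto.atTop_div_const (by positivity) (tendsto_atTop_add_const_right _ _ ?_)
    exact (tendsto_rpow_atTop hs').comp (tendsto_linPremium_atTop hε)
  refine not_tendsto_nhds_of_tendsto_atTop h3 _ (h2.congr' ?_)
  filter_upwards [eventually_ge_atTop 0] with u hu
  have hsub : Set.uIcc 0 u ⊆ Ici 0 := by
    rw [uIcc_of_le hu]; exact Icc_subset_Ici_self
  rw [id, intervalIntegral.integral_eq_sub_of_hasDerivAt
    (f := fun u => linPremium c ε u ^ (s + 1) / (ε * (s + 1))) (fun x hx => ?_)
    (hcont.mono hsub).intervalIntegrable, sub_div]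
  have hpx := hp x (hsub hx)
  refine ((hasDerivAt_linPremium_rpow (s + 1) hpx).div_const _).congr_deriv ?_
  rw [rpow_add_one hpx.ne']
  field_simp

end KummerSolutions

/-! ### The modified Bessel function `I_ν` -/

/-- The coefficients of the entire function `G_ν(y) = ∑ yᵐ / (m! Γ(m+ν+1))`, for which
`I_ν(x) = (x/2)^ν G_ν(x²/4)`. -/
noncomputable def besselCoeff (ν : ℝ) (m : ℕ) : ℝ :=
  1 / ((m.factorial : ℝ) * Real.Gamma ((m : ℝ) + ν + 1))

lemma besselCoeff_pos {ν : ℝ} (hν : -1 < ν) (m : ℕ) : 0 < besselCoeff ν m := by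
  have h1 : 0 < (m : ℝ) + ν + 1 := by
    have : (0 : ℝ) ≤ m := by positivity
    linarith
  have := Real.Gamma_pos_of_pos h1
  unfold besselCoeff
  positivity

lemma besselCoeff_recursion {ν : ℝ} (hν : -1 < ν) (n : ℕ) :
    ((n : ℝ) + 1) * (n + (ν + 1)) * besselCoeff ν (n + 1) = (0 * n + 1) * besselCoeff ν n := by
  have h1 : 0 < (n : ℝ) + ν + 1 := by
    have : (0 : ℝ) ≤ n := by positivity
    linarith
  have h2 := Real.Gamma_pos_of_pos h1
  have e : ((n + 1 : ℕ) : ℝ) + ν + 1 = ((n : ℝ) + ν + 1) + 1 := by push_cast; ring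
  simp only [besselCoeff]
  rw [e, Real.Gamma_add_one h1.ne', Nat.factorial_succ]
  push_cast
  have h3 : (n : ℝ) + 1 ≠ 0 := by positivity
  have h4 : ((n.factorial : ℕ) : ℝ) ≠ 0 := by positivity
  have h5 : (n : ℝ) + (ν + 1) ≠ 0 := by rw [← add_assoc]; exact h1.ne'
  rw [add_assoc] at *
  field_simp
  ring

lemma entireCoeff_besselCoeff {ν : ℝ} (hν : -1 < ν) : EntireCoeff (besselCoeff ν) :=
  entireCoeff_of_recursion (by linarith) (besselCoeff_pos hν) (besselCoeff_recursion hν)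

lemma derivCoeff_besselCoeff (ν : ℝ) : derivCoeff (besselCoeff ν) = besselCoeff (ν + 1) := by
  funext m
  have e : ((m + 1 : ℕ) : ℝ) + ν + 1 = (m : ℝ) + (ν + 1) + 1 := by push_cast; ring
  simp only [derivCoeff, besselCoeff]
  rw [e, Nat.factorial_succ]
  push_cast
  have h3 : (m : ℝ) + 1 ≠ 0 := by positivity
  rw [mul_assoc, one_div, one_div, mul_inv, mul_inv_cancel_left₀ h3]

/-- The equation of `G_ν`, which is the recurrence of `I_ν` as `G_ν' = G_{ν+1}`. -/
lemma powSum_besselCoeff_ode {ν : ℝ} (hν : -1 < ν) (y : ℝ) :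
    y * powSum (besselCoeff (ν + 2)) y + (ν + 1) * powSum (besselCoeff (ν + 1)) y
      = powSum (besselCoeff ν) y := by
  have := (entireCoeff_besselCoeff hν).powSum_ode (besselCoeff_recursion hν) y
  rw [derivCoeff_besselCoeff, derivCoeff_besselCoeff, add_assoc ν 1 1, one_add_one_eq_two] at this
  linarith

lemma besselI_eq (ν : ℝ) {x : ℝ} (hx : 0 < x) :
    besselI ν x = (x / 2) ^ ν * powSum (besselCoeff ν) (x ^ 2 / 4) := by
  rw [besselI, powSum, ← tsum_mul_left]
  refine tsum_congr fun m => ?_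
  have h1 : (x / 2) ^ (2 * (m : ℝ) + ν) = (x ^ 2 / 4) ^ m * (x / 2) ^ ν := by
    rw [rpow_add (by positivity), mul_comm 2 (m : ℝ), mul_comm (m : ℝ) 2, rpow_mul (by positivity),
      rpow_natCast]
    congr 2
    rw [rpow_two]
    ring
  rw [h1, besselCoeff]
  ring

/-- The recurrence `I_ν = I_{ν+2} + (2(ν+1)/x) I_{ν+1}`. -/
lemma besselI_recurrence {ν : ℝ} (hν : -1 < ν) {x : ℝ} (hx : 0 < x) :
    besselI ν x = besselI (ν + 1 + 1) x + 2 * (ν + 1) / x * besselI (ν + 1) x := by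
  rw [besselI_eq _ hx, besselI_eq _ hx, besselI_eq _ hx, ← powSum_besselCoeff_ode hν,
    add_assoc ν 1 1, one_add_one_eq_two, rpow_add (by positivity) ν 2, rpow_add (by positivity) ν 1,
    rpow_one, rpow_two]
  field_simp
  ring

lemma Gamma_natCast_add_half (m : ℕ) :
    Real.Gamma (m + 1 / 2) * (4 ^ m * m.factorial) = (2 * m).factorial * √π := by
  induction m with
  | zero =>
    simp only [CharP.cast_eq_zero, zero_add, Real.Gamma_one_half_eq]
    simp
  | succ m ih =>
    have h1 : ((m + 1 : ℕ) : ℝ) + 1 / 2 = ((m : ℝ) + 1 / 2) + 1 := by push_cast; ring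
    rw [h1, Real.Gamma_add_one (by positivity), show 2 * (m + 1) = 2 * m + 1 + 1 by ring,
      Nat.factorial_succ, Nat.factorial_succ, Nat.factorial_succ]
    push_cast
    linear_combination 4 * ((m : ℝ) + 1 / 2) * (m + 1) * ih

lemma integral_rpow_mul_one_sub_rpow {α β : ℝ} (hα : 0 < α) (hβ : 0 < β) :
    ∫ x in (0 : ℝ)..1, x ^ (α - 1) * (1 - x) ^ (β - 1)
      = Real.Gamma α * Real.Gamma β / Real.Gamma (α + β) := by
  have h1 := beta_eq_betaIntegralReal α β hα hβ
  rw [beta] at h1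
  rw [h1, Complex.betaIntegral, ← Complex.ofReal_re (∫ x in (0 : ℝ)..1, _),
    ← intervalIntegral.integral_ofReal]
  congr 1
  refine intervalIntegral.integral_congr fun x hx => ?_
  rw [uIcc_of_le zero_le_one] at hx
  have h2 : (0 : ℝ) ≤ 1 - x := by linarith [hx.2]
  push_cast [Complex.ofReal_cpow hx.1, Complex.ofReal_cpow h2]
  rfl

/-- The Beta integral, after the substitution `x = t²`. -/
lemma integral_pow_mul_one_sub_sq_rpow {σ : ℝ} (hσ : -1 < σ) (m : ℕ) :
    ∫ t in (0 : ℝ)..1, t ^ (2 * m) * (1 - t ^ 2) ^ σ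
      = Real.Gamma (m + 1 / 2) * Real.Gamma (σ + 1) / Real.Gamma (m + 1 / 2 + (σ + 1)) / 2 := by
  have h1 := integral_rpow_mul_one_sub_rpow (α := (m : ℝ) + 1 / 2) (β := σ + 1) (by positivity)
    (by linarith)
  rw [← h1, intervalIntegral.integral_of_le zero_le_one, intervalIntegral.integral_of_le zero_le_one,
    integral_Ioc_eq_integral_Ioo, integral_Ioc_eq_integral_Ioo]
  have himg : (fun t : ℝ => t ^ 2) '' Ioo 0 1 = Ioo 0 1 := by
    ext y
    constructor
    · rintro ⟨t, ht, rfl⟩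
      have h0 : 0 < t := ht.1
      have h1 : t < 1 := ht.2
      exact ⟨by positivity, by simp only; nlinarith⟩
    · intro hy
      refine ⟨√y, ⟨sqrt_pos.2 hy.1, ?_⟩, sq_sqrt hy.1.le⟩
      rw [sqrt_lt' one_pos]
      simpa using hy.2
  have key := integral_image_eq_integral_abs_deriv_smul (s := Ioo (0 : ℝ) 1)
    (f := fun t => t ^ 2) (f' := fun t => 2 * t) measurableSet_Ioo
    (fun t _ => by simpa using (hasDerivAt_pow 2 t).hasDerivWithinAt)
    (fun x hx y hy hxy => (pow_left_inj₀ hx.1.le hy.1.le two_ne_zero).1 hxy)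
    (fun x : ℝ => x ^ ((m : ℝ) + 1 / 2 - 1) * (1 - x) ^ (σ + 1 - 1))
  rw [himg] at key
  rw [key, eq_div_iff two_ne_zero, ← integral_mul_const]
  refine setIntegral_congr_fun measurableSet_Ioo fun t ht => ?_
  have ht0 : 0 < t := ht.1
  have h2 : (t ^ 2) ^ ((m : ℝ) + 1 / 2 - 1) * t = t ^ (2 * m) := by
    rw [← rpow_two, ← rpow_mul ht0.le, ← rpow_add_one ht0.ne', ← rpow_natCast]
    congr 1
    push_cast
    ring
  simp only [smul_eq_mul, add_sub_cancel_right]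
  rw [abs_of_pos (by positivity), ← h2]
  ring

/-- Poisson's integral for `I_ν`, by integrating the series of `cosh` term by term. -/
lemma integral_one_sub_sq_rpow_mul_cosh {ν : ℝ} (hν : 1 / 2 ≤ ν) (x : ℝ) :
    ∫ t in (0 : ℝ)..1, (1 - t ^ 2) ^ (ν - 1 / 2) * cosh (x * t)
      = √π * Real.Gamma (ν + 1 / 2) / 2 * powSum (besselCoeff ν) (x ^ 2 / 4) := by
  have key := intervalIntegral.hasSum_integral_of_dominated_convergence (μ := volume)
    (a := 0) (b := 1)
    (F := fun (m : ℕ) (t : ℝ) => (1 - t ^ 2) ^ (ν - 1 / 2) * ((x * t) ^ (2 * m) / (2 * m).factorial))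
    (f := fun t => (1 - t ^ 2) ^ (ν - 1 / 2) * cosh (x * t))
    (fun m _ => |x| ^ (2 * m) / (2 * m).factorial)
    (fun m => Measurable.aestronglyMeasurable (by fun_prop)) ?_ ?_ ?_ ?_
  · refine key.unique ?_
    refine (((entireCoeff_besselCoeff (ν := ν) (by linarith)).hasSum (x ^ 2 / 4)).mul_left
      (√π * Real.Gamma (ν + 1 / 2) / 2)).congr_fun fun m => ?_
    have h1 := integral_pow_mul_one_sub_sq_rpow (σ := ν - 1 / 2) (by linarith) m
    have h2 : ∫ t in (0 : ℝ)..1,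
        (1 - t ^ 2) ^ (ν - 1 / 2) * ((x * t) ^ (2 * m) / (2 * m).factorial)
        = x ^ (2 * m) / (2 * m).factorial *
          ∫ t in (0 : ℝ)..1, t ^ (2 * m) * (1 - t ^ 2) ^ (ν - 1 / 2) := by
      rw [← intervalIntegral.integral_const_mul]
      congr 1
      funext t
      ring
    rw [h2, h1, besselCoeff]
    have h3 := Gamma_natCast_add_half m
    have e1 : ν - 1 / 2 + 1 = ν + 1 / 2 := by ring
    have e2 : (m : ℝ) + 1 / 2 + (ν + 1 / 2) = m + ν + 1 := by ring
    rw [e1, e2]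
    have h4 : 0 < Real.Gamma (m + ν + 1) := Real.Gamma_pos_of_pos (by positivity)
    have h5 : Real.Gamma ((m : ℝ) + 1 / 2) = (2 * m).factorial * √π / (4 ^ m * m.factorial) := by
      rw [eq_div_iff (by positivity), h3]
    rw [h5, div_pow, ← pow_mul]
    have h6 : (((2 * m).factorial : ℕ) : ℝ) ≠ 0 := by positivity
    field_simp
  · intro m
    refine Eventually.of_forall fun t ht => ?_
    rw [uIoc_of_le zero_le_one] at ht
    have h0 : 0 ≤ t := ht.1.le
    have h1 : t ≤ 1 := ht.2
    have h2 : 0 ≤ 1 - t ^ 2 := by nlinarith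
    rw [norm_mul, Real.norm_of_nonneg (rpow_nonneg h2 _), norm_div, norm_pow, norm_mul,
      Real.norm_eq_abs, Real.norm_eq_abs, Real.norm_natCast]
    have h3 : (1 - t ^ 2) ^ (ν - 1 / 2) ≤ 1 :=
      rpow_le_one h2 (by nlinarith) (by linarith)
    have h4 : |x| * |t| ≤ |x| := mul_le_of_le_one_right (abs_nonneg x) (by rwa [abs_of_nonneg h0])
    calc _ ≤ 1 * ((|x| * |t|) ^ (2 * m) / ((2 * m).factorial : ℝ)) := by gcongr
      _ ≤ _ := by rw [one_mul]; gcongr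
  · exact Eventually.of_forall fun t _ => (Real.hasSum_cosh |x|).summable
  · exact intervalIntegrable_const
  · exact Eventually.of_forall fun t _ => (Real.hasSum_cosh (x * t)).mul_left _

/-- Laplace's method for Poisson's integral, in the variable `y = x(1 - t)`. -/
lemma tendsto_integral_one_sub_sq_rpow_mul_cosh {σ : ℝ} (hσ : 0 ≤ σ) :
    Tendsto (fun x : ℝ => x ^ (σ + 1) * exp (-x) *
      ∫ t in (0 : ℝ)..1, (1 - t ^ 2) ^ σ * cosh (x * t)) atTop
      (𝓝 (2 ^ σ / 2 * Real.Gamma (σ + 1))) := by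
  have h1 : Tendsto (fun x : ℝ => ∫ y in Ioi (0 : ℝ), (Iio x).indicator
      (fun y => y ^ σ * (2 - y / x) ^ σ * ((exp (-y) + exp (-(2 * x)) * exp y) / 2)) y) atTop
      (𝓝 (∫ y in Ioi (0 : ℝ), y ^ σ * 2 ^ σ * ((exp (-y) + 0 * exp y) / 2))) := by
    refine tendsto_integral_filter_of_dominated_convergence
      (fun y => 2 ^ σ * (exp (-y) * y ^ (σ + 1 - 1))) ?_ ?_ ?_ ?_
    · exact Eventually.of_forall fun x => Measurable.aestronglyMeasurable
        (Measurable.indicator (by fun_prop) measurableSet_Iio)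
    · filter_upwards [eventually_gt_atTop 0] with x hx
      refine (ae_restrict_mem measurableSet_Ioi).mono fun y (hy : 0 < y) => ?_
      by_cases hyx : y < x
      · rw [indicator_of_mem (mem_Iio.2 hyx)]
        have h2 : 0 ≤ y / x := by positivity
        have h3 : y / x < 1 := (div_lt_one hx).2 hyx
        have h4 : (2 - y / x) ^ σ ≤ 2 ^ σ := rpow_le_rpow (by linarith) (by linarith) hσ
        have h5 : 0 ≤ (2 - y / x) ^ σ := rpow_nonneg (by linarith) _
        have h6 : exp (-(2 * x)) * exp y ≤ exp (-y) := by
          rw [← exp_add, exp_le_exp]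
          linarith
        rw [Real.norm_of_nonneg (by positivity), add_sub_cancel_right]
        calc y ^ σ * (2 - y / x) ^ σ * ((exp (-y) + exp (-(2 * x)) * exp y) / 2)
            ≤ y ^ σ * 2 ^ σ * exp (-y) := by
              gcongr
              linarith
          _ = _ := by ring
      · rw [indicator_of_notMem (by simpa using hyx), norm_zero]
        positivity
    · exact (Real.GammaIntegral_convergent (by linarith)).const_mul _
    · refine (ae_restrict_mem measurableSet_Ioi).mono fun y (hy : 0 < y) => ?_
      have h2 : Tendsto (fun x : ℝ => 2 - y / x) atTop (𝓝 2) := by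
        simpa using (tendsto_const_nhds.div_atTop tendsto_id).const_sub (2 : ℝ)
      have h3 : Tendsto (fun x : ℝ => exp (-(2 * x))) atTop (𝓝 0) :=
        tendsto_exp_neg_atTop_nhds_zero.comp (tendsto_id.const_mul_atTop two_pos)
      have h4 := ((h2.rpow_const (p := σ) (Or.inl two_ne_zero)).const_mul (y ^ σ)).mul
        (((h3.mul_const (exp y)).const_add (exp (-y))).div_const 2)
      refine h4.congr' ?_
      filter_upwards [eventually_gt_atTop y] with x hx
      rw [indicator_of_mem (mem_Iio.2 hx)]
  have e : ∫ y in Ioi (0 : ℝ), y ^ σ * 2 ^ σ * ((exp (-y) + 0 * exp y) / 2)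
      = 2 ^ σ / 2 * Real.Gamma (σ + 1) := by
    rw [Real.Gamma_eq_integral (by linarith), ← integral_const_mul]
    congr 1
    funext y
    rw [add_sub_cancel_right]
    ring
  rw [e] at h1
  refine h1.congr' ?_
  filter_upwards [eventually_gt_atTop 0] with x hx
  have h2 : ∫ t in (0 : ℝ)..1, (1 - t ^ 2) ^ σ * cosh (x * t)
      = ∫ t in (0 : ℝ)..1, (t * (2 - t)) ^ σ * cosh (x - x * t) := by
    have := intervalIntegral.integral_comp_sub_left (a := 0) (b := 1)
      (fun t : ℝ => (1 - t ^ 2) ^ σ * cosh (x * t)) 1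
    rw [sub_zero, sub_self] at this
    rw [← this]
    congr 1
    funext t
    congr 2 <;> ring
  have h3 := intervalIntegral.integral_comp_div (a := 0) (b := x)
    (fun t : ℝ => (t * (2 - t)) ^ σ * cosh (x - x * t)) hx.ne'
  rw [zero_div, div_self hx.ne', smul_eq_mul] at h3
  rw [setIntegral_indicator measurableSet_Iio, Ioi_inter_Iio, h2]
  have h4 : x ^ (σ + 1) * exp (-x) * ∫ t in (0 : ℝ)..1, (t * (2 - t)) ^ σ * cosh (x - x * t)
      = x ^ σ * exp (-x) * ∫ t in (0 : ℝ)..x, (t / x * (2 - t / x)) ^ σ * cosh (x - x * (t / x)) := by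
    rw [h3, rpow_add_one hx.ne']
    ring
  rw [h4, intervalIntegral.integral_of_le hx.le, integral_Ioc_eq_integral_Ioo, ← integral_const_mul]
  refine setIntegral_congr_fun measurableSet_Ioo fun y hy => ?_
  have hy0 : 0 < y := hy.1
  have hyx : y / x < 1 := (div_lt_one hx).2 hy.2
  have h5 : exp (-x) * cosh (x - x * (y / x)) = (exp (-y) + exp (-(2 * x)) * exp y) / 2 := by
    rw [mul_div_cancel₀ _ hx.ne', cosh_eq, mul_div_assoc', mul_add, ← exp_add, ← exp_add, ← exp_add]
    congr 3 <;> ring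
  have h6 : (y / x * (2 - y / x)) ^ σ = y ^ σ / x ^ σ * (2 - y / x) ^ σ := by
    rw [mul_rpow (by positivity) (by linarith), div_rpow hy0.le hx.le]
  have h7 := (rpow_pos_of_pos hx σ).ne'
  rw [← h5, h6]
  field_simp

lemma tendsto_besselI_of_half_le {ν : ℝ} (hν : 1 / 2 ≤ ν) :
    Tendsto (fun x => √x * exp (-x) * besselI ν x) atTop (𝓝 (1 / √(2 * π))) := by
  have hG : 0 < Real.Gamma (ν + 1 / 2) := Real.Gamma_pos_of_pos (by linarith)
  have h1 := (tendsto_integral_one_sub_sq_rpow_mul_cosh (σ := ν - 1 / 2) (by linarith)).const_mul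
    (2 / (√π * Real.Gamma (ν + 1 / 2) * 2 ^ ν))
  have e : 2 / (√π * Real.Gamma (ν + 1 / 2) * 2 ^ ν)
      * (2 ^ (ν - 1 / 2) / 2 * Real.Gamma (ν - 1 / 2 + 1)) = 1 / √(2 * π) := by
    have e1 : ν - 1 / 2 + 1 = ν + 1 / 2 := by ring
    rw [e1, rpow_sub two_pos, ← sqrt_eq_rpow, sqrt_mul two_pos.le]
    have h2 : (0 : ℝ) < 2 ^ ν := by positivity
    have h3 : 0 < √π := sqrt_pos.2 pi_pos
    field_simp
  rw [e] at h1
  refine h1.congr' ?_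
  filter_upwards [eventually_gt_atTop 0] with x hx
  rw [integral_one_sub_sq_rpow_mul_cosh hν, besselI_eq _ hx, div_rpow hx.le two_pos.le]
  have e1 : ν - 1 / 2 + 1 = 1 / 2 + ν := by ring
  have h3 : 0 < √π := sqrt_pos.2 pi_pos
  have h2 : (0 : ℝ) < 2 ^ ν := by positivity
  rw [e1, rpow_add hx, ← sqrt_eq_rpow]
  field_simp

/-- `I_ν(x) ~ e^x / √(2πx)` as `x → ∞`. The recurrence reduces the order `ν > -1` to orders for
which the weight of Poisson's integral is bounded. -/
lemma tendsto_besselI {ν : ℝ} (hν : -1 < ν) :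
    Tendsto (fun x => √x * exp (-x) * besselI ν x) atTop (𝓝 (1 / √(2 * π))) := by
  have step : ∀ ν : ℝ, -1 < ν →
      Tendsto (fun x => √x * exp (-x) * besselI (ν + 1) x) atTop (𝓝 (1 / √(2 * π))) →
      Tendsto (fun x => √x * exp (-x) * besselI (ν + 1 + 1) x) atTop (𝓝 (1 / √(2 * π))) →
      Tendsto (fun x => √x * exp (-x) * besselI ν x) atTop (𝓝 (1 / √(2 * π))) := by
    intro ν hν h1 h2
    have h3 : Tendsto (fun x : ℝ => 2 * (ν + 1) / x) atTop (𝓝 0) :=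
      tendsto_const_nhds.div_atTop tendsto_id
    have h4 := h2.add (h3.mul h1)
    rw [zero_mul, add_zero] at h4
    refine h4.congr' ?_
    filter_upwards [eventually_gt_atTop 0] with x hx
    rw [besselI_recurrence hν hx]
    ring
  have half : ∀ ν : ℝ, -(1 / 2) ≤ ν →
      Tendsto (fun x => √x * exp (-x) * besselI ν x) atTop (𝓝 (1 / √(2 * π))) := fun ν hν =>
    step ν (by linarith) (tendsto_besselI_of_half_le (by linarith))
      (tendsto_besselI_of_half_le (by linarith))
  exact step ν hν (half _ (by linarith)) (half _ (by linarith))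

/-! ### The modified Bessel function `K_ν` -/

/-- The integral `∫₀^∞ e^{-x cosh t} cosh(t)^k cosh(νt) dt`, which is `(-1)^k` times the `k`-th
derivative of `K_ν`. -/
noncomputable def besselKMoment (k : ℕ) (ν x : ℝ) : ℝ :=
  ∫ t in Ioi (0 : ℝ), exp (-(x * cosh t)) * (cosh t ^ k * cosh (ν * t))

lemma besselK_eq (ν x : ℝ) : besselK ν x = besselKMoment 0 ν x := by
  simp only [besselK, besselKMoment, pow_zero, one_mul]

lemma sq_div_two_le_cosh_sub_one (t : ℝ) : t ^ 2 / 2 ≤ cosh t - 1 := by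
  have h0 : |t / 2| ≤ sinh |t / 2| := self_le_sinh_iff.2 (abs_nonneg _)
  have h1 : cosh t = 2 * sinh |t / 2| ^ 2 + 1 := by
    have h2 : cosh t = cosh (2 * |t / 2|) := by
      rw [← cosh_abs t]
      congr 1
      rw [abs_div, abs_two]
      ring
    rw [h2, cosh_two_mul, cosh_sq]
    ring
  have h3 : |t / 2| ^ 2 ≤ sinh |t / 2| ^ 2 := pow_le_pow_left₀ (abs_nonneg _) h0 2
  rw [sq_abs] at h3
  rw [h1]
  linarith

lemma cosh_le_exp_abs (y : ℝ) : cosh y ≤ exp |y| := by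
  rw [cosh_eq]
  have h1 := exp_le_exp.2 (le_abs_self y)
  have h2 := exp_le_exp.2 (neg_le_abs y)
  linarith

lemma exp_neg_mul_sq_mul_cosh_le {x : ℝ} (hx : 0 < x) (ν t : ℝ) :
    exp (-(x / 2 * t ^ 2)) * cosh (ν * t) ≤ exp (ν ^ 2 / x) * exp (-(x / 4) * t ^ 2) := by
  calc exp (-(x / 2 * t ^ 2)) * cosh (ν * t)
      ≤ exp (-(x / 2 * t ^ 2)) * exp |ν * t| := by
        gcongr
        exact cosh_le_exp_abs _
    _ ≤ _ := by
        rw [← exp_add, ← exp_add, exp_le_exp]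
        have h1 : 0 ≤ (|ν * t| - x / 2 * t ^ 2) ^ 2 := sq_nonneg _
        have h2 : |ν * t| ≤ ν ^ 2 / x + x / 4 * t ^ 2 := by
          rw [abs_mul, ← sq_abs ν, ← sq_abs t]
          have h3 : 0 ≤ (|ν| - x / 2 * |t|) ^ 2 / x := by positivity
          have h4 : (|ν| - x / 2 * |t|) ^ 2 / x
              = |ν| ^ 2 / x + x / 4 * |t| ^ 2 - |ν| * |t| := by
            field_simp
            ring
          linarith
        linarith

lemma laplaceIntegrable_cosh (ν : ℝ) (k : ℕ) :
    LaplaceIntegrable cosh (fun t => cosh t ^ k * cosh (ν * t)) := by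
  induction k with
  | zero =>
    intro x hx
    have h1 := ((integrable_exp_neg_mul_sq (b := x / 4) (by positivity)).const_mul
      (exp (ν ^ 2 / x))).integrableOn (s := Ioi 0)
    refine Integrable.mono' h1 ?_ ?_
    · exact Measurable.aestronglyMeasurable (by fun_prop)
    · refine Eventually.of_forall fun t => ?_
      have h2 := cosh_pos (ν * t)
      simp only [pow_zero, one_mul]
      rw [Real.norm_of_nonneg (by positivity)]
      refine le_trans ?_ (exp_neg_mul_sq_mul_cosh_le hx ν t)
      refine mul_le_mul_of_nonneg_right (exp_le_exp.2 ?_) h2.le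
      have := sq_div_two_le_cosh_sub_one t
      nlinarith
  | succ k ih =>
    have := ih.mul_phase (by fun_prop) (fun t _ => (cosh_pos t).le)
    refine fun z hz => (this z hz).congr_fun (fun t _ => ?_) measurableSet_Ioi
    ring_nf

lemma hasDerivAt_besselKMoment (k : ℕ) (ν : ℝ) {x : ℝ} (hx : 0 < x) :
    HasDerivAt (besselKMoment k ν) (-besselKMoment (k + 1) ν x) x := by
  refine ((laplaceIntegrable_cosh ν k).hasDerivAt (by fun_prop)
    (fun t _ => (cosh_pos t).le) hx).congr_deriv ?_
  rw [besselKMoment]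
  congr 1
  refine integral_congr_ae (Eventually.of_forall fun t => ?_)
  ring_nf

lemma besselKMoment_pos (k : ℕ) (ν : ℝ) {x : ℝ} (hx : 0 < x) : 0 < besselKMoment k ν x :=
  integral_Ioi_pos (laplaceIntegrable_cosh ν k x hx) fun t _ =>
    mul_pos (exp_pos _) (mul_pos (pow_pos (cosh_pos t) k) (cosh_pos _))

lemma tendsto_exp_neg_mul_sq_add_atTop {x : ℝ} (hx : 0 < x) (a : ℝ) :
    Tendsto (fun t : ℝ => exp (-(x / 2 * t ^ 2) + a * t)) atTop (𝓝 0) := by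
  refine tendsto_exp_atBot.comp ?_
  have h1 : Tendsto (fun t : ℝ => t * (x / 2 * t - a)) atTop atTop :=
    tendsto_id.atTop_mul_atTop₀ (tendsto_atTop_add_const_right _ _
      (tendsto_id.const_mul_atTop (by positivity)))
  refine (tendsto_neg_atTop_atBot.comp h1).congr fun t => ?_
  simp only [Function.comp]
  ring

lemma abs_sinh_le_cosh (y : ℝ) : |sinh y| ≤ cosh y := by
  rw [abs_le]
  constructor
  · have := exp_pos y
    rw [← cosh_add_sinh] at this
    linarith
  · exact (sinh_lt_cosh y).le

lemma tendsto_exp_neg_mul_cosh_mul {x : ℝ} (hx : 0 < x) (ν : ℝ) {f : ℝ → ℝ}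
    (hf : ∀ t, 0 < t → |f t| ≤ cosh t * cosh (ν * t)) :
    Tendsto (fun t => exp (-(x * cosh t)) * f t) atTop (𝓝 0) := by
  refine squeeze_zero_norm' ?_ (tendsto_exp_neg_mul_sq_add_atTop hx (1 + |ν|))
  filter_upwards [eventually_gt_atTop 0] with t ht
  rw [norm_mul, Real.norm_of_nonneg (exp_pos _).le, Real.norm_eq_abs]
  have h1 := sq_div_two_le_cosh_sub_one t
  have h2 := cosh_le_exp_abs t
  have h3 := cosh_le_exp_abs (ν * t)
  rw [abs_of_pos ht] at h2
  rw [abs_mul, abs_of_pos ht] at h3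
  have h4 := cosh_pos (ν * t)
  calc exp (-(x * cosh t)) * |f t| ≤ exp (-(x / 2 * t ^ 2)) * (exp t * exp (|ν| * t)) := by
        refine mul_le_mul (exp_le_exp.2 ?_) ((hf t ht).trans ?_) (abs_nonneg _) (exp_pos _).le
        · nlinarith
        · gcongr
    _ = _ := by
        rw [← exp_add, ← exp_add]
        congr 1
        ring

lemma hasDerivAt_exp_neg_mul_cosh (x t : ℝ) :
    HasDerivAt (fun t => exp (-(x * cosh t))) (-(x * sinh t) * exp (-(x * cosh t))) t := by
  have h1 := (((hasDerivAt_cosh t).const_mul x).neg).exp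
  exact h1.congr_deriv (by simp only [Pi.neg_apply]; ring)

lemma hasDerivAt_mul_id (ν t : ℝ) : HasDerivAt (fun t : ℝ => ν * t) ν t := by
  simpa using (hasDerivAt_id t).const_mul ν

/-- The integral of `e^{-x cosh t} sinh t sinh(νt)`, by parts. -/
lemma integral_sinh_mul_sinh {x : ℝ} (hx : 0 < x) (ν : ℝ) :
    IntegrableOn (fun t => exp (-(x * cosh t)) * (sinh t * sinh (ν * t))) (Ioi 0) ∧
    x * ∫ t in Ioi (0 : ℝ), exp (-(x * cosh t)) * (sinh t * sinh (ν * t))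
      = ν * besselKMoment 0 ν x := by
  have hi : IntegrableOn (fun t => exp (-(x * cosh t)) * (sinh t * sinh (ν * t))) (Ioi 0) := by
    refine Integrable.mono' (laplaceIntegrable_cosh ν 1 x hx)
      (Measurable.aestronglyMeasurable (by fun_prop)) (Eventually.of_forall fun t => ?_)
    rw [norm_mul, Real.norm_of_nonneg (exp_pos _).le, norm_mul, Real.norm_eq_abs, Real.norm_eq_abs]
    simp only [pow_one]
    gcongr
    · exact abs_sinh_le_cosh t
    · exact abs_sinh_le_cosh _
  refine ⟨hi, ?_⟩
  have hi0 : IntegrableOn (fun t => exp (-(x * cosh t)) * (cosh t ^ 0 * cosh (ν * t))) (Ioi 0) :=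
    laplaceIntegrable_cosh ν 0 x hx
  have hi2 : IntegrableOn (fun t => ν * (exp (-(x * cosh t)) * (cosh t ^ 0 * cosh (ν * t)))
      - x * (exp (-(x * cosh t)) * (sinh t * sinh (ν * t)))) (Ioi 0) :=
    (hi0.const_mul ν).sub (hi.const_mul x)
  have key := integral_Ioi_of_hasDerivAt_of_tendsto' (a := 0) (m := 0)
    (f := fun t => exp (-(x * cosh t)) * sinh (ν * t))
    (f' := fun t => ν * (exp (-(x * cosh t)) * (cosh t ^ 0 * cosh (ν * t)))
      - x * (exp (-(x * cosh t)) * (sinh t * sinh (ν * t))))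
    (fun t _ => by
      refine ((hasDerivAt_exp_neg_mul_cosh x t).mul (hasDerivAt_mul_id ν t).sinh).congr_deriv ?_
      ring)
    hi2
    (tendsto_exp_neg_mul_cosh_mul hx ν fun t _ =>
      (abs_sinh_le_cosh _).trans (le_mul_of_one_le_left (cosh_pos _).le (one_le_cosh t)))
  rw [integral_sub (hi0.const_mul ν) (hi.const_mul x), integral_const_mul, integral_const_mul] at key
  simp only [mul_zero, sinh_zero, sub_zero] at key
  rw [besselKMoment]
  linarith

/-- `x K_ν'(x) < -|ν| K_ν(x)`. -/
lemma abs_mul_besselKMoment_lt {x : ℝ} (hx : 0 < x) (ν : ℝ) :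
    |ν| * besselKMoment 0 ν x < x * besselKMoment 1 ν x := by
  have h0 : besselKMoment 0 ν x = besselKMoment 0 |ν| x := by
    simp only [besselKMoment]
    congr 1
    funext t
    rw [← cosh_abs (ν * t), ← cosh_abs (|ν| * t), abs_mul, abs_mul, abs_abs]
  have h1 : besselKMoment 1 ν x = besselKMoment 1 |ν| x := by
    simp only [besselKMoment]
    congr 1
    funext t
    rw [← cosh_abs (ν * t), ← cosh_abs (|ν| * t), abs_mul, abs_mul, abs_abs]
  obtain ⟨hi, he⟩ := integral_sinh_mul_sinh hx |ν|
  rw [h0, h1, ← he]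
  refine mul_lt_mul_of_pos_left ?_ hx
  have hi1 := laplaceIntegrable_cosh |ν| 1 x hx
  rw [← sub_pos, besselKMoment, ← integral_sub hi1 hi]
  refine integral_Ioi_pos (hi1.sub hi) fun t (ht : 0 < t) => ?_
  have h2 : sinh t < cosh t := sinh_lt_cosh t
  have h3 : sinh (|ν| * t) < cosh (|ν| * t) := sinh_lt_cosh _
  have h4 : 0 ≤ sinh t := sinh_nonneg_iff.2 ht.le
  have h5 : 0 ≤ sinh (|ν| * t) := sinh_nonneg_iff.2 (by positivity)
  rw [← mul_sub]
  refine mul_pos (exp_pos _) ?_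
  simp only [pow_one]
  nlinarith

/-- Bessel's equation `x²K'' + xK' - (x² + ν²)K = 0`. -/
lemma besselKMoment_ode {x : ℝ} (hx : 0 < x) (ν : ℝ) :
    x ^ 2 * besselKMoment 2 ν x - x * besselKMoment 1 ν x - (x ^ 2 + ν ^ 2) * besselKMoment 0 ν x
      = 0 := by
  obtain ⟨hi, he⟩ := integral_sinh_mul_sinh hx ν
  have hk : ∀ k : ℕ,
      IntegrableOn (fun t => exp (-(x * cosh t)) * (cosh t ^ k * cosh (ν * t))) (Ioi 0) :=
    fun k => laplaceIntegrable_cosh ν k x hx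
  set A : ℝ → ℝ := fun t => exp (-(x * cosh t)) * (sinh t * sinh (ν * t))
  set B : ℕ → ℝ → ℝ := fun k t => exp (-(x * cosh t)) * (cosh t ^ k * cosh (ν * t))
  have i1 : IntegrableOn (fun t => ν * A t + B 1 t) (Ioi 0) := (hi.const_mul ν).add (hk 1)
  have i2 : IntegrableOn (fun t => B 2 t - B 0 t) (Ioi 0) := (hk 2).sub (hk 0)
  have key := integral_Ioi_of_hasDerivAt_of_tendsto' (a := 0) (m := 0)
    (f := fun t => exp (-(x * cosh t)) * (sinh t * cosh (ν * t)))
    (f' := fun t => (ν * A t + B 1 t) - x * (B 2 t - B 0 t))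
    (fun t _ => by
      refine ((hasDerivAt_exp_neg_mul_cosh x t).mul
        ((hasDerivAt_sinh t).mul (hasDerivAt_mul_id ν t).cosh)).congr_deriv ?_
      simp only [A, B, Pi.mul_apply, cosh_sq]
      ring)
    (i1.sub (i2.const_mul x))
    (tendsto_exp_neg_mul_cosh_mul hx ν fun t _ => by
      rw [abs_mul, abs_of_pos (cosh_pos (ν * t))]
      exact mul_le_mul_of_nonneg_right (abs_sinh_le_cosh t) (cosh_pos _).le)
  rw [integral_sub i1 (i2.const_mul x), integral_add (hi.const_mul ν) (hk 1), integral_const_mul,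
    integral_const_mul, integral_sub (hk 2) (hk 0)] at key
  simp only [sinh_zero, zero_mul, mul_zero, sub_zero] at key
  have e : ∀ k, besselKMoment k ν x = ∫ t in Ioi (0 : ℝ), B k t := fun k => rfl
  rw [e] at he ⊢
  rw [e, e]
  linear_combination -x * key + ν * he

lemma tendsto_cosh_sub_one_div_sq : Tendsto (fun h : ℝ => (cosh h - 1) / h ^ 2) (𝓝[≠] 0)
    (𝓝 (1 / 2)) := by
  have h1 : Tendsto (fun h : ℝ => sinh h / h) (𝓝[≠] 0) (𝓝 1) := by
    have := hasDerivAt_iff_tendsto_slope.1 (hasDerivAt_sinh 0)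
    rw [cosh_zero] at this
    refine this.congr fun h => ?_
    rw [slope_def_field, sinh_zero, sub_zero, sub_zero]
  have h2 : Tendsto (fun h : ℝ => h / 2) (𝓝[≠] 0) (𝓝[≠] 0) := by
    refine tendsto_nhdsWithin_iff.2 ⟨?_, ?_⟩
    · have : Tendsto (fun h : ℝ => h / 2) (𝓝 0) (𝓝 (0 / 2)) := tendsto_id.div_const 2
      rw [zero_div] at this
      exact this.mono_left nhdsWithin_le_nhds
    · filter_upwards [self_mem_nhdsWithin] with h hh
      exact div_ne_zero hh two_ne_zero
  have h3 := ((h1.comp h2).pow 2).div_const 2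
  rw [one_pow] at h3
  refine h3.congr fun h => ?_
  have h4 : cosh h = 2 * sinh (h / 2) ^ 2 + 1 := by
    have : cosh h = cosh (2 * (h / 2)) := by congr 1; ring
    rw [this, cosh_two_mul, cosh_sq]
    ring
  simp only [Function.comp]
  rw [h4, div_pow]
  rcases eq_or_ne h 0 with rfl | hh
  · simp
  field_simp
  ring

/-- `K_ν(x) ~ √(π/(2x)) e^{-x}` as `x → ∞`, by Laplace's method in the variable `s = t√x`. -/
lemma tendsto_besselK (ν : ℝ) :
    Tendsto (fun x => √x * exp x * besselK ν x) atTop (𝓝 √(π / 2)) := by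
  have h1 : Tendsto (fun x : ℝ => ∫ s in Ioi (0 : ℝ),
      exp (-(x * (cosh (s / √x) - 1))) * cosh (ν * (s / √x))) atTop
      (𝓝 (∫ s in Ioi (0 : ℝ), exp (-(1 / 2) * s ^ 2) * 1)) := by
    refine tendsto_integral_filter_of_dominated_convergence
      (fun s => exp (ν ^ 2 / 1) * exp (-(1 / 4) * s ^ 2)) ?_ ?_ ?_ ?_
    · exact Eventually.of_forall fun x => Measurable.aestronglyMeasurable (by fun_prop)
    · filter_upwards [eventually_ge_atTop 1] with x hx
      refine (ae_restrict_mem measurableSet_Ioi).mono fun s (hs : 0 < s) => ?_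
      have hx0 : 0 < x := by linarith
      have h2 := cosh_pos (ν * (s / √x))
      rw [Real.norm_of_nonneg (by positivity)]
      refine le_trans ?_ (exp_neg_mul_sq_mul_cosh_le one_pos ν s)
      refine mul_le_mul (exp_le_exp.2 ?_) ?_ h2.le (exp_pos _).le
      · have h3 := sq_div_two_le_cosh_sub_one (s / √x)
        rw [div_pow, sq_sqrt hx0.le] at h3
        have h4 := mul_le_mul_of_nonneg_left h3 hx0.le
        have h5 : x * (s ^ 2 / x / 2) = 1 / 2 * s ^ 2 := by field_simp
        rw [h5] at h4
        linarith
      · rw [cosh_le_cosh, abs_mul, abs_mul]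
        refine mul_le_mul_of_nonneg_left ?_ (abs_nonneg _)
        rw [abs_div, abs_of_pos hs, abs_of_nonneg (sqrt_nonneg x)]
        exact div_le_self hs.le (one_le_sqrt.2 hx)
    · exact ((integrable_exp_neg_mul_sq (by norm_num : (0 : ℝ) < 1 / 4)).const_mul _).integrableOn
    · refine (ae_restrict_mem measurableSet_Ioi).mono fun s (hs : 0 < s) => ?_
      have h2 : Tendsto (fun x : ℝ => s / √x) atTop (𝓝 0) :=
        tendsto_const_nhds.div_atTop tendsto_sqrt_atTop
      have h3 : Tendsto (fun x : ℝ => s / √x) atTop (𝓝[≠] 0) := by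
        refine tendsto_nhdsWithin_iff.2 ⟨h2, ?_⟩
        filter_upwards [eventually_gt_atTop 0] with x hx
        exact (div_pos hs (sqrt_pos.2 hx)).ne'
      have h4 := ((tendsto_cosh_sub_one_div_sq.comp h3).const_mul (s ^ 2)).neg
      have h5 := (continuous_cosh.tendsto _).comp (h2.const_mul ν)
      rw [mul_zero, cosh_zero] at h5
      refine ((continuous_exp.tendsto _).comp h4).mul h5 |>.congr' ?_ |>.trans_eq ?_
      · filter_upwards [eventually_gt_atTop 0] with x hx
        simp only [Function.comp]
        congr 2
        rw [div_pow, sq_sqrt hx.le]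
        field_simp
      · congr 2
        ring_nf
  simp only [mul_one] at h1
  rw [integral_gaussian_Ioi] at h1
  have e : √(π / (1 / 2)) / 2 = √(π / 2) := by
    rw [div_div_eq_mul_div, div_one, mul_comm, sqrt_mul two_pos.le, sqrt_div pi_pos.le]
    have h2 : √2 ^ 2 = 2 := sq_sqrt two_pos.le
    have h3 : 0 < √2 := sqrt_pos.2 two_pos
    field_simp
    rw [h2]
  rw [e] at h1
  refine h1.congr' ?_
  filter_upwards [eventually_gt_atTop 0] with x hx
  have hsx := sqrt_pos.2 hx
  have h5 := integral_comp_mul_left_Ioi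
    (fun s : ℝ => exp (-(x * (cosh (s / √x) - 1))) * cosh (ν * (s / √x))) 0 hsx
  simp only [mul_zero, smul_eq_mul, mul_div_cancel_left₀ _ hsx.ne'] at h5
  rw [eq_inv_mul_iff_mul_eq₀ hsx.ne'] at h5
  rw [← h5, mul_assoc, besselK, ← integral_const_mul (exp x)]
  congr 2
  funext t
  rw [← mul_assoc, ← exp_add]
  congr 2
  ring

/-! ### Bessel-type solutions -/

section BesselSolutions

variable {lam μ c ε ν : ℝ}

/-- The equation `zF'' + (ν+1)F' - (λ/ε)F = 0` for `F`, with `ν = λ/ε - 1`, becomes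
`p h'' + (2ε+2μp-λ)h' + (2με+μ²p-2μλ)h = 0` for `h = e^{-μu} p^ν F(μp/ε)`. -/
lemma expPowMul_ode_bessel (hμ : 0 < μ) (hε : 0 < ε) (hν : ν = -1 + lam / ε) {F F' F'' : ℝ → ℝ}
    {u : ℝ} (hp : 0 < linPremium c ε u)
    (hF : ∀ z, 0 < z → z * F'' z + (ν + 1) * F' z - lam / ε * F z = 0) :
    linPremium c ε u * expPowMulDeriv₂ μ c ε ν F F' F'' u
      + (2 * ε + 2 * μ * linPremium c ε u - lam) * expPowMulDeriv μ c ε ν F F' u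
      + (2 * μ * ε + μ ^ 2 * linPremium c ε u - 2 * μ * lam) * expPowMul μ c ε ν F u = 0 := by
  have h1 := hF (μ * linPremium c ε u / ε) (by positivity)
  simp only [expPowMulDeriv₂, expPowMulDeriv, expPowMul]
  set p := linPremium c ε u
  set G := F (μ * p / ε)
  set G' := F' (μ * p / ε)
  set G'' := F'' (μ * p / ε)
  have hlam : lam = ε * (ν + 1) := by
    rw [hν]
    field_simp
    ring
  have h4 : μ * p * G'' + ε * (ν + 1) * G' - lam * G = 0 := by
    have h5 : μ * p / ε * ε = μ * p := div_mul_cancel₀ _ hε.ne'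
    have h6 : lam / ε * ε = lam := div_mul_cancel₀ _ hε.ne'
    linear_combination ε * h1 - G'' * h5 + G * h6
  have h6 : p * (μ ^ 2 * G'' + 2 * μ * (ε * ν / p - μ) * G'
        + ((ε * ν / p - μ) ^ 2 - ε ^ 2 * ν / p ^ 2) * G)
      + (2 * ε + 2 * μ * p - lam) * (μ * G' + (ε * ν / p - μ) * G)
      + (2 * μ * ε + μ ^ 2 * p - 2 * μ * lam) * G = 0 := by
    have h7 : p * (ε ^ 2 * ν / p ^ 2) = ε ^ 2 * ν / p := by
      field_simp
    have h8 : ε * ν / p * p = ε * ν := div_mul_cancel₀ _ hp.ne'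
    have h9 : ε ^ 2 * ν / p = ε * (ε * ν / p) := by ring
    rw [hlam] at h4 ⊢
    linear_combination μ * h4 - G * h7 - G * h9
      + (2 * μ * G' + ε * ν / p * G) * h8
  linear_combination exp (-(μ * u)) * p ^ ν * h6

/-- The solution of `zF'' + (ν+1)F' - LF = 0` that belongs to `I_ν`. -/
noncomputable def besselFunI (L ν A z : ℝ) : ℝ := A * powSum (besselCoeff ν) (L * z)

/-- The derivative of `besselFunI`. -/
noncomputable def besselFunIDeriv (L ν A z : ℝ) : ℝ :=
  A * (L * powSum (besselCoeff (ν + 1)) (L * z))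

/-- The second derivative of `besselFunI`. -/
noncomputable def besselFunIDeriv₂ (L ν A z : ℝ) : ℝ :=
  A * (L * (L * powSum (besselCoeff (ν + 2)) (L * z)))

lemma hasDerivAt_powSum_besselCoeff (hν : -1 < ν) (L z : ℝ) :
    HasDerivAt (fun z => powSum (besselCoeff ν) (L * z))
      (L * powSum (besselCoeff (ν + 1)) (L * z)) z := by
  have h1 := (entireCoeff_besselCoeff hν).hasDerivAt (L * z)
  rw [derivCoeff_besselCoeff] at h1
  exact (h1.comp z (hasDerivAt_mul_id L z)).congr_deriv (by ring)

lemma hasDerivAt_besselFunI (hν : -1 < ν) (L A z : ℝ) :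
    HasDerivAt (besselFunI L ν A) (besselFunIDeriv L ν A z) z :=
  (hasDerivAt_powSum_besselCoeff hν L z).const_mul A

lemma hasDerivAt_besselFunIDeriv (hν : -1 < ν) (L A z : ℝ) :
    HasDerivAt (besselFunIDeriv L ν A) (besselFunIDeriv₂ L ν A z) z := by
  have := ((hasDerivAt_powSum_besselCoeff (ν := ν + 1) (by linarith) L z).const_mul L).const_mul A
  rwa [add_assoc ν 1 1, one_add_one_eq_two] at this

lemma besselFunI_ode (hν : -1 < ν) (L A z : ℝ) :
    z * besselFunIDeriv₂ L ν A z + (ν + 1) * besselFunIDeriv L ν A z - L * besselFunI L ν A z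
      = 0 := by
  simp only [besselFunI, besselFunIDeriv, besselFunIDeriv₂]
  linear_combination A * L * powSum_besselCoeff_ode hν (L * z)

/-- The solution of `zF'' + (ν+1)F' - LF = 0` that belongs to `K_ν`. -/
noncomputable def besselFunK (L ν A z : ℝ) : ℝ :=
  A * (z ^ (-ν / 2) * besselKMoment 0 ν (2 * √(L * z)))

/-- The derivative of `besselFunK`. -/
noncomputable def besselFunKDeriv (L ν A z : ℝ) : ℝ :=
  A * (z ^ (-ν / 2 - 1) * (-(ν * besselKMoment 0 ν (2 * √(L * z))
    + 2 * √(L * z) * besselKMoment 1 ν (2 * √(L * z))) / 2))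

/-- The second derivative of `besselFunK`. -/
noncomputable def besselFunKDeriv₂ (L ν A z : ℝ) : ℝ :=
  A * (z ^ (-ν / 2 - 2) * (-((-ν / 2 - 1) * (ν * besselKMoment 0 ν (2 * √(L * z))
    + 2 * √(L * z) * besselKMoment 1 ν (2 * √(L * z)))
    + √(L * z) * ((1 - ν) * besselKMoment 1 ν (2 * √(L * z))
      - 2 * √(L * z) * besselKMoment 2 ν (2 * √(L * z)))) / 2))

lemma hasDerivAt_two_mul_sqrt {L z : ℝ} (hL : 0 < L) (hz : 0 < z) :
    HasDerivAt (fun z => 2 * √(L * z)) (√(L * z) / z) z := by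
  have h0 : 0 < L * z := by positivity
  refine (((hasDerivAt_mul_id L z).sqrt h0.ne').const_mul 2).congr_deriv ?_
  have h1 := sqrt_pos.2 h0
  have h2 := sq_sqrt h0.le
  field_simp
  rw [h2]

lemma hasDerivAt_besselKMoment_comp {L z : ℝ} (hL : 0 < L) (hz : 0 < z) (k : ℕ) :
    HasDerivAt (fun z => besselKMoment k ν (2 * √(L * z)))
      (-besselKMoment (k + 1) ν (2 * √(L * z)) * (√(L * z) / z)) z := by
  have h0 : 0 < L * z := by positivity
  have h1 : 0 < 2 * √(L * z) := by
    have := sqrt_pos.2 h0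
    positivity
  exact (hasDerivAt_besselKMoment k ν h1).comp z (hasDerivAt_two_mul_sqrt hL hz)

lemma hasDerivAt_besselFunK {L : ℝ} (hL : 0 < L) (A : ℝ) {z : ℝ} (hz : 0 < z) :
    HasDerivAt (besselFunK L ν A) (besselFunKDeriv L ν A z) z := by
  have h1 : HasDerivAt (fun z : ℝ => z ^ (-ν / 2)) (-ν / 2 * z ^ (-ν / 2 - 1)) z :=
    hasDerivAt_rpow_const (Or.inl hz.ne')
  refine ((h1.mul (hasDerivAt_besselKMoment_comp hL hz 0)).const_mul A).congr_deriv ?_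
  simp only [besselFunKDeriv, zero_add]
  have e : z ^ (-ν / 2) = z ^ (-ν / 2 - 1) * z := by
    rw [← rpow_add_one hz.ne', sub_add_cancel]
  rw [e]
  field_simp
  ring

lemma hasDerivAt_besselFunKDeriv {L : ℝ} (hL : 0 < L) (A : ℝ) {z : ℝ} (hz : 0 < z) :
    HasDerivAt (besselFunKDeriv L ν A) (besselFunKDeriv₂ L ν A z) z := by
  have h1 : HasDerivAt (fun z : ℝ => z ^ (-ν / 2 - 1))
      ((-ν / 2 - 1) * z ^ (-ν / 2 - 1 - 1)) z :=
    hasDerivAt_rpow_const (Or.inl hz.ne')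
  have h2 := (((hasDerivAt_besselKMoment_comp (ν := ν) hL hz 0).const_mul ν).add
    ((hasDerivAt_two_mul_sqrt hL hz).mul (hasDerivAt_besselKMoment_comp (ν := ν) hL hz 1))).neg.div_const 2
  refine ((h1.mul h2).const_mul A).congr_deriv ?_
  have e1 : -ν / 2 - 1 - 1 = -ν / 2 - 2 := by ring
  have e : z ^ (-ν / 2 - 1) = z ^ (-ν / 2 - 2) * z := by
    rw [← rpow_add_one hz.ne']
    congr 1
    ring
  simp only [besselFunKDeriv₂, Pi.add_apply, Pi.mul_apply, Pi.neg_apply, zero_add, one_add_one_eq_two]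
  rw [e1, e]
  field_simp
  ring

lemma besselFunK_ode {L : ℝ} (hL : 0 < L) (A : ℝ) {z : ℝ} (hz : 0 < z) :
    z * besselFunKDeriv₂ L ν A z + (ν + 1) * besselFunKDeriv L ν A z - L * besselFunK L ν A z
      = 0 := by
  have h0 : 0 < L * z := by positivity
  have hx : 0 < 2 * √(L * z) := by
    have := sqrt_pos.2 h0
    positivity
  have h1 := besselKMoment_ode hx ν
  have h2 : (2 * √(L * z)) ^ 2 = 4 * (L * z) := by
    rw [mul_pow, sq_sqrt h0.le]
    ring
  have h3 := sq_sqrt h0.le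
  rw [h2] at h1
  have e2 : z ^ (-ν / 2 - 1) = z ^ (-ν / 2 - 2) * z := by
    rw [← rpow_add_one hz.ne']
    congr 1
    ring
  have e1 : z ^ (-ν / 2) = z ^ (-ν / 2 - 1) * z := by
    rw [← rpow_add_one hz.ne', sub_add_cancel]
  simp only [besselFunK, besselFunKDeriv, besselFunKDeriv₂]
  rw [e1, e2]
  set y := √(L * z)
  set K0 := besselKMoment 0 ν (2 * y)
  set K1 := besselKMoment 1 ν (2 * y)
  set K2 := besselKMoment 2 ν (2 * y)
  linear_combination A * z ^ (-ν / 2 - 2) * z * (h1 / 4 + K2 * h3)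

/-- The argument of the Bessel functions in the solutions, `2√((u + c/ε)λμ/ε) = (2/ε)√(λμp)`. -/
noncomputable def besselArg (lam μ c ε u : ℝ) : ℝ := 2 * √((u + c / ε) * lam * μ / ε)

lemma besselArg_eq_two_mul_sqrt (hε : 0 < ε) (u : ℝ) :
    besselArg lam μ c ε u = 2 * √(lam / ε * (μ * linPremium c ε u / ε)) := by
  unfold besselArg linPremium
  congr 2
  field_simp
  ring

lemma besselArg_eq_div (hε : 0 < ε) (u : ℝ) :
    besselArg lam μ c ε u = 2 / ε * √(lam * μ * linPremium c ε u) := by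
  rw [besselArg_eq_two_mul_sqrt hε]
  have : lam / ε * (μ * linPremium c ε u / ε) = (lam * μ * linPremium c ε u) / ε ^ 2 := by
    field_simp
  rw [this, sqrt_div' _ (by positivity), sqrt_sq hε.le]
  ring

lemma besselArg_pos (hlam : 0 < lam) (hμ : 0 < μ) (hc : 0 < c) (hε : 0 < ε) {u : ℝ} (hu : 0 ≤ u) :
    0 < besselArg lam μ c ε u := by
  have hp := linPremium_pos hc hε hu
  rw [besselArg_eq_div hε]
  have := sqrt_pos.2 (by positivity : 0 < lam * μ * linPremium c ε u)
  positivity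

lemma exp_neg_div_mul_linPremium (hε : 0 < ε) (u : ℝ) :
    exp (-(μ / ε * linPremium c ε u)) = exp (-(μ * c / ε)) * exp (-(μ * u)) := by
  rw [← exp_add]
  congr 1
  unfold linPremium
  field_simp
  ring

lemma besselSolI_eq_expPowMul (hlam : 0 < lam) (hμ : 0 < μ) (hc : 0 < c) (hε : 0 < ε)
    (hν : ν = -1 + lam / ε) {u : ℝ} (hu : 0 ≤ u) :
    besselSolI lam μ c ε u = expPowMul μ c ε ν
      (besselFunI (lam / ε) ν (exp (-(μ * c / ε)) * (lam / ε * (μ / ε)) ^ (ν / 2))) u := by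
  have hp := linPremium_pos hc hε hu
  have hx := besselArg_pos hlam hμ hc hε hu
  have e0 : -1 / 2 + lam / (2 * ε) = ν / 2 := by
    rw [hν]
    field_simp
  have h1 : 0 ≤ lam / ε * (μ * linPremium c ε u / ε) := by positivity
  have h2 : besselArg lam μ c ε u ^ 2 / 4 = lam / ε * (μ * linPremium c ε u / ε) := by
    rw [besselArg_eq_two_mul_sqrt hε, mul_pow, sq_sqrt h1]
    ring
  have h3 : (besselArg lam μ c ε u / 2) ^ ν
      = (lam / ε * (μ / ε)) ^ (ν / 2) * linPremium c ε u ^ (ν / 2) := by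
    rw [besselArg_eq_two_mul_sqrt hε, mul_div_cancel_left₀ _ two_ne_zero, sqrt_eq_rpow,
      ← rpow_mul h1, ← mul_rpow (by positivity) hp.le]
    congr 1 <;> ring
  have h4 : linPremium c ε u ^ ν = linPremium c ε u ^ (ν / 2) * linPremium c ε u ^ (ν / 2) := by
    rw [← rpow_add hp, add_halves]
  have h5 : besselSolI lam μ c ε u = exp (-(μ / ε * linPremium c ε u)) *
      linPremium c ε u ^ (ν / 2) * besselI ν (besselArg lam μ c ε u) := by
    rw [besselSolI, e0, ← hν]
    rfl
  rw [h5, besselI_eq ν hx, h2, h3, exp_neg_div_mul_linPremium hε, expPowMul, besselFunI, h4]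
  ring

lemma besselSolK_eq_expPowMul (hμ : 0 < μ) (hc : 0 < c) (hε : 0 < ε)
    (hν : ν = -1 + lam / ε) {u : ℝ} (hu : 0 ≤ u) :
    besselSolK lam μ c ε u = expPowMul μ c ε ν
      (besselFunK (lam / ε) ν (exp (-(μ * c / ε)) * (μ / ε) ^ (ν / 2))) u := by
  have hp := linPremium_pos hc hε hu
  have e0 : -1 / 2 + lam / (2 * ε) = ν / 2 := by
    rw [hν]
    field_simp
  have h3 : (μ * linPremium c ε u / ε) ^ (-ν / 2)
      = ((μ / ε) ^ (ν / 2))⁻¹ * (linPremium c ε u ^ (ν / 2))⁻¹ := by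
    rw [mul_div_right_comm, neg_div, mul_rpow (by positivity) hp.le, rpow_neg (by positivity),
      rpow_neg hp.le]
  have h4 : linPremium c ε u ^ ν = linPremium c ε u ^ (ν / 2) * linPremium c ε u ^ (ν / 2) := by
    rw [← rpow_add hp, add_halves]
  have h5 : besselSolK lam μ c ε u = exp (-(μ / ε * linPremium c ε u)) *
      linPremium c ε u ^ (ν / 2) * besselK ν (besselArg lam μ c ε u) := by
    rw [besselSolK, e0, ← hν]
    rfl
  have h6 := rpow_pos_of_pos hp (ν / 2)
  have h7 := rpow_pos_of_pos (div_pos hμ hε) (ν / 2)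
  rw [h5, besselK_eq, exp_neg_div_mul_linPremium hε, expPowMul, besselFunK, h4, h3,
    besselArg_eq_two_mul_sqrt hε]
  generalize besselKMoment 0 ν _ = K
  field_simp

lemma neg_one_lt_order (hlam : 0 < lam) (hε : 0 < ε) (hν : ν = -1 + lam / ε) : -1 < ν := by
  have := div_pos hlam hε
  linarith

/-- `z^{-ν/2} K_ν(2 √(Lz))` is decreasing, because `x K_ν'(x) < -|ν| K_ν(x)`. -/
lemma besselFunKDeriv_neg {L A z : ℝ} (hL : 0 < L) (hA : 0 < A) (hz : 0 < z) :
    besselFunKDeriv L ν A z < 0 := by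
  have hx : 0 < 2 * √(L * z) := by
    have := sqrt_pos.2 (by positivity : 0 < L * z)
    positivity
  have h1 := abs_mul_besselKMoment_lt hx ν
  have h2 := besselKMoment_pos 0 ν hx
  have h3 : -|ν| * besselKMoment 0 ν (2 * √(L * z)) ≤ ν * besselKMoment 0 ν (2 * √(L * z)) :=
    mul_le_mul_of_nonneg_right (neg_abs_le ν) h2.le
  have h4 : 0 < A * z ^ (-ν / 2 - 1) := by positivity
  rw [besselFunKDeriv, ← mul_assoc]
  refine mul_neg_of_pos_of_neg h4 ?_
  linarith

/-- `besselSolI` and `besselSolK` span the solutions of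
`p h'' + (2ε+2μp-λ)h' + (2με+μ²p-2μλ)h = 0`. -/
lemma solvesODE_iff_besselSol (hlam : 0 < lam) (hμ : 0 < μ) (hc : 0 < c) (hε : 0 < ε)
    (h : ℝ → ℝ) :
    SolvesODE (linPremium c ε) (fun u => 2 * ε + 2 * μ * linPremium c ε u - lam)
      (fun u => 2 * μ * ε + μ ^ 2 * linPremium c ε u - 2 * μ * lam) h ↔
      ∃ C₁ C₂ : ℝ, ∀ u, 0 ≤ u → h u = C₁ * besselSolI lam μ c ε u + C₂ * besselSolK lam μ c ε u := by
  obtain ⟨ν, hν⟩ : ∃ ν : ℝ, ν = -1 + lam / ε := ⟨_, rfl⟩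
  have hν1 := neg_one_lt_order hlam hε hν
  have hL : 0 < lam / ε := div_pos hlam hε
  set AI := exp (-(μ * c / ε)) * (lam / ε * (μ / ε)) ^ (ν / 2)
  set AK := exp (-(μ * c / ε)) * (μ / ε) ^ (ν / 2)
  have hAI : 0 < AI := by positivity
  have hAK : 0 < AK := by positivity
  have hp : ∀ u, 0 ≤ u → 0 < linPremium c ε u := fun u hu => linPremium_pos hc hε hu
  have hz : ∀ u, 0 ≤ u → 0 < μ * linPremium c ε u / ε := fun u hu => by
    have := hp u hu
    positivity
  have hI : ∀ u, 0 ≤ u → besselSolI lam μ c ε u = expPowMul μ c ε ν (besselFunI (lam / ε) ν AI) u :=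
    fun u hu => besselSolI_eq_expPowMul hlam hμ hc hε hν hu
  have hK : ∀ u, 0 ≤ u → besselSolK lam μ c ε u = expPowMul μ c ε ν (besselFunK (lam / ε) ν AK) u :=
    fun u hu => besselSolK_eq_expPowMul hμ hc hε hν hu
  have key := solvesODE_iff_exists_eq_add
    (a₂ := linPremium c ε) (a₁ := fun u => 2 * ε + 2 * μ * linPremium c ε u - lam)
    (a₀ := fun u => 2 * μ * ε + μ ^ 2 * linPremium c ε u - 2 * μ * lam)
    (f := expPowMul μ c ε ν (besselFunI (lam / ε) ν AI))
    (f' := expPowMulDeriv μ c ε ν (besselFunI (lam / ε) ν AI) (besselFunIDeriv (lam / ε) ν AI))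
    (f'' := expPowMulDeriv₂ μ c ε ν (besselFunI (lam / ε) ν AI) (besselFunIDeriv (lam / ε) ν AI)
      (besselFunIDeriv₂ (lam / ε) ν AI))
    (g := expPowMul μ c ε ν (besselFunK (lam / ε) ν AK))
    (g' := expPowMulDeriv μ c ε ν (besselFunK (lam / ε) ν AK) (besselFunKDeriv (lam / ε) ν AK))
    (g'' := expPowMulDeriv₂ μ c ε ν (besselFunK (lam / ε) ν AK) (besselFunKDeriv (lam / ε) ν AK)
      (besselFunKDeriv₂ (lam / ε) ν AK))
    (fun u hu => (hp u hu).ne') (fun u hu => ⟨?_, ?_, ?_⟩) (fun u hu => ⟨?_, ?_, ?_⟩)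
    (fun u hu => ?_) h
  · rw [key]
    refine exists_congr fun C₁ => exists_congr fun C₂ => forall₂_congr fun u hu => ?_
    rw [hI u hu, hK u hu]
  · exact (hasDerivAt_expPowMul hε (hp u hu) (hasDerivAt_besselFunI hν1 _ _ _)).hasDerivWithinAt
  · exact (hasDerivAt_expPowMulDeriv hε (hp u hu) (hasDerivAt_besselFunI hν1 _ _ _)
      (hasDerivAt_besselFunIDeriv hν1 _ _ _)).hasDerivWithinAt
  · exact expPowMul_ode_bessel hμ hε hν (hp u hu) fun z _ => besselFunI_ode hν1 _ _ z
  · exact (hasDerivAt_expPowMul hε (hp u hu)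
      (hasDerivAt_besselFunK hL _ (hz u hu))).hasDerivWithinAt
  · exact (hasDerivAt_expPowMulDeriv hε (hp u hu) (hasDerivAt_besselFunK hL _ (hz u hu))
      (hasDerivAt_besselFunKDeriv hL _ (hz u hu))).hasDerivWithinAt
  · exact expPowMul_ode_bessel hμ hε hν (hp u hu) fun z hz => besselFunK_ode hL _ hz
  · -- After removal of the common factor, one solution increases and the other decreases.
    set z := μ * linPremium c ε u / ε with hzdef
    have e : expPowMul μ c ε ν (besselFunI (lam / ε) ν AI) u
          * expPowMulDeriv μ c ε ν (besselFunK (lam / ε) ν AK) (besselFunKDeriv (lam / ε) ν AK) u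
        - expPowMulDeriv μ c ε ν (besselFunI (lam / ε) ν AI) (besselFunIDeriv (lam / ε) ν AI) u
          * expPowMul μ c ε ν (besselFunK (lam / ε) ν AK) u
        = -((exp (-(μ * u)) * linPremium c ε u ^ ν) ^ 2 * μ
          * (besselFunI (lam / ε) ν AI z * -besselFunKDeriv (lam / ε) ν AK z
            + besselFunIDeriv (lam / ε) ν AI z * besselFunK (lam / ε) ν AK z)) := by
      simp only [expPowMul, expPowMulDeriv, ← hzdef]
      ring
    rw [e]
    have h1 := rpow_pos_of_pos (hp u hu) ν
    have hz' : 0 < z := hz u hu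
    have hLz : 0 < lam / ε * z := by positivity
    have h3 : 0 < besselFunI (lam / ε) ν AI z :=
      mul_pos hAI ((entireCoeff_besselCoeff hν1).powSum_pos hLz.le)
    have h4 : 0 < besselFunIDeriv (lam / ε) ν AI z :=
      mul_pos hAI (mul_pos hL
        ((entireCoeff_besselCoeff (ν := ν + 1) (by linarith)).powSum_pos hLz.le))
    have h5 : 0 < besselFunK (lam / ε) ν AK z :=
      mul_pos hAK (mul_pos (rpow_pos_of_pos hz' _) (besselKMoment_pos 0 ν
        (mul_pos two_pos (sqrt_pos.2 hLz))))
    have h6 := neg_pos.2 (besselFunKDeriv_neg (ν := ν) hL hAK hz')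
    exact (neg_neg_of_pos (by positivity)).ne

/-- `p h_K' < (λ - ε) h_K` at `0`. A ruin probability with `ψ' = C h_K` would have equality here,
because its mean after a claim has derivative zero at `0`. -/
lemma exists_hasDerivWithinAt_besselSolK (hlam : 0 < lam) (hμ : 0 < μ) (hc : 0 < c) (hε : 0 < ε) :
    ∃ d, HasDerivWithinAt (besselSolK lam μ c ε) d (Ici 0) 0 ∧
      c * d < (lam - ε) * besselSolK lam μ c ε 0 := by
  obtain ⟨ν, hν⟩ : ∃ ν : ℝ, ν = -1 + lam / ε := ⟨_, rfl⟩
  have hL : 0 < lam / ε := div_pos hlam hε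
  have hp0 : linPremium c ε 0 = c := by simp [linPremium]
  have hp : 0 < linPremium c ε 0 := by rwa [hp0]
  set AK := exp (-(μ * c / ε)) * (μ / ε) ^ (ν / 2)
  have hAK : 0 < AK := by positivity
  have hz : 0 < μ * linPremium c ε 0 / ε := by positivity
  refine ⟨_, (hasDerivAt_expPowMul (s := ν) hε hp
    (hasDerivAt_besselFunK (ν := ν) hL AK hz)).hasDerivWithinAt.congr_of_mem
    (fun u hu => besselSolK_eq_expPowMul hμ hc hε hν hu) (mem_Ici.2 le_rfl), ?_⟩
  rw [besselSolK_eq_expPowMul hμ hc hε hν le_rfl]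
  simp only [expPowMulDeriv, expPowMul]
  have h6 := besselFunKDeriv_neg (ν := ν) hL hAK hz
  have h5 : 0 < besselFunK (lam / ε) ν AK (μ * linPremium c ε 0 / ε) :=
    mul_pos hAK (mul_pos (rpow_pos_of_pos hz _) (besselKMoment_pos 0 ν
      (mul_pos two_pos (sqrt_pos.2 (by positivity)))))
  have h7 : ε * ν = lam - ε := by
    rw [hν]
    field_simp
    ring
  rw [h7, hp0] at *
  set E := exp (-(μ * 0)) * c ^ ν
  have hE : 0 < E := by positivity
  set G := besselFunK (lam / ε) ν AK (μ * c / ε)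
  set G' := besselFunKDeriv (lam / ε) ν AK (μ * c / ε)
  have e : c * (E * (μ * G' + ((lam - ε) / c - μ) * G))
      = (lam - ε) * (E * G) - E * (c * μ) * (-G' + G) := by
    field_simp
    ring
  rw [e, sub_lt_self_iff]
  have := neg_pos.2 h6
  positivity

lemma continuousOn_besselSolI (hlam : 0 < lam) (hμ : 0 < μ) (hc : 0 < c) (hε : 0 < ε) :
    ContinuousOn (besselSolI lam μ c ε) (Ici 0) := by
  obtain ⟨ν, hν⟩ : ∃ ν : ℝ, ν = -1 + lam / ε := ⟨_, rfl⟩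
  refine ContinuousOn.congr (fun u hu => ?_)
    (fun u hu => besselSolI_eq_expPowMul hlam hμ hc hε hν hu)
  exact (hasDerivAt_expPowMul hε (linPremium_pos hc hε hu) (hasDerivAt_besselFunI
    (neg_one_lt_order hlam hε hν) _ _ _)).continuousAt.continuousWithinAt

lemma continuousOn_besselSolK (hlam : 0 < lam) (hμ : 0 < μ) (hc : 0 < c) (hε : 0 < ε) :
    ContinuousOn (besselSolK lam μ c ε) (Ici 0) := by
  obtain ⟨ν, hν⟩ : ∃ ν : ℝ, ν = -1 + lam / ε := ⟨_, rfl⟩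
  refine ContinuousOn.congr (fun u hu => ?_)
    (fun u hu => besselSolK_eq_expPowMul hμ hc hε hν hu)
  have hp := linPremium_pos hc hε hu
  exact (hasDerivAt_expPowMul hε hp (hasDerivAt_besselFunK (div_pos hlam hε) _
    (by positivity))).continuousAt.continuousWithinAt

/-! ### Asymptotics of the Bessel-type solutions -/

lemma sqrtTail_pos (σ lam μ : ℝ) (hc : 0 < c) (hε : 0 < ε) {u : ℝ} (hu : 0 ≤ u) :
    0 < sqrtTail σ lam μ c ε u :=
  mul_pos (exp_pos _) (rpow_pos_of_pos (linPremium_pos hc hε hu) _)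

lemma continuousOn_sqrtTail (σ lam μ : ℝ) (hc : 0 < c) (hε : 0 < ε) :
    ContinuousOn (sqrtTail σ lam μ c ε) (Ici 0) := by
  have hp := (continuous_linPremium c ε)
  refine ContinuousOn.mul (by fun_prop) ?_
  exact hp.continuousOn.rpow_const fun u hu => Or.inl (linPremium_pos hc hε hu).ne'

lemma integrableOn_sqrtTail {σ : ℝ} (hσ : σ ≤ 1) (hlam : 0 < lam) (hμ : 0 < μ) (hc : 0 < c)
    (hε : 0 < ε) : IntegrableOn (sqrtTail σ lam μ c ε) (Ioi 0) := by
  refine integrable_of_isBigO_exp_neg (b := μ / 2) (by positivity)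
    (continuousOn_sqrtTail σ lam μ hc hε) ?_
  have h1 := (isLittleO_rpow_exp_pos_mul_atTop (-3 / 4 + lam / (2 * ε))
    (by positivity : 0 < μ / (4 * ε))).comp_tendsto (tendsto_linPremium_atTop (c := c) hε)
  have h2 : (fun y => exp (-(μ * y) + σ * (2 / ε * √(lam * μ * linPremium c ε y)))) =O[atTop]
      fun y => exp (-(μ * y) + (μ * linPremium c ε y / 4 + 4 * lam) / ε) := by
    refine IsBigO.of_bound 1 ?_
    filter_upwards [eventually_ge_atTop 0] with y hy
    have hp := linPremium_pos hc hε hy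
    rw [Real.norm_of_nonneg (exp_pos _).le, Real.norm_of_nonneg (exp_pos _).le, one_mul, exp_le_exp]
    -- The inequality of arithmetic and geometric means absorbs the square root in the exponent.
    have h3 : 2 * √(lam * μ * linPremium c ε y) ≤ μ * linPremium c ε y / 4 + 4 * lam := by
      have h4 : lam * μ * linPremium c ε y = 4 * lam * (μ * linPremium c ε y / 4) := by ring
      rw [h4, sqrt_mul (by positivity)]
      have h5 := two_mul_le_add_sq √(4 * lam) √(μ * linPremium c ε y / 4)
      rw [sq_sqrt (by positivity), sq_sqrt (by positivity)] at h5
      linarith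
    have h6 : 0 ≤ 2 / ε * √(lam * μ * linPremium c ε y) := by positivity
    have h7 : σ * (2 / ε * √(lam * μ * linPremium c ε y))
        ≤ (μ * linPremium c ε y / 4 + 4 * lam) / ε := by
      calc _ ≤ 1 * (2 / ε * √(lam * μ * linPremium c ε y)) := by gcongr
        _ = 2 * √(lam * μ * linPremium c ε y) / ε := by ring
        _ ≤ _ := by gcongr
    linarith
  refine (h2.mul h1.isBigO).trans (IsBigO.of_bound (exp (μ * c / (2 * ε) + 4 * lam / ε)) ?_)
  refine Eventually.of_forall fun y => ?_
  simp only [Function.comp]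
  rw [← exp_add, Real.norm_of_nonneg (exp_pos _).le, Real.norm_of_nonneg (exp_pos _).le, ← exp_add,
    exp_le_exp]
  refine le_of_eq ?_
  unfold linPremium
  field_simp
  ring

lemma tendsto_besselArg (hlam : 0 < lam) (hμ : 0 < μ) (hε : 0 < ε) :
    Tendsto (besselArg lam μ c ε) atTop atTop := by
  have h1 : Tendsto (fun u => 2 / ε * √(lam * μ * linPremium c ε u)) atTop atTop :=
    (tendsto_sqrt_atTop.comp
      ((tendsto_linPremium_atTop hε).const_mul_atTop (by positivity))).const_mul_atTop (by positivity)
  exact h1.congr fun u => (besselArg_eq_div hε u).symm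

lemma isLittleO_sqrtTail (hlam : 0 < lam) (hμ : 0 < μ) (hc : 0 < c) (hε : 0 < ε) :
    sqrtTail (-1) lam μ c ε =o[atTop] sqrtTail 1 lam μ c ε := by
  have h1 : Tendsto (fun u => exp (-(2 * besselArg lam μ c ε u))) atTop (𝓝 0) :=
    tendsto_exp_neg_atTop_nhds_zero.comp
      ((tendsto_besselArg hlam hμ hε).const_mul_atTop two_pos)
  refine (isLittleO_iff_tendsto' ?_).2 (h1.congr' ?_)
  · filter_upwards [eventually_ge_atTop 0] with u hu h0
    exact absurd h0 (sqrtTail_pos 1 lam μ hc hε hu).ne'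
  · filter_upwards [eventually_ge_atTop 0] with u hu
    have h2 := rpow_pos_of_pos (linPremium_pos hc hε hu) (-3 / 4 + lam / (2 * ε))
    rw [sqrtTail, sqrtTail, mul_div_mul_right _ _ h2.ne', ← exp_sub, besselArg_eq_div hε]
    congr 1
    ring

/-- The passage from `√x e^{-σx} Φ(x) → ℓ` to the asymptotics of the solution built from `Φ`. -/
lemma isEquivalent_const_mul_sqrtTail (hlam : 0 < lam) (hμ : 0 < μ) (hc : 0 < c) (hε : 0 < ε)
    {σ l : ℝ} (hl : 0 < l) {Φ : ℝ → ℝ}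
    (hΦ : Tendsto (fun x => √x * exp (-(σ * x)) * Φ x) atTop (𝓝 l)) :
    (fun u => exp (-(μ / ε * linPremium c ε u)) * linPremium c ε u ^ (-1 / 2 + lam / (2 * ε)) *
      Φ (besselArg lam μ c ε u)) ~[atTop]
    fun u => l * (√(ε / 2) / √√(lam * μ)) * exp (-(μ * c / ε)) * sqrtTail σ lam μ c ε u := by
  have h1 := (hΦ.comp (tendsto_besselArg (c := c) hlam hμ hε)).div_const l
  rw [div_self hl.ne'] at h1
  refine isEquivalent_of_tendsto_one (h1.congr' ?_)
  filter_upwards [eventually_ge_atTop 0] with u hu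
  have hp := linPremium_pos hc hε hu
  simp only [Function.comp, Pi.div_apply, sqrtTail]
  have h2 : √(besselArg lam μ c ε u) = √√(lam * μ) / √(ε / 2) * linPremium c ε u ^ (1 / 4 : ℝ) := by
    have h3 : besselArg lam μ c ε u = √(lam * μ) / (ε / 2) * √(linPremium c ε u) := by
      rw [besselArg_eq_div hε, sqrt_mul (by positivity)]
      field_simp
    rw [h3, sqrt_mul (by positivity), sqrt_div (by positivity)]
    congr 1
    rw [sqrt_eq_rpow, sqrt_eq_rpow, ← rpow_mul hp.le]
    norm_num
  have h4 : linPremium c ε u ^ (-1 / 2 + lam / (2 * ε))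
      = linPremium c ε u ^ (-3 / 4 + lam / (2 * ε)) * linPremium c ε u ^ (1 / 4 : ℝ) := by
    rw [← rpow_add hp]
    congr 1
    ring
  have h5 := rpow_pos_of_pos hp (-3 / 4 + lam / (2 * ε))
  have h6 := rpow_pos_of_pos hp (1 / 4 : ℝ)
  have h7 : 0 < √√(lam * μ) := sqrt_pos.2 (sqrt_pos.2 (by positivity))
  have h8 : 0 < √(ε / 2) := sqrt_pos.2 (by positivity)
  rw [h2, h4, exp_neg_div_mul_linPremium hε, exp_add, ← besselArg_eq_div hε, exp_neg (σ * _)]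
  have h9 := exp_pos (-(μ * u))
  have h10 := exp_pos (-(μ * c / ε))
  have h11 := exp_pos (σ * besselArg lam μ c ε u)
  generalize Φ (besselArg lam μ c ε u) = Y
  field_simp

lemma besselSolI_isEquivalent (hlam : 0 < lam) (hμ : 0 < μ) (hc : 0 < c) (hε : 0 < ε) :
    besselSolI lam μ c ε ~[atTop] fun u =>
      √(ε / 2) / √(2 * π * √(lam * μ)) * exp (-(μ * c / ε)) * sqrtTail 1 lam μ c ε u := by
  have h0 : 0 < √(2 * π) := sqrt_pos.2 (by positivity)
  have h1 := isEquivalent_const_mul_sqrtTail hlam hμ hc hε (σ := 1) (l := 1 / √(2 * π))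
    (Φ := besselI (-1 + lam / ε)) (by positivity)
    (by simpa only [one_mul] using tendsto_besselI (neg_one_lt_order hlam hε rfl))
  refine h1.congr_right (Eventually.of_forall fun u => ?_)
  rw [sqrt_mul (by positivity : 0 ≤ 2 * π)]
  ring

lemma besselSolK_isEquivalent (hlam : 0 < lam) (hμ : 0 < μ) (hc : 0 < c) (hε : 0 < ε) :
    besselSolK lam μ c ε ~[atTop] fun u =>
      √(ε / 2) * √(π / (2 * √(lam * μ))) * exp (-(μ * c / ε)) * sqrtTail (-1) lam μ c ε u := by
  have h1 := isEquivalent_const_mul_sqrtTail hlam hμ hc hε (σ := -1) (l := √(π / 2))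
    (Φ := besselK (-1 + lam / ε)) (sqrt_pos.2 (by positivity))
    (by simpa only [neg_mul, one_mul, neg_neg] using tendsto_besselK (-1 + lam / ε))
  refine h1.congr_right (Eventually.of_forall fun u => ?_)
  rw [← div_div, sqrt_div (by positivity : 0 ≤ π / 2)]
  ring

lemma integrableOn_besselSolI (hlam : 0 < lam) (hμ : 0 < μ) (hc : 0 < c) (hε : 0 < ε) :
    IntegrableOn (besselSolI lam μ c ε) (Ioi 0) :=
  integrableOn_Ioi_of_isEquivalent ((integrableOn_sqrtTail le_rfl hlam hμ hc hε).const_mul _)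
    (continuousOn_besselSolI hlam hμ hc hε) (besselSolI_isEquivalent hlam hμ hc hε)

lemma integrableOn_besselSolK (hlam : 0 < lam) (hμ : 0 < μ) (hc : 0 < c) (hε : 0 < ε) :
    IntegrableOn (besselSolK lam μ c ε) (Ioi 0) :=
  integrableOn_Ioi_of_isEquivalent
    ((integrableOn_sqrtTail (by norm_num) hlam hμ hc hε).const_mul _)
    (continuousOn_besselSolK hlam hμ hc hε) (besselSolK_isEquivalent hlam hμ hc hε)

end BesselSolutions

/-! ### The exponential tail integral -/

section ExpTail

variable {μ c ε : ℝ}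

lemma integrableOn_exp_neg_mul_div_linPremium (hμ : 0 < μ) (hc : 0 < c) (hε : 0 < ε) {u : ℝ}
    (hu : 0 ≤ u) : IntegrableOn (fun v => exp (-(μ * v)) / linPremium c ε v) (Ioi u) := by
  have hcont : ContinuousOn (fun v => exp (-(μ * v)) / linPremium c ε v) (Ioi u) := by
    have := continuous_linPremium c ε
    exact ContinuousOn.div (by fun_prop) this.continuousOn fun v (hv : u < v) =>
      (linPremium_pos hc hε (hu.trans hv.le)).ne'
  refine Integrable.mono' ((integrableOn_exp_neg_mul_Ioi hμ u).div_const c)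
    (hcont.aestronglyMeasurable measurableSet_Ioi) ?_
  refine (ae_restrict_mem measurableSet_Ioi).mono fun v (hv : u < v) => ?_
  have hv0 : 0 ≤ v := hu.trans hv.le
  have hp := linPremium_pos hc hε hv0
  rw [Real.norm_of_nonneg (by positivity)]
  have : c ≤ linPremium c ε v := by
    unfold linPremium
    nlinarith
  gcongr

/-- Integration by parts. -/
lemma integral_expTail (hμ : 0 < μ) (hc : 0 < c) (hε : 0 < ε) {u : ℝ} (hu : 0 ≤ u) :
    ∫ y in Ioi u, expTail μ c ε y = 1 / ε * (exp (-(μ * u)) / linPremium c ε u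
      - μ * ∫ v in Ioi u, exp (-(μ * v)) / linPremium c ε v) := by
  have i1 := integrableOn_exp_neg_mul_div_linPremium hμ hc hε hu
  have i2 : IntegrableOn (expTail μ c ε) (Ioi u) :=
    (integrableOn_expTail hμ hc hε).mono_set (Ioi_subset_Ioi hu)
  have hlim : Tendsto (fun v => exp (-(μ * v)) / linPremium c ε v) atTop (𝓝 0) := by
    have h1 : Tendsto (fun u => exp (-(μ * u))) atTop (𝓝 0) :=
      tendsto_exp_neg_atTop_nhds_zero.comp (tendsto_id.const_mul_atTop hμ)
    exact h1.div_atTop (tendsto_linPremium_atTop hε)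
  have key := integral_Ioi_of_hasDerivAt_of_tendsto' (a := u) (m := 0)
    (f := fun v => exp (-(μ * v)) / linPremium c ε v)
    (f' := fun v => -μ * (exp (-(μ * v)) / linPremium c ε v) - ε * expTail μ c ε v)
    (fun v hv => by
      have hp := linPremium_pos hc hε (hu.trans hv)
      refine ((hasDerivAt_exp_neg_mul μ v).div (hasDerivAt_linPremium c ε v) hp.ne').congr_deriv ?_
      rw [expTail, rpow_neg hp.le, rpow_two]
      field_simp)
    ((i1.const_mul (-μ)).sub (i2.const_mul ε)) hlim
  rw [integral_sub (i1.const_mul (-μ)) (i2.const_mul ε), integral_const_mul, integral_const_mul]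
    at key
  field_simp
  linarith

/-- The substitution `t = μ p(v) / ε`. -/
lemma upperGamma_linPremium (hμ : 0 < μ) (hc : 0 < c) (hε : 0 < ε) {u : ℝ} (hu : 0 ≤ u) :
    ∫ v in Ioi u, exp (-(μ * v)) / linPremium c ε v
      = 1 / ε * exp (μ / ε * c) * upperGamma (μ / ε * linPremium c ε u) 0 := by
  have h1 := integral_comp_mul_left_Ioi (fun t : ℝ => t ^ ((0 : ℝ) - 1) * exp (-t))
    (u + c / ε) hμ
  have h2 := (measurePreserving_add_right volume (c / ε)).setIntegral_preimage_emb
    (measurableEmbedding_addRight (c / ε))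
    (fun t : ℝ => (μ * t) ^ ((0 : ℝ) - 1) * exp (-(μ * t))) (Ioi (u + c / ε))
  rw [preimage_add_const_Ioi, add_sub_cancel_right] at h2
  have e : μ / ε * linPremium c ε u = μ * (u + c / ε) := by
    unfold linPremium
    field_simp
    ring
  rw [upperGamma, e, ← inv_mul_eq_iff_eq_mul₀ (mul_pos (one_div_pos.2 hε) (exp_pos _)).ne']
  rw [smul_eq_mul, eq_inv_mul_iff_mul_eq₀ hμ.ne'] at h1
  rw [← h1, ← h2, ← integral_const_mul, ← integral_const_mul]
  refine setIntegral_congr_fun measurableSet_Ioi fun v (hv : u < v) => ?_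
  have hp := linPremium_pos hc hε (hu.trans hv.le)
  have e2 : μ * (v + c / ε) = μ / ε * linPremium c ε v := by
    unfold linPremium
    field_simp
    ring
  have e3 : exp (-(μ / ε * linPremium c ε v)) = (exp (μ / ε * c))⁻¹ * exp (-(μ * v)) := by
    rw [exp_neg_div_mul_linPremium hε, ← exp_neg]
    congr 3
    ring
  rw [e2, e3, zero_sub, rpow_neg_one]
  field_simp

end ExpTail

/-! ### Characteristic roots and their first corrections -/

lemma integrableOn_linPremium_rpow {c ε s : ℝ} (hc : 0 < c) (hε : 0 < ε) (hs : s < -1) {a : ℝ}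
    (ha : 0 ≤ a) : IntegrableOn (fun u => linPremium c ε u ^ s) (Ioi a) := by
  have h1 : IntegrableOn (fun u => ε ^ s * (u + c / ε) ^ s) (Ioi a) :=
    (integrableOn_add_rpow_Ioi_of_lt (m := c / ε) (c := a) hs
      (by have := div_pos hc hε; linarith)).const_mul (ε ^ s)
  refine h1.congr_fun (fun u (hu : a < u) => ?_) measurableSet_Ioi
  have h2 : 0 ≤ u + c / ε := by
    have := div_pos hc hε
    linarith
  simp only
  rw [← mul_rpow hε.le h2, linPremium]
  congr 1
  field_simp
  ring

lemma two_mul_charRoot_add (σ : ℝ) (q₁ q₀ : ℝ → ℝ) (u : ℝ) :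
    2 * charRoot σ q₁ q₀ u + q₁ u = σ * √(charDiscr q₁ q₀ u) := by
  rw [charRoot]
  ring

/-- The first correction in terms of the derivatives `d` of `q₁` and `D` of the discriminant. -/
lemma charCorrection_eq {σ : ℝ} (hσ : σ = 1 ∨ σ = -1) {q₁ q₀ : ℝ → ℝ} {u d D : ℝ}
    (h₁ : HasDerivAt q₁ d u) (hD : HasDerivAt (charDiscr q₁ q₀) D u)
    (hpos : 0 < charDiscr q₁ q₀ u) :
    charCorrection σ q₁ q₀ u
      = σ * d / (2 * √(charDiscr q₁ q₀ u)) - D / (4 * charDiscr q₁ q₀ u) := by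
  have h2 : HasDerivAt (charRoot σ q₁ q₀) ((-d + σ * (D / (2 * √(charDiscr q₁ q₀ u)))) / 2) u :=
    (h₁.neg.add ((hD.sqrt hpos.ne').const_mul σ)).div_const 2
  rw [charCorrection, two_mul_charRoot_add, h2.deriv]
  have h3 := sqrt_pos.2 hpos
  have h4 := sq_sqrt hpos.le
  set r := √(charDiscr q₁ q₀ u)
  rw [← h4]
  rcases hσ with rfl | rfl <;>
  · field_simp
    ring

/-- For `q₁ = m + A/p` and `q₁² - 4q₀ = m₂ + B/p + γ/p²`, the integrand of `expRoot`. -/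
noncomputable def expRootIntegrand (σ c ε m A m₂ B γ u : ℝ) : ℝ :=
  (-(m + A / linPremium c ε u)
      + σ * √(m₂ + B / linPremium c ε u + γ / linPremium c ε u ^ 2)) / 2
    + (σ * (-(ε * A) / linPremium c ε u ^ 2)
        / (2 * √(m₂ + B / linPremium c ε u + γ / linPremium c ε u ^ 2))
      - (-(ε * B) / linPremium c ε u ^ 2 - 2 * ε * γ / linPremium c ε u ^ 3)
        / (4 * (m₂ + B / linPremium c ε u + γ / linPremium c ε u ^ 2)))

section ExpRoot

variable {c ε m A m₂ B γ u₀ σ : ℝ} {q₁ q₀ : ℝ → ℝ}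

lemma continuousOn_expRootIntegrand (hc : 0 < c) (hε : 0 < ε) (hu₀ : 0 ≤ u₀)
    (hpos : ∀ u, u₀ ≤ u → 0 < m₂ + B / linPremium c ε u + γ / linPremium c ε u ^ 2) :
    ContinuousOn (expRootIntegrand σ c ε m A m₂ B γ) (Ici u₀) := by
  have hp : ContinuousOn (linPremium c ε) (Ici u₀) := (continuous_linPremium c ε).continuousOn
  have hp0 : ∀ u ∈ Ici u₀, linPremium c ε u ≠ 0 := fun u hu =>
    (linPremium_pos hc hε (hu₀.trans hu)).ne'
  have hp2 : ∀ u ∈ Ici u₀, linPremium c ε u ^ 2 ≠ 0 := fun u hu => pow_ne_zero _ (hp0 u hu)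
  have hp3 : ∀ u ∈ Ici u₀, linPremium c ε u ^ 3 ≠ 0 := fun u hu => pow_ne_zero _ (hp0 u hu)
  have hD : ContinuousOn
      (fun u => m₂ + B / linPremium c ε u + γ / linPremium c ε u ^ 2) (Ici u₀) :=
    (continuousOn_const.add (continuousOn_const.div hp hp0)).add
      (continuousOn_const.div (hp.pow 2) hp2)
  have hs : ContinuousOn
      (fun u => √(m₂ + B / linPremium c ε u + γ / linPremium c ε u ^ 2)) (Ici u₀) := hD.sqrt
  unfold expRootIntegrand
  refine ContinuousOn.add (ContinuousOn.div_const (ContinuousOn.add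
    (continuousOn_const.add (continuousOn_const.div hp hp0)).neg
    (continuousOn_const.mul hs)) 2) (ContinuousOn.sub ?_ ?_)
  · exact (continuousOn_const.mul (continuousOn_const.div (hp.pow 2) hp2)).div
      (continuousOn_const.mul hs) fun u hu => (mul_pos two_pos (sqrt_pos.2 (hpos u hu))).ne'
  · exact ((continuousOn_const.div (hp.pow 2) hp2).sub (continuousOn_const.div (hp.pow 3) hp3)).div
      (continuousOn_const.mul hD) fun u hu => (mul_pos four_pos (hpos u hu)).ne'

/-- A continuous integrand makes `y ↦ exp (∫_a^y f)` continuous. -/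
lemma continuousOn_exp_integral {f : ℝ → ℝ} {a : ℝ} (hf : ContinuousOn f (Ici a)) :
    ContinuousOn (fun y => exp (∫ z in a..y, f z)) (Ici a) := by
  have hg : Continuous fun x => f (max x a) :=
    hf.comp_continuous (by fun_prop) fun x => mem_Ici.2 (le_max_right x a)
  have h1 : Continuous fun y => ∫ z in a..y, f (max z a) :=
    intervalIntegral.continuous_primitive (fun x y => hg.intervalIntegrable x y) a
  refine (continuous_exp.comp h1).continuousOn.congr fun y hy => ?_
  simp only [Function.comp]
  congr 1
  refine intervalIntegral.integral_congr fun z hz => ?_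
  rw [uIcc_of_le hy] at hz
  simp [hz.1]

lemma expRoot_eq (hc : 0 < c) (hε : 0 < ε) (hu₀ : 0 ≤ u₀) (hσ : σ = 1 ∨ σ = -1)
    (hq₁ : ∀ u, 0 < linPremium c ε u → q₁ u = m + A / linPremium c ε u)
    (hΔ : ∀ u, 0 < linPremium c ε u →
      charDiscr q₁ q₀ u = m₂ + B / linPremium c ε u + γ / linPremium c ε u ^ 2)
    (hpos : ∀ u, u₀ ≤ u → 0 < m₂ + B / linPremium c ε u + γ / linPremium c ε u ^ 2) {y : ℝ}
    (hy : u₀ ≤ y) :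
    expRoot σ q₁ q₀ u₀ y = exp (∫ z in u₀..y, expRootIntegrand σ c ε m A m₂ B γ z) := by
  rw [expRoot]
  congr 1
  refine intervalIntegral.integral_congr fun u hu => ?_
  rw [uIcc_of_le hy] at hu
  have hp := linPremium_pos hc hε (hu₀.trans hu.1)
  have hev : ∀ᶠ v in 𝓝 u, 0 < linPremium c ε v :=
    (continuous_linPremium c ε).continuousAt.eventually_const_lt hp
  have hpu := hasDerivAt_linPremium c ε u
  have d1 : HasDerivAt q₁ (-(ε * A) / linPremium c ε u ^ 2) u := by
    have h1 : HasDerivAt (fun u => m + A / linPremium c ε u) (-(ε * A) / linPremium c ε u ^ 2) u := by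
      refine ((hpu.inv hp.ne').const_mul A).const_add m |>.congr_deriv ?_
      ring
    exact h1.congr_of_eventuallyEq (hev.mono fun v hv => hq₁ v hv)
  have d2 : HasDerivAt (charDiscr q₁ q₀)
      (-(ε * B) / linPremium c ε u ^ 2 - 2 * ε * γ / linPremium c ε u ^ 3) u := by
    have h1 : HasDerivAt (fun u => m₂ + B / linPremium c ε u + γ / linPremium c ε u ^ 2)
        (-(ε * B) / linPremium c ε u ^ 2 - 2 * ε * γ / linPremium c ε u ^ 3) u := by
      refine (((hpu.inv hp.ne').const_mul B).const_add m₂).add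
        (((hpu.pow 2).inv (pow_pos hp 2).ne').const_mul γ) |>.congr_deriv ?_
      simp only [Pi.pow_apply]
      field_simp
      ring
    exact h1.congr_of_eventuallyEq (hev.mono fun v hv => hΔ v hv)
  have h3 := hΔ u hp
  have h4 := hpos u hu.1
  rw [charCorrection_eq hσ d1 d2 (by rw [h3]; exact h4), charRoot, h3, hq₁ u hp]
  rfl

/-- The asymptotics of `expRoot` once the integrand is known up to an integrable error. -/
lemma exists_expRoot_isEquivalent {g g' R target : ℝ → ℝ} {C : ℝ} (hc : 0 < c) (hε : 0 < ε)
    (hu₀ : 0 ≤ u₀) (hσ : σ = 1 ∨ σ = -1)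
    (hq₁ : ∀ u, 0 < linPremium c ε u → q₁ u = m + A / linPremium c ε u)
    (hΔ : ∀ u, 0 < linPremium c ε u →
      charDiscr q₁ q₀ u = m₂ + B / linPremium c ε u + γ / linPremium c ε u ^ 2)
    (hpos : ∀ u, u₀ ≤ u → 0 < m₂ + B / linPremium c ε u + γ / linPremium c ε u ^ 2)
    (hg : ∀ x, u₀ ≤ x → HasDerivAt g (g' x) x) (hg' : ContinuousOn g' (Ici u₀))
    (hR : IntegrableOn R (Ioi u₀))
    (hb : ∀ᶠ x in atTop, |expRootIntegrand σ c ε m A m₂ B γ x - g' x| ≤ C * R x)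
    (ht : ∀ x, u₀ ≤ x → exp (g x) = target x) :
    (∃ κ : ℝ, 0 < κ ∧ expRoot σ q₁ q₀ u₀ ~[atTop] fun y => κ * target y) ∧
      ContinuousOn (expRoot σ q₁ q₀ u₀) (Ici u₀) := by
  have hcont := continuousOn_expRootIntegrand (σ := σ) (m := m) (A := A) hc hε hu₀ hpos
  have he : ∀ y, u₀ ≤ y → expRoot σ q₁ q₀ u₀ y
      = exp (∫ z in u₀..y, expRootIntegrand σ c ε m A m₂ B γ z) :=
    fun y hy => expRoot_eq hc hε hu₀ hσ hq₁ hΔ hpos hy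
  refine ⟨?_, (continuousOn_exp_integral hcont).congr he⟩
  obtain ⟨κ, hκ, h⟩ := exists_exp_integral_isEquivalent hcont hg hg' hR hb
  refine ⟨κ, hκ, (h.congr_left ?_).congr_right ?_⟩
  · filter_upwards [eventually_ge_atTop u₀] with y hy
    exact (he y hy).symm
  · filter_upwards [eventually_ge_atTop u₀] with y hy
    rw [ht y hy]

/-- The integrand is `-μ - 2ε/p + O(p⁻²)` when the discriminant tends to `μ² > 0`. -/
lemma exists_expRoot_isEquivalent_expTail {μ β : ℝ} (hμ : 0 < μ) (hc : 0 < c) (hε : 0 < ε)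
    (hβ : 0 ≤ β) (hu₀ : 0 ≤ u₀) (hA : A + β = 4 * ε)
    (hq₁ : ∀ u, 0 < linPremium c ε u → q₁ u = μ + A / linPremium c ε u)
    (hΔ : ∀ u, 0 < linPremium c ε u →
      charDiscr q₁ q₀ u = μ ^ 2 + 2 * μ * β / linPremium c ε u + γ / linPremium c ε u ^ 2)
    (hpos : ∀ u, u₀ ≤ u → 0 < charDiscr q₁ q₀ u) :
    (∃ κ : ℝ, 0 < κ ∧ expRoot (-1) q₁ q₀ u₀ ~[atTop] fun y => κ * expTail μ c ε y) ∧
      ContinuousOn (expRoot (-1) q₁ q₀ u₀) (Ici u₀) := by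
  have hp : ∀ u, u₀ ≤ u → 0 < linPremium c ε u := fun u hu => linPremium_pos hc hε (hu₀.trans hu)
  have hpos' : ∀ u, u₀ ≤ u →
      0 < μ ^ 2 + 2 * μ * β / linPremium c ε u + γ / linPremium c ε u ^ 2 := fun u hu => by
    rw [← hΔ u (hp u hu)]
    exact hpos u hu
  refine exists_expRoot_isEquivalent (g := fun u => -(μ * u) + Real.log (linPremium c ε u) * (-2))
    (g' := fun u => -μ - 2 * ε / linPremium c ε u) (R := fun u => linPremium c ε u ^ (-2 : ℝ))
    (C := |γ - β ^ 2| / (2 * μ) + ε * |A| / μ + ε * (2 * μ * β + 2 * |γ|) / μ ^ 2)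
    hc hε hu₀ (Or.inr rfl) hq₁ hΔ hpos' (fun u hu => ?_) ?_
    (integrableOn_linPremium_rpow hc hε (by norm_num) hu₀) ?_ (fun u hu => ?_)
  · have h1 : HasDerivAt (fun u : ℝ => -(μ * u)) (-μ) u := (hasDerivAt_mul_id μ u).neg
    refine (h1.add (((hasDerivAt_linPremium c ε u).log (hp u hu).ne').mul_const (-2))).congr_deriv ?_
    ring
  · exact continuousOn_const.sub (continuousOn_const.div (continuous_linPremium c ε).continuousOn
      fun u hu => (hp u hu).ne')
  · have hlim : Tendsto (fun u => μ ^ 2 + 2 * μ * β / linPremium c ε u + γ / linPremium c ε u ^ 2)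
        atTop (𝓝 (μ ^ 2)) := by
      have h1 := tendsto_linPremium_atTop (c := c) hε
      have h2 := (tendsto_const_nhds (x := 2 * μ * β)).div_atTop h1
      have h3 := (tendsto_const_nhds (x := γ)).div_atTop ((tendsto_pow_atTop two_ne_zero).comp h1)
      simpa using! (h2.const_add (μ ^ 2)).add h3
    filter_upwards [eventually_ge_atTop u₀, hlim.eventually_const_lt
      (by nlinarith [pow_pos hμ 2] : (μ / 2) ^ 2 < μ ^ 2),
      (tendsto_linPremium_atTop (c := c) hε).eventually_ge_atTop 1] with u hu hΔu hp1
    have hpu := hp u hu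
    unfold expRootIntegrand
    rw [rpow_neg hpu.le, rpow_two]
    set p := linPremium c ε u
    set D := μ ^ 2 + 2 * μ * β / p + γ / p ^ 2
    have hD : 0 < D := hpos' u hu
    have hs : μ / 2 ≤ √D := le_sqrt_of_sq_le hΔu.le
    have hs0 : 0 < √D := by linarith [half_pos hμ]
    have hsq : √D ^ 2 = D := sq_sqrt hD.le
    have hβp : 0 ≤ β / p := by positivity
    have t1 : |√D - (μ + β / p)| ≤ |γ - β ^ 2| / μ * (p ^ 2)⁻¹ := by
      have h1 : √D - (μ + β / p) = (γ - β ^ 2) * (p ^ 2)⁻¹ / (√D + μ + β / p) := by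
        rw [eq_div_iff (by positivity)]
        have : (√D - (μ + β / p)) * (√D + μ + β / p) = √D ^ 2 - (μ + β / p) ^ 2 := by ring
        rw [this, hsq]
        simp only [D]
        field_simp
        ring
      rw [h1, abs_div, abs_mul, abs_of_pos (by positivity : 0 < (p ^ 2)⁻¹),
        abs_of_pos (by positivity : 0 < √D + μ + β / p), div_mul_eq_mul_div]
      gcongr
      linarith
    have t2 : |ε * A / p ^ 2 / (2 * √D)| ≤ ε * |A| / μ * (p ^ 2)⁻¹ := by
      rw [abs_div, abs_div, abs_mul, abs_of_pos hε, abs_of_pos (by positivity : 0 < p ^ 2),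
        abs_of_pos (by positivity : 0 < 2 * √D), div_mul_eq_mul_div, ← div_eq_mul_inv]
      gcongr
      linarith
    have t3 : |(2 * ε * μ * β / p ^ 2 + 2 * ε * γ / p ^ 3) / (4 * D)|
        ≤ ε * (2 * μ * β + 2 * |γ|) / μ ^ 2 * (p ^ 2)⁻¹ := by
      rw [abs_div, abs_of_pos (by positivity : 0 < 4 * D), div_mul_eq_mul_div]
      have h1 : |2 * ε * μ * β / p ^ 2 + 2 * ε * γ / p ^ 3|
          ≤ ε * (2 * μ * β + 2 * |γ|) * (p ^ 2)⁻¹ := by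
        refine (abs_add_le _ _).trans ?_
        rw [abs_div, abs_div, abs_of_nonneg (by positivity : 0 ≤ 2 * ε * μ * β),
          abs_of_pos (by positivity : 0 < p ^ 2), abs_of_pos (by positivity : 0 < p ^ 3), abs_mul,
          abs_of_pos (by positivity : 0 < 2 * ε)]
        have h2 : 2 * ε * |γ| / p ^ 3 ≤ 2 * ε * |γ| / p ^ 2 := by
          gcongr
          norm_num
        calc _ ≤ 2 * ε * μ * β / p ^ 2 + 2 * ε * |γ| / p ^ 2 := by gcongr
          _ = _ := by ring
      calc _ ≤ ε * (2 * μ * β + 2 * |γ|) * (p ^ 2)⁻¹ / (4 * D) := by gcongr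
        _ ≤ _ := by
          gcongr
          linarith
    have hAe : A = 4 * ε - β := by linarith
    have e : (-(μ + A / p) + -1 * √D) / 2
          + (-1 * (-(ε * A) / p ^ 2) / (2 * √D)
            - (-(ε * (2 * μ * β)) / p ^ 2 - 2 * ε * γ / p ^ 3) / (4 * D))
          - (-μ - 2 * ε / p)
        = -(√D - (μ + β / p)) / 2 + ε * A / p ^ 2 / (2 * √D)
          + (2 * ε * μ * β / p ^ 2 + 2 * ε * γ / p ^ 3) / (4 * D) := by
      have h1 : A / p = 4 * ε / p - β / p := by rw [hAe]; ring
      rw [h1]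
      ring
    rw [e]
    refine (abs_add_le _ _).trans ((add_le_add_left (abs_add_le _ _) _).trans ?_)
    rw [abs_div, abs_neg, abs_two]
    calc _ ≤ |γ - β ^ 2| / μ * (p ^ 2)⁻¹ / 2 + ε * |A| / μ * (p ^ 2)⁻¹
          + ε * (2 * μ * β + 2 * |γ|) / μ ^ 2 * (p ^ 2)⁻¹ := by gcongr
      _ = _ := by
        field_simp
  · rw [exp_add, expTail, rpow_def_of_pos (hp u hu)]

/-- The integrand is `-μ + σ√(λμ/p) + (-3/4 + λ/(2ε))ε/p + O(p^{-3/2})` when the discriminant is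
`4λμ/p + O(p⁻²)`. -/
lemma exists_expRoot_isEquivalent_sqrtTail {lam μ : ℝ} (hlam : 0 < lam) (hμ : 0 < μ) (hc : 0 < c)
    (hε : 0 < ε) (hσ : σ = 1 ∨ σ = -1) (hA : A = 2 * ε - lam)
    (hq₁ : ∀ u, 0 < linPremium c ε u → q₁ u = 2 * μ + A / linPremium c ε u)
    (hΔ : ∀ u, 0 < linPremium c ε u →
      charDiscr q₁ q₀ u = 0 + 4 * lam * μ / linPremium c ε u + A ^ 2 / linPremium c ε u ^ 2) :
    (∃ κ : ℝ, 0 < κ ∧ expRoot σ q₁ q₀ 0 ~[atTop] fun y => κ * sqrtTail σ lam μ c ε y) ∧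
      ContinuousOn (expRoot σ q₁ q₀ 0) (Ici 0) := by
  have hp : ∀ u, 0 ≤ u → 0 < linPremium c ε u := fun u hu => linPremium_pos hc hε hu
  have hσ1 : |σ| = 1 := by rcases hσ with rfl | rfl <;> simp
  have hpos' : ∀ u, 0 ≤ u →
      0 < 0 + 4 * lam * μ / linPremium c ε u + A ^ 2 / linPremium c ε u ^ 2 := fun u hu => by
    have := hp u hu
    positivity
  refine exists_expRoot_isEquivalent
    (g := fun u => -(μ * u) + σ * (2 / ε * √(lam * μ * linPremium c ε u))
      + Real.log (linPremium c ε u) * (-3 / 4 + lam / (2 * ε)))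
    (g' := fun u => -μ + σ * √(lam * μ) / √(linPremium c ε u)
      + (-3 * ε / 4 + lam / 2) / linPremium c ε u)
    (R := fun u => linPremium c ε u ^ (-(3 / 2) : ℝ))
    (C := A ^ 2 / (4 * √(lam * μ)) + ε * |A| / (4 * √(lam * μ)) + ε * A ^ 2 / (16 * lam * μ))
    hc hε le_rfl hσ hq₁ hΔ hpos' (fun u hu => ?_) ?_
    (integrableOn_linPremium_rpow hc hε (by norm_num) le_rfl) ?_ (fun u hu => ?_)
  · have h1 : HasDerivAt (fun u : ℝ => -(μ * u)) (-μ) u := (hasDerivAt_mul_id μ u).neg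
    have hpu := hp u hu
    have h2 : 0 < lam * μ * linPremium c ε u := by positivity
    have h3 := ((((hasDerivAt_linPremium c ε u).const_mul (lam * μ)).sqrt h2.ne').const_mul
      (2 / ε)).const_mul σ
    refine ((h1.add h3).add (((hasDerivAt_linPremium c ε u).log hpu.ne').mul_const
      (-3 / 4 + lam / (2 * ε)))).congr_deriv ?_
    have h4 : 0 < √(lam * μ) := sqrt_pos.2 (by positivity)
    have h5 : 0 < √(linPremium c ε u) := sqrt_pos.2 hpu
    rw [sqrt_mul (by positivity)]
    have h6 : lam * μ = √(lam * μ) ^ 2 := (sq_sqrt (by positivity)).symm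
    have h7 : σ * (2 / ε * (lam * μ * ε / (2 * (√(lam * μ) * √(linPremium c ε u)))))
        = σ * √(lam * μ) / √(linPremium c ε u) := by
      nth_rewrite 1 [h6]
      field_simp
    rw [h7]
    field_simp
  · have hpc := (continuous_linPremium c ε).continuousOn (s := Ici 0)
    refine ContinuousOn.add (continuousOn_const.add (continuousOn_const.div hpc.sqrt
      fun u hu => (sqrt_pos.2 (hp u hu)).ne')) (continuousOn_const.div hpc fun u hu => (hp u hu).ne')
  · filter_upwards [eventually_ge_atTop 0,
      (tendsto_linPremium_atTop (c := c) hε).eventually_ge_atTop 1] with u hu hp1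
    have hpu := hp u hu
    unfold expRootIntegrand
    have hR : linPremium c ε u ^ (-(3 / 2) : ℝ) = (√(linPremium c ε u) ^ 3)⁻¹ := by
      rw [rpow_neg hpu.le, sqrt_eq_rpow, ← rpow_natCast, ← rpow_mul hpu.le]
      norm_num
    rw [hR]
    have hsp : 1 ≤ √(linPremium c ε u) := one_le_sqrt.2 hp1
    have hps : linPremium c ε u = √(linPremium c ε u) ^ 2 := (sq_sqrt hpu.le).symm
    set s := √(linPremium c ε u)
    have hs0 : 0 < s := by linarith
    rw [hps]
    set l := √(lam * μ)
    have hl : 0 < l := sqrt_pos.2 (by positivity)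
    have hll : lam * μ = l ^ 2 := (sq_sqrt (by positivity)).symm
    have hll4 : 4 * lam * μ = 4 * l ^ 2 := by rw [← hll]; ring
    have hll16 : 16 * lam * μ = 16 * l ^ 2 := by rw [← hll]; ring
    rw [hll4, hll16]
    set D := 0 + 4 * l ^ 2 / s ^ 2 + A ^ 2 / (s ^ 2) ^ 2 with hDdef
    clear_value D
    have hDge : 4 * l ^ 2 / s ^ 2 ≤ D := by
      have : 0 ≤ A ^ 2 / (s ^ 2) ^ 2 := by positivity
      linarith
    have hD : 0 < D := lt_of_lt_of_le (by positivity) hDge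
    have hsD : 2 * l / s ≤ √D := by
      refine le_sqrt_of_sq_le (le_trans (le_of_eq ?_) hDge)
      ring
    have hls : 0 < 2 * l / s := by positivity
    have hsD0 : 0 < √D := by linarith
    have hsq : √D ^ 2 = D := sq_sqrt hD.le
    have t1 : |σ * (√D - 2 * l / s) / 2| ≤ A ^ 2 / (4 * l) * (s ^ 3)⁻¹ := by
      have h1 : √D - 2 * l / s = A ^ 2 / s ^ 4 / (√D + 2 * l / s) := by
        rw [eq_div_iff (by positivity)]
        have : (√D - 2 * l / s) * (√D + 2 * l / s) = √D ^ 2 - (2 * l / s) ^ 2 := by ring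
        rw [this, hsq, hDdef]
        ring
      rw [abs_div, abs_mul, hσ1, one_mul, abs_two, h1, abs_of_nonneg (by positivity)]
      have h2 : A ^ 2 / s ^ 4 / (√D + 2 * l / s) ≤ A ^ 2 / s ^ 4 / (2 * l / s) := by
        gcongr
        linarith
      calc _ ≤ A ^ 2 / s ^ 4 / (2 * l / s) / 2 := by gcongr
        _ = _ := by
          field_simp
          norm_num
    have t2 : |σ * (-(ε * A) / (s ^ 2) ^ 2) / (2 * √D)| ≤ ε * |A| / (4 * l) * (s ^ 3)⁻¹ := by
      rw [abs_div, abs_mul, hσ1, one_mul, abs_div, abs_neg, abs_mul, abs_of_pos hε,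
        abs_of_pos (by positivity : 0 < (s ^ 2) ^ 2), abs_of_pos (by positivity : 0 < 2 * √D)]
      calc _ ≤ ε * |A| / (s ^ 2) ^ 2 / (2 * (2 * l / s)) := by gcongr
        _ = _ := by
          field_simp
          norm_num
    have t3 : |ε * A ^ 2 / (4 * D * s ^ 6)| ≤ ε * A ^ 2 / (16 * l ^ 2) * (s ^ 3)⁻¹ := by
      rw [abs_of_nonneg (by positivity)]
      calc _ ≤ ε * A ^ 2 / (4 * (4 * l ^ 2 / s ^ 2) * s ^ 6) := by gcongr
        _ = ε * A ^ 2 / (16 * l ^ 2) * (s ^ 4)⁻¹ := by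
          field_simp
          norm_num
        _ ≤ _ := by
          gcongr
          norm_num
    have e : (-(2 * μ + A / s ^ 2) + σ * √D) / 2
          + (σ * (-(ε * A) / (s ^ 2) ^ 2) / (2 * √D)
            - (-(ε * (4 * l ^ 2)) / (s ^ 2) ^ 2 - 2 * ε * A ^ 2 / (s ^ 2) ^ 3) / (4 * D))
          - (-μ + σ * l / s + (-3 * ε / 4 + lam / 2) / s ^ 2)
        = σ * (√D - 2 * l / s) / 2 + σ * (-(ε * A) / (s ^ 2) ^ 2) / (2 * √D)
          + ε * A ^ 2 / (4 * D * s ^ 6) := by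
      have hlamA : lam = 2 * ε - A := by linarith
      have h1 : (-(ε * (4 * l ^ 2)) / (s ^ 2) ^ 2 - 2 * ε * A ^ 2 / (s ^ 2) ^ 3) / (4 * D)
          = -(ε / (4 * s ^ 2)) - ε * A ^ 2 / (4 * D * s ^ 6) := by
        have h2 : D * s ^ 4 = 4 * l ^ 2 * s ^ 2 + A ^ 2 := by
          rw [hDdef]
          field_simp
          ring
        rw [div_eq_iff (by positivity)]
        field_simp
        linear_combination h2
      rw [h1, hlamA]
      ring
    rw [e]
    refine (abs_add_le _ _).trans ((add_le_add_left (abs_add_le _ _) _).trans ?_)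
    calc _ ≤ A ^ 2 / (4 * l) * (s ^ 3)⁻¹ + ε * |A| / (4 * l) * (s ^ 3)⁻¹
          + ε * A ^ 2 / (16 * l ^ 2) * (s ^ 3)⁻¹ := by gcongr
      _ = _ := by ring
  · rw [exp_add, sqrtTail, rpow_def_of_pos (hp u hu)]

end ExpRoot

/-! ### The flow of the premium and the path between claims -/

/-- The solution at time `t` of `y' = c + εy` with `y(0) = u`. -/
noncomputable def premiumFlow (c ε u t : ℝ) : ℝ := (u + c / ε) * exp (ε * t) - c / ε

lemma le_premiumFlow {c ε u t : ℝ} (hc : 0 < c) (hε : 0 < ε) (hu : 0 ≤ u) (ht : 0 ≤ t) :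
    u ≤ premiumFlow c ε u t := by
  have h1 : 1 ≤ exp (ε * t) := one_le_exp (by positivity)
  have h2 : 0 ≤ u + c / ε := by positivity
  unfold premiumFlow
  nlinarith

@[fun_prop]
lemma measurable_premiumFlow (c ε : ℝ) : Measurable fun q : ℝ × ℝ => premiumFlow c ε q.1 q.2 := by
  unfold premiumFlow; fun_prop

/-- The surplus just after the claims, frozen once it is negative. -/
noncomputable def surplusChain (c ε u : ℝ) (τ X : ℕ → ℝ) : ℕ → ℝ
  | 0 => u
  | n + 1 =>
    if surplusChain c ε u τ X n < 0 then surplusChain c ε u τ X n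
    else premiumFlow c ε (surplusChain c ε u τ X n) (τ n) - X n

lemma surplusChain_succ_neg {c ε u : ℝ} {τ X : ℕ → ℝ} {n : ℕ}
    (h : surplusChain c ε u τ X n < 0) : surplusChain c ε u τ X (n + 1) < 0 := by
  rw [surplusChain, if_pos h]
  exact h

/-- The frozen chain becomes negative exactly when the unfrozen recursion does. -/
lemma exists_neg_iff_exists_surplusChain_neg {c ε u : ℝ} {τ X R : ℕ → ℝ} (h0 : R 0 = u)
    (hR : ∀ n, R (n + 1) = premiumFlow c ε (R n) (τ n) - X n) :
    (∃ n, R n < 0) ↔ ∃ n, surplusChain c ε u τ X n < 0 := by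
  have key : ∀ n, 0 ≤ surplusChain c ε u τ X n → surplusChain c ε u τ X n = R n := by
    intro n
    induction n with
    | zero => exact fun _ => h0.symm
    | succ n ih =>
      intro hn
      have h1 : 0 ≤ surplusChain c ε u τ X n := by
        by_contra h
        exact absurd (surplusChain_succ_neg (not_le.1 h)) (not_lt.2 hn)
      rw [surplusChain, if_neg (not_lt.2 h1), hR, ih h1]
  constructor
  · rintro ⟨n, hn⟩
    by_contra! h
    rw [← key n (h n)] at hn
    exact absurd (h n) (not_le.2 hn)
  · intro h
    classical
    obtain ⟨n, hn, hmin⟩ : ∃ n, surplusChain c ε u τ X n < 0 ∧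
        ∀ m < n, ¬ surplusChain c ε u τ X m < 0 :=
      ⟨Nat.find h, Nat.find_spec h, fun m hm => Nat.find_min h hm⟩
    refine ⟨n, ?_⟩
    cases n with
    | zero =>
      rw [h0]
      exact hn
    | succ n =>
      have h1 := hmin n n.lt_succ_self
      rw [hR, ← key n (not_lt.1 h1)]
      rwa [surplusChain, if_neg h1] at hn

lemma ruinTime_lt_top_iff (V : ℝ → ℝ) : ruinTime V < ⊤ ↔ ∃ t, 0 ≤ t ∧ V t < 0 := by
  simp only [ruinTime, iInf_lt_iff]
  constructor
  · rintro ⟨t, ht, -⟩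
    exact ⟨t, t.2, ht⟩
  · rintro ⟨t, ht, h⟩
    exact ⟨⟨t, ht⟩, h, ENNReal.coe_lt_top⟩

lemma claimCount_eq {τ : ℕ → ℝ} (hτ : ∀ n, 0 < τ n) {n : ℕ} {t : ℝ}
    (h1 : ∑ j ∈ Finset.range n, τ j ≤ t) (h2 : t < ∑ j ∈ Finset.range (n + 1), τ j) :
    claimCount τ t = n := by
  have hmono : Monotone fun n => ∑ j ∈ Finset.range n, τ j :=
    monotone_nat_of_le_succ fun n => by
      rw [Finset.sum_range_succ]
      linarith [hτ n]
  have : {k : ℕ | ∑ j ∈ Finset.range (k + 1), τ j ≤ t} = Iio n := by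
    ext k
    simp only [mem_ofPred_eq, mem_Iio]
    constructor
    · intro hk
      by_contra! hkn
      exact absurd (hk.trans_lt h2) (not_lt.2 (hmono (Nat.succ_le_succ hkn)))
    · exact fun hk => (hmono (Nat.succ_le_of_lt hk)).trans h1
  rw [claimCount, this]
  simp [Set.ncard_eq_toFinset_card']

/-- A path that solves `V(t) = v₀ + ∫₀ᵗ (c + εV)` on `[a, b)` follows the flow there, and so does the
right-hand side up to `b`. -/
lemma eq_premiumFlow_of_integral_eq {c ε v₀ a b : ℝ} {V : ℝ → ℝ} (hε : 0 < ε) (ha : 0 ≤ a)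
    (hab : a < b) (hi : IntervalIntegrable (fun s => linPremium c ε (V s)) volume 0 b)
    (hV : ∀ t ∈ Ico a b, V t = v₀ + ∫ s in (0 : ℝ)..t, linPremium c ε (V s)) :
    ∀ t ∈ Icc a b, v₀ + (∫ s in (0 : ℝ)..t, linPremium c ε (V s)) = premiumFlow c ε (V a) (t - a) := by
  set I : ℝ → ℝ := fun t => ∫ s in (0 : ℝ)..t, linPremium c ε (V s) with hI
  have hb : 0 ≤ b := ha.trans hab.le
  have hIc : ContinuousOn I (Icc 0 b) := by
    have := intervalIntegral.continuousOn_primitive_interval' hi (left_mem_uIcc)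
    rwa [uIcc_of_le hb] at this
  have hVc : ContinuousOn V (Ico a b) :=
    ContinuousOn.congr (continuousOn_const.add (hIc.mono fun t ht => ⟨ha.trans ht.1, ht.2.le⟩)) hV
  have hId : ∀ t ∈ Ico a b, HasDerivWithinAt I (linPremium c ε (V t)) (Ici t) t := by
    intro t ht
    have ht0 : 0 ≤ t := ha.trans ht.1
    refine intervalIntegral.integral_hasDerivWithinAt_right (t := Ioi t) (hi.mono_set ?_)
      ⟨Ioc 0 b, ?_, hi.1.aestronglyMeasurable⟩ ?_
    · rw [uIcc_of_le ht0, uIcc_of_le hb]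
      exact Icc_subset_Icc_right ht.2.le
    · exact mem_of_superset (Ioc_mem_nhdsGT ht.2) (Ioc_subset_Ioc_left ht0)
    · have h1 : ContinuousWithinAt V (Ioi t) t := by
        refine ((hVc t ht).mono_of_mem_nhdsWithin ?_)
        exact mem_of_superset (Ioo_mem_nhdsGT ht.2) fun s hs => ⟨ht.1.trans hs.1.le, hs.2⟩
      exact (continuous_linPremium c ε).continuousAt.comp_continuousWithinAt h1
  have hconst := constant_of_has_deriv_right_zero (a := a) (b := b)
    (f := fun t => exp (-(ε * t)) * (v₀ + I t + c / ε))
    ((by fun_prop : Continuous fun t => exp (-(ε * t))).continuousOn.mul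
      ((continuousOn_const.add (hIc.mono (Icc_subset_Icc_left ha))).add continuousOn_const))
    (fun t ht => by
      refine (((hasDerivAt_exp_neg_mul ε t).hasDerivWithinAt).mul
        (((hId t ht).const_add v₀).add_const (c / ε))).congr_deriv ?_
      rw [hV t ht, linPremium]
      field_simp
      ring)
  intro t ht
  have h1 := hconst t ht
  have h2 := hV a ⟨le_rfl, hab⟩
  rw [premiumFlow, h2]
  have h3 : exp (ε * (t - a)) = exp (-(ε * a)) * exp (ε * t) := by
    rw [← exp_add]
    congr 1
    ring
  have h4 : exp (-(ε * t)) * exp (ε * t) = 1 := by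
    rw [← exp_add, neg_add_cancel, exp_zero]
  rw [h3, eq_sub_iff_add_eq]
  calc v₀ + I t + c / ε = exp (-(ε * t)) * exp (ε * t) * (v₀ + I t + c / ε) := by rw [h4, one_mul]
    _ = (exp (-(ε * t)) * (v₀ + I t + c / ε)) * exp (ε * t) := by ring
    _ = _ := by rw [h1]; ring

/-- A path of the surplus is negative somewhere exactly when it is negative at a claim time. -/
lemma ruinTime_lt_top_iff_exists_surplusChain_neg {c ε u : ℝ} (hc : 0 < c) (hε : 0 < ε)
    {τ X : ℕ → ℝ} {V : ℝ → ℝ} (hτ : ∀ n, 0 < τ n)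
    (hS : Tendsto (fun n => ∑ j ∈ Finset.range n, τ j) atTop atTop)
    (hV : ∀ t, 0 ≤ t → IntervalIntegrable (fun s => linPremium c ε (V s)) volume 0 t ∧
      V t = u + (∫ s in (0 : ℝ)..t, linPremium c ε (V s))
        - ∑ k ∈ Finset.range (claimCount τ t), X k) :
    ruinTime V < ⊤ ↔ ∃ n, surplusChain c ε u τ X n < 0 := by
  set S : ℕ → ℝ := fun n => ∑ j ∈ Finset.range n, τ j with hSdef
  have hS0 : S 0 = 0 := by simp [hSdef]
  have hSs : ∀ n, S (n + 1) = S n + τ n := fun n => Finset.sum_range_succ _ _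
  have hSlt : ∀ n, S n < S (n + 1) := fun n => by rw [hSs]; linarith [hτ n]
  have hSnn : ∀ n, 0 ≤ S n := fun n => Finset.sum_nonneg fun j _ => (hτ j).le
  have hcount : ∀ n t, t ∈ Ico (S n) (S (n + 1)) → claimCount τ t = n := fun n t ht =>
    claimCount_eq hτ ht.1 ht.2
  have hflow : ∀ n, ∀ t ∈ Icc (S n) (S (n + 1)),
      (u - ∑ k ∈ Finset.range n, X k) + (∫ s in (0 : ℝ)..t, linPremium c ε (V s))
        = premiumFlow c ε (V (S n)) (t - S n) := fun n =>
    eq_premiumFlow_of_integral_eq hε (hSnn n) (hSlt n) (hV _ (hSnn _)).1 fun t ht => by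
      rw [(hV t ((hSnn n).trans ht.1)).2, hcount n t ht]
      ring
  have hstep : ∀ n, V (S (n + 1)) = premiumFlow c ε (V (S n)) (τ n) - X n := by
    intro n
    have h1 := hflow n (S (n + 1)) ⟨(hSlt n).le, le_rfl⟩
    have h2 : S (n + 1) - S n = τ n := by rw [hSs]; ring
    rw [h2] at h1
    rw [(hV _ (hSnn (n + 1))).2, hcount (n + 1) _ ⟨le_rfl, hSlt _⟩, Finset.sum_range_succ, ← h1]
    ring
  have h0 : V (S 0) = u := by
    rw [(hV _ (hSnn 0)).2, hcount 0 _ ⟨le_rfl, hSlt _⟩, hS0]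
    simp
  rw [ruinTime_lt_top_iff, ← exists_neg_iff_exists_surplusChain_neg (R := fun n => V (S n)) h0 hstep]
  constructor
  · rintro ⟨t, ht, hneg⟩
    by_contra! h
    classical
    have hex : ∃ n, t < S (n + 1) :=
      ((tendsto_add_atTop_iff_nat 1).2 hS).eventually_gt_atTop t |>.exists
    obtain ⟨n, hn1, hn2⟩ : ∃ n, S n ≤ t ∧ t < S (n + 1) := by
      refine ⟨Nat.find hex, ?_, Nat.find_spec hex⟩
      rcases Nat.eq_zero_or_pos (Nat.find hex) with h1 | h1
      · rw [h1, hS0]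
        exact ht
      · have h2 := Nat.find_min hex (Nat.sub_lt h1 one_pos)
        have h3 : Nat.find hex - 1 + 1 = Nat.find hex := Nat.sub_add_cancel h1
        rw [h3] at h2
        exact not_lt.1 h2
    have h1 := hflow n t ⟨hn1, hn2.le⟩
    have h2 : V t = premiumFlow c ε (V (S n)) (t - S n) := by
      rw [← h1, (hV t ht).2, hcount n t ⟨hn1, hn2⟩]
      ring
    have h3 := le_premiumFlow hc hε (h n) (sub_nonneg.2 hn1)
    linarith [h n]
  · rintro ⟨n, hn⟩
    exact ⟨S n, hSnn n, hn⟩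

/-! ### The law of the surplus after the claims -/

/-- The transition operator of the surplus after the claims, frozen on the negative half-line. -/
noncomputable def ruinOp (c ε : ℝ) (νT νX : Measure ℝ) (f : ℝ → ℝ≥0∞) (z : ℝ) : ℝ≥0∞ :=
  if z < 0 then f z else ∫⁻ t, ∫⁻ x, f (premiumFlow c ε z t - x) ∂νX ∂νT

/-- The probability of ruin as a function of the initial surplus, as the limit of the probabilities
of ruin by the first `n` claims. It depends on the laws alone. -/
noncomputable def ruinFun (c ε : ℝ) (νT νX : Measure ℝ) (z : ℝ) : ℝ≥0∞ :=
  ⨆ n, (ruinOp c ε νT νX)^[n] ((Iio 0).indicator 1) z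

lemma ruinOp_mono (c ε : ℝ) (νT νX : Measure ℝ) : Monotone (ruinOp c ε νT νX) := by
  intro f g hfg z
  unfold ruinOp
  split_ifs
  · exact hfg z
  · exact lintegral_mono fun t => lintegral_mono fun x => hfg _

section RuinOp

variable {c ε : ℝ} {νT νX : Measure ℝ} [IsProbabilityMeasure νT] [IsProbabilityMeasure νX]

lemma measurable_ruinOp {f : ℝ → ℝ≥0∞} (hf : Measurable f) : Measurable (ruinOp c ε νT νX f) := by
  refine Measurable.ite measurableSet_Iio hf ?_
  refine Measurable.lintegral_prod_right' (f := fun q : ℝ × ℝ =>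
    ∫⁻ x, f (premiumFlow c ε q.1 q.2 - x) ∂νX) ?_
  refine Measurable.lintegral_prod_right' (f := fun q : (ℝ × ℝ) × ℝ =>
    f (premiumFlow c ε q.1.1 q.1.2 - q.2)) ?_
  have := measurable_premiumFlow c ε
  exact hf.comp ((this.comp measurable_fst).sub measurable_snd)

lemma measurable_iterate_ruinOp {f : ℝ → ℝ≥0∞} (hf : Measurable f) (n : ℕ) :
    Measurable ((ruinOp c ε νT νX)^[n] f) := by
  induction n with
  | zero => exact hf
  | succ n ih =>
    rw [Function.iterate_succ_apply']
    exact measurable_ruinOp ih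

end RuinOp

lemma surplusChain_congr {c ε u : ℝ} {τ X τ' X' : ℕ → ℝ} {n : ℕ}
    (hτ : ∀ i < n, τ i = τ' i) (hX : ∀ i < n, X i = X' i) :
    surplusChain c ε u τ X n = surplusChain c ε u τ' X' n := by
  induction n with
  | zero => rfl
  | succ n ih =>
    have h := ih (fun i hi => hτ i (hi.trans n.lt_succ_self)) fun i hi => hX i (hi.trans n.lt_succ_self)
    simp only [surplusChain, h, hτ n n.lt_succ_self, hX n n.lt_succ_self]

lemma measurable_surplusChain {α : Type*} [MeasurableSpace α] (c ε u : ℝ) {τ X : ℕ → α → ℝ}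
    (hτ : ∀ n, Measurable (τ n)) (hX : ∀ n, Measurable (X n)) (n : ℕ) :
    Measurable fun w => surplusChain c ε u (fun j => τ j w) (fun j => X j w) n := by
  induction n with
  | zero => exact measurable_const
  | succ n ih =>
    simp only [surplusChain]
    refine Measurable.ite (measurableSet_lt ih measurable_const) ih ?_
    exact ((measurable_premiumFlow c ε).comp (ih.prodMk (hτ n))).sub (hX n)

/-- The surplus after `n` claims is independent of the next interarrival time and claim. -/
lemma indepFun_surplusChain {Ω : Type*} [MeasurableSpace Ω] {P : Measure Ω} {c ε u : ℝ}
    {τ X : ℕ → Ω → ℝ} (hτ : ∀ n, Measurable (τ n)) (hX : ∀ n, Measurable (X n))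
    (hind : iIndepFun (Sum.elim τ X) P) (n : ℕ) :
    IndepFun (fun w => surplusChain c ε u (fun j => τ j w) (fun j => X j w) n)
      (fun w => (τ n w, X n w)) P := by
  classical
  set A : Finset (ℕ ⊕ ℕ) := (Finset.range n).disjSum (Finset.range n) with hA
  set B : Finset (ℕ ⊕ ℕ) := {Sum.inl n, Sum.inr n} with hB
  have hdisj : Disjoint A B := by
    rw [Finset.disjoint_left]
    rintro (i | i) hi hi' <;> simp_all
  have hmeas : ∀ i, Measurable (Sum.elim τ X i) := by
    rintro (i | i)
    · exact hτ i
    · exact hX i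
  have h1 := hind.indepFun_finset A B hdisj hmeas
  set τ' : ℕ → (A → ℝ) → ℝ := fun i v => if h : Sum.inl i ∈ A then v ⟨Sum.inl i, h⟩ else 0
  set X' : ℕ → (A → ℝ) → ℝ := fun i v => if h : Sum.inr i ∈ A then v ⟨Sum.inr i, h⟩ else 0
  have hτ' : ∀ i, Measurable (τ' i) := by
    intro i
    by_cases h : Sum.inl i ∈ A
    · simp only [τ', h, dite_true]
      exact measurable_pi_apply _
    · simp only [τ', h, dite_false]
      exact measurable_const
  have hX' : ∀ i, Measurable (X' i) := by
    intro i
    by_cases h : Sum.inr i ∈ A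
    · simp only [X', h, dite_true]
      exact measurable_pi_apply _
    · simp only [X', h, dite_false]
      exact measurable_const
  have hn : Sum.inl n ∈ B := by simp [hB]
  have hn' : Sum.inr n ∈ B := by simp [hB]
  have hψ : Measurable fun v : B → ℝ => (v ⟨Sum.inl n, hn⟩, v ⟨Sum.inr n, hn'⟩) :=
    (measurable_pi_apply _).prodMk (measurable_pi_apply _)
  have h2 := h1.comp (measurable_surplusChain c ε u hτ' hX' n) hψ
  refine h2.congr (Eventually.of_forall fun w => ?_) (Eventually.of_forall fun w => rfl)
  refine surplusChain_congr (fun i hi => ?_) fun i hi => ?_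
  · have : Sum.inl i ∈ A := by simpa [hA] using hi
    simp [τ', this]
  · have : Sum.inr i ∈ A := by simpa [hA] using hi
    simp [X', this]

section RiskModel

variable {Ω : Type*} [MeasurableSpace Ω] {P : Measure Ω} [IsProbabilityMeasure P]
  {c ε u : ℝ} {νT νX : Measure ℝ} {τ X : ℕ → Ω → ℝ}

/-- The surplus after the claims is a Markov chain, frozen below zero: `E f(Zₙ)` is the `n`-th iterate
of the transition operator applied to `f`. -/
lemma lintegral_surplusChain [IsProbabilityMeasure νT] [IsProbabilityMeasure νX]
    (hτ : ∀ n, Measurable (τ n)) (hX : ∀ n, Measurable (X n))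
    (hνT : ∀ n, P.map (τ n) = νT) (hνX : ∀ n, P.map (X n) = νX)
    (hind : iIndepFun (Sum.elim τ X) P) (n : ℕ) {f : ℝ → ℝ≥0∞} (hf : Measurable f) :
    ∫⁻ w, f (surplusChain c ε u (fun j => τ j w) (fun j => X j w) n) ∂P
      = (ruinOp c ε νT νX)^[n] f u := by
  induction n generalizing f with
  | zero => simp [surplusChain]
  | succ n ih =>
    rw [Function.iterate_succ_apply, ← ih (measurable_ruinOp hf)]
    set Z : Ω → ℝ := fun w => surplusChain c ε u (fun j => τ j w) (fun j => X j w) n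
    have hZ : Measurable Z := measurable_surplusChain c ε u hτ hX n
    have hpair : P.map (fun w => (τ n w, X n w)) = νT.prod νX := by
      have h1 : IndepFun (τ n) (X n) P :=
        hind.indepFun (i := Sum.inl n) (j := Sum.inr n) (by simp)
      rw [h1.map_prod_eq_prod_map_map (hτ n).aemeasurable (hX n).aemeasurable, hνT, hνX]
    have hlaw : P.map (fun w => (Z w, (τ n w, X n w))) = (P.map Z).prod (νT.prod νX) := by
      rw [(indepFun_surplusChain hτ hX hind n).map_prod_eq_prod_map_map hZ.aemeasurable
        ((hτ n).prodMk (hX n)).aemeasurable, hpair]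
    set F : ℝ × (ℝ × ℝ) → ℝ≥0∞ := fun q =>
      if q.1 < 0 then f q.1 else f (premiumFlow c ε q.1 q.2.1 - q.2.2)
    have hF : Measurable F := by
      refine Measurable.ite (measurableSet_lt measurable_fst measurable_const)
        (hf.comp measurable_fst) (hf.comp ?_)
      exact ((measurable_premiumFlow c ε).comp
        (measurable_fst.prodMk (measurable_fst.comp measurable_snd))).sub
        (measurable_snd.comp measurable_snd)
    have e1 : ∀ w, f (surplusChain c ε u (fun j => τ j w) (fun j => X j w) (n + 1))
        = F (Z w, (τ n w, X n w)) := by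
      intro w
      simp only [surplusChain, F, Z]
      split_ifs <;> rfl
    simp only [e1]
    have : IsProbabilityMeasure (P.map Z) := Measure.isProbabilityMeasure_map hZ.aemeasurable
    rw [← lintegral_map hF (hZ.prodMk ((hτ n).prodMk (hX n))), hlaw, lintegral_prod _ hF.aemeasurable,
      lintegral_map (measurable_ruinOp hf) hZ |>.symm]
    refine lintegral_congr fun z => ?_
    simp only [F, ruinOp]
    split_ifs with hz
    · simp
    · refine lintegral_prod (μ := νT) (ν := νX)
        (fun q : ℝ × ℝ => f (premiumFlow c ε z q.1 - q.2)) (Measurable.aemeasurable (hf.comp ?_))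
      exact ((measurable_premiumFlow c ε).comp (measurable_const.prodMk measurable_fst)).sub
        measurable_snd

/-- By the strong law of large numbers for `min(τ, 1)`, the claim times tend to infinity. -/
lemma ae_tendsto_sum_atTop (hτ : ∀ n, Measurable (τ n)) (hνT : ∀ n, P.map (τ n) = νT)
    (hind : iIndepFun (Sum.elim τ X) P) (hpos : ∀ᵐ t ∂νT, 0 < t) :
    ∀ᵐ w ∂P, (∀ n, 0 < τ n w) ∧ Tendsto (fun n => ∑ j ∈ Finset.range n, τ j w) atTop atTop := by
  have h0 : ∀ᵐ w ∂P, ∀ n, 0 < τ n w := by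
    rw [ae_all_iff]
    intro n
    refine ae_of_ae_map (hτ n).aemeasurable (p := fun t => 0 < t) ?_
    rwa [hνT]
  have hm : Measurable fun t : ℝ => min t 1 := by fun_prop
  have hbd : ∀ᵐ w ∂P, ‖min (τ 0 w) 1‖ ≤ 1 := by
    filter_upwards [h0] with w hw
    rw [Real.norm_of_nonneg (le_min (hw 0).le zero_le_one)]
    exact min_le_right _ _
  have hint : Integrable (fun w => min (τ 0 w) 1) P :=
    Integrable.of_bound (hm.comp (hτ 0)).aestronglyMeasurable 1 hbd
  have hslln := strong_law_ae_real (fun n w => min (τ n w) 1) hint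
    (fun i j hij => (hind.indepFun (i := Sum.inl i) (j := Sum.inl j) (by simpa using hij)).comp hm hm)
    (fun i => (IdentDistrib.mk (hτ i).aemeasurable (hτ 0).aemeasurable
      ((hνT i).trans (hνT 0).symm)).comp hm)
  have hmean : 0 < ∫ w, min (τ 0 w) 1 ∂P := by
    rw [integral_pos_iff_support_of_nonneg_ae
      (h0.mono fun w hw => le_min (hw 0).le zero_le_one) hint]
    have : P (Function.support fun w => min (τ 0 w) 1) = 1 := by
      rw [prob_compl_eq_zero_iff₀ ?_ |>.symm]
      · refine measure_mono_null ?_ (ae_iff.1 h0)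
        intro w hw
        simp only [mem_compl_iff, Function.mem_support, not_not] at hw
        simp only [mem_ofPred_eq]
        intro h
        exact (lt_min (h 0) zero_lt_one).ne' hw
      · exact (measurableSet_support (hm.comp (hτ 0))).nullMeasurableSet
    rw [this]
    exact one_pos
  filter_upwards [h0, hslln] with w hw hlim
  refine ⟨hw, ?_⟩
  have h1 : Tendsto (fun n : ℕ => (∑ i ∈ Finset.range n, min (τ i w) 1) / n * n) atTop atTop :=
    hlim.pos_mul_atTop hmean tendsto_natCast_atTop_atTop
  refine tendsto_atTop_mono' _ ?_ h1
  filter_upwards [eventually_gt_atTop 0] with n hn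
  rw [div_mul_cancel₀ _ (by positivity)]
  exact Finset.sum_le_sum fun i _ => min_le_left _ _

/-- The ruin probability of a risk model is given by the laws alone. -/
lemma ruinProb_eq_ruinFun [IsProbabilityMeasure νT] [IsProbabilityMeasure νX] (hc : 0 < c)
    (hε : 0 < ε) (hpos : ∀ᵐ t ∂νT, 0 < t) {U : ℝ → ℝ → Ω → ℝ}
    (h : IsRiskModel P (linPremium c ε) νT νX τ X U) (hu : 0 ≤ u) :
    ruinProb P U u = (ruinFun c ε νT νX u).toReal := by
  set Z : ℕ → Ω → ℝ := fun n w => surplusChain c ε u (fun j => τ j w) (fun j => X j w) n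
  have hZ : ∀ n, Measurable (Z n) :=
    measurable_surplusChain c ε u h.measurable_interarrival h.measurable_claim
  have hae : {w | ruinTime (fun t => U u t w) < ⊤} =ᵐ[P] ⋃ n, {w | Z n w < 0} := by
    filter_upwards [h.surplus_eq u hu, ae_tendsto_sum_atTop h.measurable_interarrival
      h.law_interarrival h.indep hpos] with w hw hw'
    refine propext (Iff.trans
      (ruinTime_lt_top_iff_exists_surplusChain_neg hc hε hw'.1 hw'.2 hw) ?_)
    show _ ↔ w ∈ ⋃ n, {w | Z n w < 0}
    rw [mem_iUnion]
    rfl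
  have hmono : Monotone fun n => {w | Z n w < 0} :=
    monotone_nat_of_le_succ fun n w hw => surplusChain_succ_neg hw
  rw [ruinProb, measureReal_def, measure_congr hae, hmono.measure_iUnion, ruinFun]
  congr 2
  funext n
  rw [← lintegral_surplusChain h.measurable_interarrival h.measurable_claim h.law_interarrival
    h.law_claim h.indep n (measurable_one.indicator measurableSet_Iio)]
  rw [← lintegral_indicator_one (measurableSet_lt (hZ n) measurable_const)]
  rfl

end RiskModel

/-! ### The renewal equation of the ruin probability -/

section RuinFun

variable {c ε : ℝ} {νT νX : Measure ℝ}

lemma monotone_iterate_ruinOp (c ε : ℝ) (νT νX : Measure ℝ) :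
    Monotone fun n => (ruinOp c ε νT νX)^[n] ((Iio 0).indicator 1) := by
  refine (ruinOp_mono c ε νT νX).monotone_iterate_of_le_map fun z => ?_
  unfold ruinOp
  split_ifs with hz
  · exact le_rfl
  · rw [indicator_of_notMem (by simpa using hz)]
    exact zero_le

/-- The ruin probability lies below every supersolution of the renewal equation. -/
lemma ruinFun_le_of_ruinOp_le {w : ℝ → ℝ≥0∞} (h0 : ∀ z < 0, 1 ≤ w z)
    (h : ruinOp c ε νT νX w ≤ w) : ruinFun c ε νT νX ≤ w := by
  intro z
  refine iSup_le fun n => ?_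
  have : (ruinOp c ε νT νX)^[n] ((Iio 0).indicator 1) ≤ w := by
    induction n with
    | zero => exact fun z => indicator_apply_le (h0 z)
    | succ n ih =>
      rw [Function.iterate_succ_apply']
      exact (ruinOp_mono c ε νT νX ih).trans h
  exact this z

lemma ruinFun_of_neg {z : ℝ} (hz : z < 0) : ruinFun c ε νT νX z = 1 := by
  have : ∀ n, (ruinOp c ε νT νX)^[n] ((Iio 0).indicator 1) z = 1 := by
    intro n
    induction n with
    | zero => exact indicator_of_mem hz 1
    | succ n ih => rw [Function.iterate_succ_apply', ruinOp, if_pos hz, ih]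
  simp only [ruinFun, this, ciSup_const]

lemma ruinFun_le_one [IsProbabilityMeasure νT] [IsProbabilityMeasure νX] (z : ℝ) :
    ruinFun c ε νT νX z ≤ 1 := by
  refine ruinFun_le_of_ruinOp_le (w := 1) (fun z _ => le_rfl) (fun z => ?_) z
  unfold ruinOp
  split_ifs <;> simp

lemma measurable_ruinFun [IsProbabilityMeasure νT] [IsProbabilityMeasure νX] :
    Measurable (ruinFun c ε νT νX) :=
  Measurable.iSup fun n => measurable_iterate_ruinOp (measurable_one.indicator measurableSet_Iio) n

/-- The renewal equation: the increasing limit of the iterates is a fixed point of the transition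
operator, by monotone convergence. -/
lemma ruinOp_ruinFun [IsProbabilityMeasure νT] [IsProbabilityMeasure νX] {z : ℝ} (hz : 0 ≤ z) :
    ruinFun c ε νT νX z = ∫⁻ t, ∫⁻ x, ruinFun c ε νT νX (premiumFlow c ε z t - x) ∂νX ∂νT := by
  set f : ℕ → ℝ → ℝ≥0∞ := fun n => (ruinOp c ε νT νX)^[n] ((Iio 0).indicator 1) with hf
  have hm : ∀ n, Measurable (f n) := fun n =>
    measurable_iterate_ruinOp (measurable_one.indicator measurableSet_Iio) n
  have hmono : Monotone f := monotone_iterate_ruinOp c ε νT νX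
  have hflow : Measurable (premiumFlow c ε z) :=
    (measurable_premiumFlow c ε).comp (measurable_const.prodMk measurable_id)
  have h1 : ruinFun c ε νT νX z = ⨆ n, f (n + 1) z :=
    ((hmono.apply₂ z).iSup_nat_add 1).symm
  have h2 : ∀ t, ∫⁻ x, ruinFun c ε νT νX (premiumFlow c ε z t - x) ∂νX
      = ⨆ n, ∫⁻ x, f n (premiumFlow c ε z t - x) ∂νX := fun t =>
    lintegral_iSup (fun n => (hm n).comp (measurable_const.sub measurable_id))
      fun m n hmn x => hmono hmn _
  simp only [h1, h2]
  rw [lintegral_iSup]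
  · refine iSup_congr fun n => ?_
    simp only [hf, Function.iterate_succ_apply']
    rw [ruinOp, if_neg (not_lt.2 hz)]
  · intro n
    refine Measurable.lintegral_prod_right' (f := fun q : ℝ × ℝ => f n (premiumFlow c ε z q.1 - q.2)) ?_
    exact (hm n).comp ((hflow.comp measurable_fst).sub measurable_snd)
  · exact fun m n hmn t => lintegral_mono fun x => hmono hmn _

/-- The renewal equation for the real-valued ruin probability, with Bochner integrals. -/
lemma toReal_ruinFun_eq [IsProbabilityMeasure νT] [IsProbabilityMeasure νX] {z : ℝ} (hz : 0 ≤ z) :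
    (ruinFun c ε νT νX z).toReal
      = ∫ t, ∫ x, (ruinFun c ε νT νX (premiumFlow c ε z t - x)).toReal ∂νX ∂νT := by
  have hlt : ∀ y, ruinFun c ε νT νX y < ⊤ := fun y => (ruinFun_le_one y).trans_lt ENNReal.one_lt_top
  have hm := measurable_ruinFun (c := c) (ε := ε) (νT := νT) (νX := νX)
  have hflow : Measurable (premiumFlow c ε z) :=
    (measurable_premiumFlow c ε).comp (measurable_const.prodMk measurable_id)
  have h1 : ∀ t, ∫ x, (ruinFun c ε νT νX (premiumFlow c ε z t - x)).toReal ∂νX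
      = (∫⁻ x, ruinFun c ε νT νX (premiumFlow c ε z t - x) ∂νX).toReal := fun t =>
    integral_toReal (hm.comp (measurable_const.sub measurable_id)).aemeasurable
      (Eventually.of_forall fun x => hlt _)
  simp only [h1]
  rw [integral_toReal, ← ruinOp_ruinFun hz]
  · refine (Measurable.lintegral_prod_right'
      (f := fun q : ℝ × ℝ => ruinFun c ε νT νX (premiumFlow c ε z q.1 - q.2)) ?_).aemeasurable
    exact hm.comp ((hflow.comp measurable_fst).sub measurable_snd)
  · refine Eventually.of_forall fun t => lt_of_le_of_lt ?_ ENNReal.one_lt_top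
    calc _ ≤ ∫⁻ _, 1 ∂νX := lintegral_mono fun x => ruinFun_le_one _
      _ = 1 := by simp

/-- If the claims have an exponential moment, the ruin probability decays exponentially: for large
`u⋆` the function `min(1, exp(-δ(z - u⋆)))` is a supersolution of the renewal equation, because the
premium rate above `u⋆` is at least `c + εu⋆`. -/
lemma tendsto_ruinFun [IsProbabilityMeasure νT] [IsProbabilityMeasure νX] (hc : 0 < c)
    (hε : 0 < ε) (hpos : ∀ᵐ t ∂νT, 0 < t) {δ : ℝ} (hδ : 0 < δ)
    (hX : ∫⁻ x, ENNReal.ofReal (exp (δ * x)) ∂νX ≠ ⊤) :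
    Tendsto (fun u => (ruinFun c ε νT νX u).toReal) atTop (𝓝 0) := by
  have hlap : Tendsto (fun κ : ℝ => ∫⁻ t, ENNReal.ofReal (exp (-(κ * t))) ∂νT) atTop (𝓝 0) := by
    rw [← lintegral_zero (μ := νT)]
    refine tendsto_lintegral_filter_of_dominated_convergence (fun _ => 1)
      (Eventually.of_forall fun κ => by fun_prop) ?_ (by simp) ?_
    · filter_upwards [eventually_ge_atTop 0] with κ hκ
      filter_upwards [hpos] with t ht
      rw [ENNReal.ofReal_le_one, exp_le_one_iff]
      nlinarith
    · filter_upwards [hpos] with t ht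
      rw [← ENNReal.ofReal_zero]
      refine ENNReal.tendsto_ofReal (tendsto_exp_atBot.comp (tendsto_neg_atTop_atBot.comp ?_))
      exact tendsto_id.atTop_mul_const ht
  have hprod : Tendsto (fun u : ℝ => (∫⁻ x, ENNReal.ofReal (exp (δ * x)) ∂νX) *
      ∫⁻ t, ENNReal.ofReal (exp (-(δ * linPremium c ε u * t))) ∂νT) atTop (𝓝 0) := by
    have := ENNReal.Tendsto.const_mul (hlap.comp
      ((tendsto_linPremium_atTop (c := c) hε).const_mul_atTop hδ)) (Or.inr hX)
    rwa [mul_zero] at this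
  obtain ⟨v, hv, hv0⟩ := ((hprod.eventually_lt_const one_pos).and (eventually_ge_atTop 0)).exists
  set w : ℝ → ℝ≥0∞ := fun z => min 1 (ENNReal.ofReal (exp (-(δ * (z - v))))) with hw
  have hw1 : ∀ z ≤ v, w z = 1 := by
    intro z hz
    refine min_eq_left ?_
    rw [← ENNReal.ofReal_one]
    exact ENNReal.ofReal_le_ofReal (one_le_exp (by nlinarith))
  have hsup : ruinOp c ε νT νX w ≤ w := by
    intro z
    unfold ruinOp
    split_ifs with hz
    · exact le_rfl
    rcases le_or_gt z v with hzv | hzv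
    · rw [hw1 z hzv]
      calc _ ≤ ∫⁻ _, ∫⁻ _, 1 ∂νX ∂νT :=
            lintegral_mono fun t => lintegral_mono fun x => min_le_left _ _
        _ = 1 := by simp
    · refine le_min ?_ ?_
      · calc _ ≤ ∫⁻ _, ∫⁻ _, 1 ∂νX ∂νT :=
            lintegral_mono fun t => lintegral_mono fun x => min_le_left _ _
          _ = 1 := by simp
      have hz0 : 0 ≤ z := hv0.trans hzv.le
      have hflow : ∀ t, 0 < t → z + linPremium c ε v * t ≤ premiumFlow c ε z t := by
        intro t ht
        have h1 : ε * t + 1 ≤ exp (ε * t) := add_one_le_exp _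
        have h2 : 0 < z + c / ε := by positivity
        have h3 : (z + c / ε) * (ε * t + 1) ≤ (z + c / ε) * exp (ε * t) := by gcongr
        have h4 : (z + c / ε) * (ε * t + 1) = z + c / ε + (c + ε * z) * t := by
          field_simp
          ring
        have h5 : (c + ε * v) * t ≤ (c + ε * z) * t := by gcongr
        rw [premiumFlow, linPremium]
        linarith
      have hpt : ∀ᵐ t ∂νT, (∫⁻ x, w (premiumFlow c ε z t - x) ∂νX)
          ≤ ENNReal.ofReal (exp (-(δ * (z - v)))) * (∫⁻ x, ENNReal.ofReal (exp (δ * x)) ∂νX)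
            * ENNReal.ofReal (exp (-(δ * linPremium c ε v * t))) := by
        filter_upwards [hpos] with t ht
        rw [← lintegral_const_mul _ (by fun_prop), ← lintegral_mul_const _ (by fun_prop)]
        refine lintegral_mono fun x => (min_le_right _ _).trans ?_
        rw [← ENNReal.ofReal_mul (exp_nonneg _), ← ENNReal.ofReal_mul (by positivity), ← exp_add,
          ← exp_add]
        refine ENNReal.ofReal_le_ofReal (exp_le_exp.2 ?_)
        nlinarith [mul_le_mul_of_nonneg_left (hflow t ht) hδ.le]
      calc _ ≤ _ := lintegral_mono_ae hpt
        _ = ENNReal.ofReal (exp (-(δ * (z - v)))) * ((∫⁻ x, ENNReal.ofReal (exp (δ * x)) ∂νX) *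
            ∫⁻ t, ENNReal.ofReal (exp (-(δ * linPremium c ε v * t))) ∂νT) := by
          rw [lintegral_const_mul _ (by fun_prop), mul_assoc]
        _ ≤ ENNReal.ofReal (exp (-(δ * (z - v)))) * 1 := by gcongr
        _ = _ := mul_one _
  have hle := ruinFun_le_of_ruinOp_le (fun z hz => (hw1 z (hz.le.trans hv0)).ge) hsup
  refine squeeze_zero (fun u => ENNReal.toReal_nonneg)
    (g := fun u => exp (-(δ * (u - v)))) (fun u => ?_) ?_
  · exact ENNReal.toReal_le_of_le_ofReal (exp_nonneg _) ((hle u).trans (min_le_right _ _))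
  · refine tendsto_exp_atBot.comp (tendsto_neg_atTop_atBot.comp ?_)
    exact (tendsto_atTop_add_const_right atTop (-v) tendsto_id).const_mul_atTop hδ

end RuinFun

/-! ### Gamma laws -/

lemma measurable_gammaPDF (a r : ℝ) : Measurable (gammaPDF a r) :=
  (measurable_gammaPDFReal a r).ennreal_ofReal

lemma ae_gammaMeasure_pos (a r : ℝ) : ∀ᵐ t ∂gammaMeasure a r, 0 < t := by
  rw [gammaMeasure, ae_withDensity_iff (measurable_gammaPDF a r)]
  have : ∀ᵐ t : ℝ, t ≠ 0 := by simp [ae_iff]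
  filter_upwards [this] with t ht h
  by_contra! hle
  exact h (gammaPDF_of_neg (lt_of_le_of_ne hle ht))

/-- Tilting by `e^{rx/2}` turns the density of rate `r` into `2^a` times the density of rate `r / 2`. -/
lemma lintegral_exp_half_mul_gammaMeasure {a r : ℝ} (ha : 0 < a) (hr : 0 < r) :
    ∫⁻ x, ENNReal.ofReal (exp (r / 2 * x)) ∂gammaMeasure a r ≠ ⊤ := by
  have h : ∀ x, gammaPDF a r x * ENNReal.ofReal (exp (r / 2 * x))
      = ENNReal.ofReal (2 ^ a) * gammaPDF a (r / 2) x := by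
    intro x
    rcases lt_or_ge x 0 with hx | hx
    · rw [gammaPDF_of_neg hx, gammaPDF_of_neg hx, zero_mul, mul_zero]
    · rw [gammaPDF_of_nonneg hx, gammaPDF_of_nonneg hx, ← ENNReal.ofReal_mul' (exp_nonneg _),
        ← ENNReal.ofReal_mul (by positivity), div_rpow hr.le zero_le_two]
      have h1 : exp (-(r * x)) * exp (r / 2 * x) = exp (-(r / 2 * x)) := by
        rw [← exp_add]
        congr 1
        ring
      congr 1
      rw [mul_assoc, h1]
      field_simp
  rw [gammaMeasure, lintegral_withDensity_eq_lintegral_mul _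
    (measurable_gammaPDF a r) (by fun_prop)]
  simp only [Pi.mul_apply, h]
  rw [lintegral_const_mul _ (measurable_gammaPDF a _),
    lintegral_gammaPDF_eq_one ha (by positivity), mul_one]
  exact ENNReal.ofReal_ne_top

lemma integral_gammaMeasure {a r : ℝ} (ha : 0 < a) (hr : 0 < r) (f : ℝ → ℝ) :
    ∫ x, f x ∂gammaMeasure a r
      = ∫ x in Ioi 0, r ^ a / Gamma a * x ^ (a - 1) * exp (-(r * x)) * f x := by
  rw [gammaMeasure, integral_withDensity_eq_integral_toReal_smul
    (measurable_gammaPDF a r) (Eventually.of_forall fun x => ENNReal.ofReal_lt_top),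
    ← integral_Ici_eq_integral_Ioi, ← integral_indicator measurableSet_Ici]
  congr 1
  funext x
  rw [gammaPDF, ENNReal.toReal_ofReal (gammaPDFReal_nonneg ha hr x), gammaPDFReal, indicator_apply]
  simp only [mem_Ici]
  split_ifs <;> simp

lemma integral_expMeasure {r : ℝ} (hr : 0 < r) (f : ℝ → ℝ) :
    ∫ x, f x ∂expMeasure r = ∫ x in Ioi 0, r * exp (-(r * x)) * f x := by
  rw [expMeasure, integral_gammaMeasure one_pos hr]
  refine setIntegral_congr_fun measurableSet_Ioi fun x _ => ?_
  simp

lemma integral_gammaMeasure_two {r : ℝ} (hr : 0 < r) (f : ℝ → ℝ) :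
    ∫ x, f x ∂gammaMeasure 2 r = ∫ x in Ioi 0, r ^ 2 * x * exp (-(r * x)) * f x := by
  rw [integral_gammaMeasure two_pos hr]
  refine setIntegral_congr_fun measurableSet_Ioi fun x _ => ?_
  have : (2 : ℝ) - 1 = 1 := by norm_num
  simp [this]

/-! ### Convolution with the claim law and substitution along the flow -/

/-- Splitting a convolution against a function equal to `1` on the negative half-line. -/
lemma integral_Ioi_mul_comp_sub {k ψ : ℝ → ℝ} (hki : IntegrableOn k (Ioi 0))
    (hψm : Measurable ψ) (hψb : ∀ y, |ψ y| ≤ 1) (hψ1 : ∀ y < 0, ψ y = 1) {v : ℝ} (hv : 0 ≤ v) :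
    ∫ x in Ioi 0, k x * ψ (v - x) = (∫ y in (0 : ℝ)..v, k (v - y) * ψ y) + ∫ x in Ioi v, k x := by
  have hint : IntegrableOn (fun x => k x * ψ (v - x)) (Ioi 0) :=
    Integrable.mul_bdd (c := 1) hki (hψm.comp (measurable_const.sub measurable_id)).aestronglyMeasurable
      (Eventually.of_forall fun x => hψb _)
  rw [← intervalIntegral.integral_interval_add_Ioi hint (hint.mono_set (Ioi_subset_Ioi hv))]
  congr 1
  · have := intervalIntegral.integral_comp_sub_left (a := 0) (b := v) (fun y => k (v - y) * ψ y) v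
    simpa using this
  · refine setIntegral_congr_fun measurableSet_Ioi fun x hx => ?_
    have : v - x < 0 := sub_neg.2 hx
    simp [hψ1 _ this]

lemma intervalIntegrable_mul_of_abs_le_one {k ψ : ℝ → ℝ} (hk : Continuous k) (hψm : Measurable ψ)
    (hψb : ∀ y, |ψ y| ≤ 1) (a b : ℝ) : IntervalIntegrable (fun y => k y * ψ y) volume a b := by
  have h := hk.intervalIntegrable (μ := volume) a b
  exact ⟨Integrable.mul_bdd (c := 1) h.1 hψm.aestronglyMeasurable (Eventually.of_forall hψb),
    Integrable.mul_bdd (c := 1) h.2 hψm.aestronglyMeasurable (Eventually.of_forall hψb)⟩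

lemma integral_Ioi_mul_exp_neg {r : ℝ} (hr : 0 < r) (v : ℝ) :
    ∫ x in Ioi v, r * exp (-(r * x)) = exp (-(r * v)) := by
  have h := integral_Ioi_of_hasDerivAt_of_nonneg' (g := fun x => -exp (-(r * x)))
    (g' := fun x => r * exp (-(r * x))) (a := v) (l := -0)
    (fun x _ => ((hasDerivAt_exp_neg_mul r x).neg).congr_deriv (by ring)) (fun x _ => by positivity)
    (tendsto_exp_atBot.comp (tendsto_neg_atTop_atBot.comp (tendsto_id.const_mul_atTop hr))).neg
  rw [h]
  ring

lemma integrableOn_mul_exp_neg {r : ℝ} (hr : 0 < r) :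
    IntegrableOn (fun x => r * exp (-(r * x))) (Ioi 0) :=
  (integrableOn_exp_neg_mul_Ioi hr 0).const_mul r

lemma hasDerivAt_erlang_tail (r x : ℝ) : HasDerivAt (fun x => -((1 + r * x) * exp (-(r * x))))
    (r ^ 2 * x * exp (-(r * x))) x := by
  have h : HasDerivAt (fun x => 1 + r * x) r x := by
    simpa using ((hasDerivAt_id x).const_mul r).const_add 1
  refine ((h.mul (hasDerivAt_exp_neg_mul r x)).neg).congr_deriv ?_
  ring

lemma tendsto_erlang_tail {r : ℝ} (hr : 0 < r) :
    Tendsto (fun x => -((1 + r * x) * exp (-(r * x)))) atTop (𝓝 0) := by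
  have h1 : Tendsto (fun y : ℝ => y ^ 1 * exp (-y)) atTop (𝓝 0) :=
    tendsto_pow_mul_exp_neg_atTop_nhds_zero 1
  have h0 : Tendsto (fun y : ℝ => y ^ 0 * exp (-y)) atTop (𝓝 0) :=
    tendsto_pow_mul_exp_neg_atTop_nhds_zero 0
  have := ((h0.add h1).neg).comp (tendsto_id.const_mul_atTop hr)
  simp only [add_zero, neg_zero] at this
  refine this.congr fun x => ?_
  simp only [Function.comp, id]
  ring

lemma integral_Ioi_erlang {r v : ℝ} (hr : 0 < r) (hv : 0 ≤ v) :
    ∫ x in Ioi v, r ^ 2 * x * exp (-(r * x)) = (1 + r * v) * exp (-(r * v)) := by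
  rw [integral_Ioi_of_hasDerivAt_of_nonneg' (fun x _ => hasDerivAt_erlang_tail r x)
    (fun x hx => ?_) (tendsto_erlang_tail hr)]
  · ring
  · have : 0 < x := hv.trans_lt hx
    positivity

lemma integrableOn_erlang {r : ℝ} (hr : 0 < r) :
    IntegrableOn (fun x => r ^ 2 * x * exp (-(r * x))) (Ioi 0) :=
  integrableOn_Ioi_deriv_of_nonneg' (fun x _ => hasDerivAt_erlang_tail r x)
    (fun x hx => by have : 0 < x := hx; positivity) (tendsto_erlang_tail hr)

lemma hasDerivWithinAt_primitive_Ici {f : ℝ → ℝ} (hi : ∀ v, IntervalIntegrable f volume 0 v)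
    (hc : ContinuousOn f (Ici 0)) {v : ℝ} (hv : 0 ≤ v) :
    HasDerivWithinAt (fun v => ∫ y in (0 : ℝ)..v, f y) (f v) (Ici 0) v := by
  rcases hv.eq_or_lt with rfl | hv
  · exact intervalIntegral.integral_hasDerivWithinAt_right (hi 0) (t := Ioi 0)
      ⟨Ioc 0 1, Ioc_mem_nhdsGT one_pos, by simpa using (hi 1).1.aestronglyMeasurable⟩
      ((hc 0 self_mem_Ici).mono Ioi_subset_Ici_self)
  · have hnb : Ioi (0 : ℝ) ∈ 𝓝 v := Ioi_mem_nhds hv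
    refine (intervalIntegral.integral_hasDerivAt_right (hi v) ⟨Ioo 0 (v + 1), ?_, ?_⟩
      ((hc v hv.le).continuousAt (Ici_mem_nhds hv))).hasDerivWithinAt
    · exact Ioo_mem_nhds hv (by linarith)
    · exact ((hi (v + 1)).1.mono_set Ioo_subset_Ioc_self).aestronglyMeasurable

lemma hasDerivAt_premiumFlow {c ε : ℝ} (hε : ε ≠ 0) (u t : ℝ) :
    HasDerivAt (premiumFlow c ε u) (linPremium c ε (premiumFlow c ε u t)) t := by
  have h : HasDerivAt (fun t => exp (ε * t)) (exp (ε * t) * ε) t := by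
    simpa using ((hasDerivAt_id t).const_mul ε).exp
  refine ((h.const_mul (u + c / ε)).sub_const (c / ε)).congr_deriv ?_
  rw [linPremium, premiumFlow]
  field_simp
  ring

lemma linPremium_premiumFlow {c ε : ℝ} (hε : ε ≠ 0) (u t : ℝ) :
    linPremium c ε (premiumFlow c ε u t) = linPremium c ε u * exp (ε * t) := by
  rw [linPremium, linPremium, premiumFlow]
  field_simp
  ring

lemma strictMono_premiumFlow {c ε u : ℝ} (hc : 0 < c) (hε : 0 < ε) (hu : 0 ≤ u) :
    StrictMono (premiumFlow c ε u) := by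
  intro s t hst
  have : 0 < u + c / ε := by positivity
  unfold premiumFlow
  gcongr

lemma premiumFlow_image_Ioi {c ε u : ℝ} (hc : 0 < c) (hε : 0 < ε) (hu : 0 ≤ u) :
    premiumFlow c ε u '' Ioi 0 = Ioi u := by
  have h0 : premiumFlow c ε u 0 = u := by simp [premiumFlow]
  have hpos : 0 < u + c / ε := by positivity
  ext v
  constructor
  · rintro ⟨t, ht, rfl⟩
    have := strictMono_premiumFlow hc hε hu ht
    rwa [h0] at this
  · intro hv
    have hv' : 0 < v + c / ε := by
      have : u < v := hv
      linarith
    have h1 : premiumFlow c ε u (log ((v + c / ε) / (u + c / ε)) / ε) = v := by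
      rw [premiumFlow, mul_div_cancel₀ _ hε.ne', exp_log (by positivity)]
      field_simp
      ring
    refine ⟨_, ?_, h1⟩
    rw [mem_Ioi, ← (strictMono_premiumFlow hc hε hu).lt_iff_lt, h0, h1]
    exact hv

/-- The substitution `v = premiumFlow c ε u t`. -/
lemma integral_Ioi_eq_integral_premiumFlow {c ε u : ℝ} (hc : 0 < c) (hε : 0 < ε) (hu : 0 ≤ u)
    (g : ℝ → ℝ) : ∫ v in Ioi u, g v
      = ∫ t in Ioi 0, linPremium c ε (premiumFlow c ε u t) * g (premiumFlow c ε u t) := by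
  rw [← premiumFlow_image_Ioi hc hε hu, integral_image_eq_integral_abs_deriv_smul measurableSet_Ioi
    (fun t _ => (hasDerivAt_premiumFlow hε.ne' u t).hasDerivWithinAt)
    (strictMono_premiumFlow hc hε hu).injective.injOn]
  refine setIntegral_congr_fun measurableSet_Ioi fun t ht => ?_
  have := linPremium_pos hc hε (hu.trans (le_premiumFlow hc hε hu (le_of_lt ht)))
  simp only [abs_of_pos this, smul_eq_mul]

lemma integrableOn_Ioi_iff_premiumFlow {c ε u : ℝ} (hc : 0 < c) (hε : 0 < ε) (hu : 0 ≤ u)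
    (g : ℝ → ℝ) : IntegrableOn g (Ioi u) ↔ IntegrableOn
      (fun t => linPremium c ε (premiumFlow c ε u t) * g (premiumFlow c ε u t)) (Ioi 0) := by
  rw [← premiumFlow_image_Ioi hc hε hu, integrableOn_image_iff_integrableOn_abs_deriv_smul
    measurableSet_Ioi (fun t _ => (hasDerivAt_premiumFlow hε.ne' u t).hasDerivWithinAt)
    (strictMono_premiumFlow hc hε hu).injective.injOn]
  refine integrableOn_congr_fun (fun t ht => ?_) measurableSet_Ioi
  have := linPremium_pos hc hε (hu.trans (le_premiumFlow hc hε hu (le_of_lt ht)))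
  simp only [abs_of_pos this, smul_eq_mul]

section Renewal

variable {lam c ε : ℝ} {G : ℝ → ℝ}

lemma integrableOn_mul_comp_premiumFlow (hc : 0 < c) (hε : 0 < ε) (hG : ContinuousOn G (Ici 0))
    (hGb : ∀ v, 0 ≤ v → |G v| ≤ 1) {k : ℝ → ℝ} (hk : IntegrableOn k (Ioi 0)) {u : ℝ} (hu : 0 ≤ u) :
    IntegrableOn (fun t => k t * G (premiumFlow c ε u t)) (Ioi 0) := by
  have hmem : ∀ t ∈ Ioi (0 : ℝ), 0 ≤ premiumFlow c ε u t := fun t ht =>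
    hu.trans (le_premiumFlow hc hε hu (le_of_lt ht))
  refine Integrable.mul_bdd (c := 1) hk (ContinuousOn.aestronglyMeasurable ?_ measurableSet_Ioi)
    ((ae_restrict_iff' measurableSet_Ioi).2 (Eventually.of_forall fun t ht => hGb _ (hmem t ht)))
  exact hG.comp (fun t _ => (hasDerivAt_premiumFlow hε.ne' u t).continuousAt.continuousWithinAt) hmem

lemma linPremium_rpow_mul_premiumFlow (hc : 0 < c) (hε : 0 < ε) {u : ℝ} (hu : 0 ≤ u) (t : ℝ) :
    linPremium c ε u ^ (lam / ε) * (linPremium c ε (premiumFlow c ε u t) *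
      linPremium c ε (premiumFlow c ε u t) ^ (-(lam / ε) - 1)) = exp (-(lam * t)) := by
  have hp := linPremium_pos hc hε hu
  rw [linPremium_premiumFlow hε.ne', rpow_sub_one (by positivity),
    mul_div_cancel₀ _ (by positivity : linPremium c ε u * exp (ε * t) ≠ 0),
    mul_rpow hp.le (exp_nonneg _), ← mul_assoc, ← rpow_add hp, add_neg_cancel, rpow_zero, one_mul,
    ← exp_mul]
  congr 1
  field_simp

/-- The renewal equation for exponential interarrival times as a tail integral. -/
lemma integral_exp_premiumFlow (hlam : 0 < lam) (hc : 0 < c) (hε : 0 < ε)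
    (hG : ContinuousOn G (Ici 0)) (hGb : ∀ v, 0 ≤ v → |G v| ≤ 1) :
    IntegrableOn (fun v => linPremium c ε v ^ (-(lam / ε) - 1) * G v) (Ioi 0) ∧
    ∀ u, 0 ≤ u → ∫ t in Ioi 0, lam * exp (-(lam * t)) * G (premiumFlow c ε u t)
      = lam * linPremium c ε u ^ (lam / ε) *
        ∫ v in Ioi u, linPremium c ε v ^ (-(lam / ε) - 1) * G v := by
  constructor
  · rw [integrableOn_Ioi_iff_premiumFlow hc hε le_rfl]
    have hp := linPremium_pos hc hε le_rfl
    have := (integrableOn_mul_comp_premiumFlow hc hε hG hGb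
      (integrableOn_exp_neg_mul_Ioi hlam 0) le_rfl).const_mul
      ((linPremium c ε 0 ^ (lam / ε))⁻¹)
    refine IntegrableOn.congr_fun this (fun t _ => ?_) measurableSet_Ioi
    have h := linPremium_rpow_mul_premiumFlow (lam := lam) hc hε le_rfl t
    rw [← h]
    field_simp
  · intro u hu
    rw [integral_Ioi_eq_integral_premiumFlow hc hε hu, ← integral_const_mul]
    refine setIntegral_congr_fun measurableSet_Ioi fun t _ => ?_
    simp only [← linPremium_rpow_mul_premiumFlow (lam := lam) hc hε hu t]
    ring

/-- The renewal equation for Erlang interarrival times as a tail integral. -/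
lemma integral_erlang_premiumFlow (hlam : 0 < lam) (hc : 0 < c) (hε : 0 < ε)
    (hG : ContinuousOn G (Ici 0)) (hGb : ∀ v, 0 ≤ v → |G v| ≤ 1) :
    IntegrableOn (fun v => log (linPremium c ε v) * (linPremium c ε v ^ (-(lam / ε) - 1) * G v))
      (Ioi 0) ∧
    ∀ u, 0 ≤ u → ∫ t in Ioi 0, lam ^ 2 * t * exp (-(lam * t)) * G (premiumFlow c ε u t)
      = lam ^ 2 / ε * linPremium c ε u ^ (lam / ε) *
        ((∫ v in Ioi u, log (linPremium c ε v) * (linPremium c ε v ^ (-(lam / ε) - 1) * G v))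
          - log (linPremium c ε u) * ∫ v in Ioi u, linPremium c ε v ^ (-(lam / ε) - 1) * G v) := by
  have hlog : ∀ u, 0 ≤ u → ∀ t,
      log (linPremium c ε (premiumFlow c ε u t)) - log (linPremium c ε u) = ε * t := by
    intro u hu t
    have hp := linPremium_pos hc hε hu
    rw [linPremium_premiumFlow hε.ne', log_mul hp.ne' (exp_pos _).ne', log_exp]
    ring
  have h1 := (integral_exp_premiumFlow hlam hc hε hG hGb).1
  have h2 : IntegrableOn (fun v => log (linPremium c ε v) *
      (linPremium c ε v ^ (-(lam / ε) - 1) * G v)) (Ioi 0) := by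
    have h3 : IntegrableOn (fun v => (log (linPremium c ε v) - log (linPremium c ε 0)) *
        (linPremium c ε v ^ (-(lam / ε) - 1) * G v)) (Ioi 0) := by
      rw [integrableOn_Ioi_iff_premiumFlow hc hε le_rfl]
      have hp := linPremium_pos hc hε le_rfl
      have := (integrableOn_mul_comp_premiumFlow hc hε hG hGb
        (integrableOn_erlang hlam) le_rfl).const_mul
        (ε / lam ^ 2 * (linPremium c ε 0 ^ (lam / ε))⁻¹)
      refine IntegrableOn.congr_fun this (fun t _ => ?_) measurableSet_Ioi
      have h := linPremium_rpow_mul_premiumFlow (lam := lam) hc hε le_rfl t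
      simp only [hlog 0 le_rfl, ← h]
      field_simp
    have h4 : IntegrableOn (fun v => log (linPremium c ε 0) *
      (linPremium c ε v ^ (-(lam / ε) - 1) * G v)) (Ioi 0) := h1.const_mul _
    refine (h3.add h4).congr_fun (fun v _ => ?_) measurableSet_Ioi
    simp only [Pi.add_apply]
    ring
  refine ⟨h2, fun u hu => ?_⟩
  rw [← integral_const_mul, ← integral_sub (h2.mono_set (Ioi_subset_Ioi hu))
    ((h1.mono_set (Ioi_subset_Ioi hu)).const_mul _),
    integral_Ioi_eq_integral_premiumFlow hc hε hu, ← integral_const_mul]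
  refine setIntegral_congr_fun measurableSet_Ioi fun t _ => ?_
  have h := hlog u hu t
  rw [← linPremium_rpow_mul_premiumFlow (lam := lam) hc hε hu t]
  have ht : t = (log (linPremium c ε (premiumFlow c ε u t)) - log (linPremium c ε u)) / ε := by
    rw [h]; field_simp
  generalize premiumFlow c ε u t = z at *
  subst ht
  field_simp

end Renewal

/-! ### Linear systems satisfied by the ruin probability -/

section Claims

variable {μ : ℝ} {ψ : ℝ → ℝ}

/-- `G v` is the mean of `ψ` after an exponential claim at surplus `v`. Since `ψ = 1` below zero,
`e^{μv} G(v) = 1 + ∫₀^v μ e^{μy} ψ(y) dy`, and this is differentiated. -/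
lemma exists_expMeasure_convolution (hμ : 0 < μ) (hm : Measurable ψ) (hb : ∀ y, |ψ y| ≤ 1)
    (h1 : ∀ y < 0, ψ y = 1) :
    ∃ G : ℝ → ℝ, G 0 = 1 ∧ Continuous G ∧ (∀ v, 0 ≤ v → ∫ x, ψ (v - x) ∂expMeasure μ = G v) ∧
      (ContinuousOn ψ (Ici 0) →
        ∀ v, 0 ≤ v → HasDerivWithinAt G (-μ * G v + μ * ψ v) (Ici 0) v) := by
  set F : ℝ → ℝ := fun y => μ * exp (μ * y) * ψ y with hF
  have hFi : ∀ a b, IntervalIntegrable F volume a b :=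
    intervalIntegrable_mul_of_abs_le_one (by fun_prop) hm hb
  refine ⟨fun v => exp (-(μ * v)) * (1 + ∫ y in (0 : ℝ)..v, F y), by simp, ?_, fun v hv => ?_,
    fun hc v hv => ?_⟩
  · exact (by fun_prop : Continuous fun v => exp (-(μ * v))).mul
      (continuous_const.add (intervalIntegral.continuous_primitive hFi 0))
  · simp only
    rw [integral_expMeasure hμ, integral_Ioi_mul_comp_sub (integrableOn_mul_exp_neg hμ) hm hb h1 hv,
      integral_Ioi_mul_exp_neg hμ, mul_add, mul_one, add_comm, ← intervalIntegral.integral_const_mul]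
    congr 1
    refine intervalIntegral.integral_congr fun y _ => ?_
    simp only [hF]
    rw [show -(μ * (v - y)) = -(μ * v) + μ * y by ring, exp_add]
    ring
  · have hd := hasDerivWithinAt_primitive_Ici (f := F) (hFi 0)
      ((by fun_prop : Continuous fun y => μ * exp (μ * y)).continuousOn.mul hc) hv
    refine ((hasDerivAt_exp_neg_mul μ v).hasDerivWithinAt.mul (hd.const_add 1)).congr_deriv ?_
    have : exp (-(μ * v)) * exp (μ * v) = 1 := by rw [← exp_add, neg_add_cancel, exp_zero]
    simp only [hF]
    linear_combination μ * ψ v * this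

/-- The analogue of `exists_expMeasure_convolution` for Erlang claims; `H` is `μ` times the mean of
`ψ` after an exponential claim, the second of the two stages of an Erlang claim. -/
lemma exists_gammaMeasure_two_convolution (hμ : 0 < μ) (hm : Measurable ψ) (hb : ∀ y, |ψ y| ≤ 1)
    (h1 : ∀ y < 0, ψ y = 1) :
    ∃ G H : ℝ → ℝ, G 0 = 1 ∧ H 0 = μ ∧ Continuous G ∧
      (∀ v, 0 ≤ v → ∫ x, ψ (v - x) ∂gammaMeasure 2 μ = G v) ∧
      (ContinuousOn ψ (Ici 0) → ∀ v, 0 ≤ v → HasDerivWithinAt G (-μ * G v + H v) (Ici 0) v ∧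
        HasDerivWithinAt H (-μ * H v + μ ^ 2 * ψ v) (Ici 0) v) := by
  set F₀ : ℝ → ℝ := fun y => μ ^ 2 * exp (μ * y) * ψ y with hF₀
  set F₁ : ℝ → ℝ := fun y => μ ^ 2 * y * exp (μ * y) * ψ y with hF₁
  have hFi₀ : ∀ a b, IntervalIntegrable F₀ volume a b :=
    intervalIntegrable_mul_of_abs_le_one (by fun_prop) hm hb
  have hFi₁ : ∀ a b, IntervalIntegrable F₁ volume a b :=
    intervalIntegrable_mul_of_abs_le_one (by fun_prop) hm hb
  refine ⟨fun v => exp (-(μ * v)) * (1 + μ * v + v * (∫ y in (0 : ℝ)..v, F₀ y)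
      - ∫ y in (0 : ℝ)..v, F₁ y), fun v => exp (-(μ * v)) * (μ + ∫ y in (0 : ℝ)..v, F₀ y),
    by simp, by simp, ?_, fun v hv => ?_, fun hc v hv => ?_⟩
  · have e₀ := intervalIntegral.continuous_primitive hFi₀ 0
    have e₁ := intervalIntegral.continuous_primitive hFi₁ 0
    fun_prop
  · rw [integral_gammaMeasure_two hμ, integral_Ioi_mul_comp_sub (integrableOn_erlang hμ) hm hb h1 hv,
      integral_Ioi_erlang hμ hv]
    have e : ∫ y in (0 : ℝ)..v, μ ^ 2 * (v - y) * exp (-(μ * (v - y))) * ψ y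
        = ∫ y in (0 : ℝ)..v, (exp (-(μ * v)) * (v * F₀ y - F₁ y)) := by
      refine intervalIntegral.integral_congr fun y _ => ?_
      simp only [hF₀, hF₁]
      rw [show -(μ * (v - y)) = -(μ * v) + μ * y by ring, exp_add]
      ring
    rw [e, intervalIntegral.integral_const_mul, intervalIntegral.integral_sub
      ((hFi₀ 0 v).const_mul v) (hFi₁ 0 v), intervalIntegral.integral_const_mul]
    ring
  · have hd₀ := hasDerivWithinAt_primitive_Ici (f := F₀) (hFi₀ 0)
      ((by fun_prop : Continuous fun y => μ ^ 2 * exp (μ * y)).continuousOn.mul hc) hv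
    have hd₁ := hasDerivWithinAt_primitive_Ici (f := F₁) (hFi₁ 0)
      ((by fun_prop : Continuous fun y => μ ^ 2 * y * exp (μ * y)).continuousOn.mul hc) hv
    have he := (hasDerivAt_exp_neg_mul μ v).hasDerivWithinAt (s := Ici 0)
    have hid : HasDerivWithinAt (fun v : ℝ => v) 1 (Ici 0) v := hasDerivWithinAt_id v _
    have hlin : HasDerivWithinAt (fun v => 1 + μ * v) μ (Ici 0) v := by
      simpa using (hid.const_mul μ).const_add 1
    have : exp (-(μ * v)) * exp (μ * v) = 1 := by rw [← exp_add, neg_add_cancel, exp_zero]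
    refine ⟨(he.mul ((hlin.add (hid.mul hd₀)).sub hd₁)).congr_deriv ?_,
      (he.mul (hd₀.const_add μ)).congr_deriv ?_⟩
    · simp only [hF₀, hF₁, Pi.add_apply, Pi.mul_apply, Pi.sub_apply]
      ring
    · simp only [hF₀]
      linear_combination μ ^ 2 * ψ v * this

end Claims

lemma toReal_ruinFun_of_neg {c ε : ℝ} {νT νX : Measure ℝ} (u : ℝ) (hu : u < 0) : (ruinFun c ε νT νX u).toReal = 1 := by
  rw [ruinFun_of_neg hu, ENNReal.toReal_one]

section System

variable {c ε : ℝ} {νT νX : Measure ℝ} [IsProbabilityMeasure νT] [IsProbabilityMeasure νX]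

lemma measurable_toReal_ruinFun : Measurable fun u => (ruinFun c ε νT νX u).toReal :=
  measurable_ruinFun.ennreal_toReal

lemma abs_toReal_ruinFun_le_one (u : ℝ) : |(ruinFun c ε νT νX u).toReal| ≤ 1 := by
  rw [abs_of_nonneg ENNReal.toReal_nonneg]
  exact ENNReal.toReal_le_of_le_ofReal zero_le_one (by simpa using ruinFun_le_one u)

lemma abs_integral_toReal_ruinFun_le_one (v : ℝ) :
    |∫ x, (ruinFun c ε νT νX (v - x)).toReal ∂νX| ≤ 1 := by
  have := norm_integral_le_of_norm_le_const (μ := νX) (C := 1)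
    (f := fun x => (ruinFun c ε νT νX (v - x)).toReal)
    (Eventually.of_forall fun x => abs_toReal_ruinFun_le_one (v - x))
  simpa using this

end System

/-- For Erlang interarrival times and exponential claims, the ruin probability `ψ`, the probability
`λ q` of ruin when the next interarrival time is exponential, and the probability `G` of ruin when a
claim is due at once satisfy a linear system. -/
lemma exists_system_erlang_times {lam μ c ε : ℝ} (hlam : 0 < lam) (hμ : 0 < μ) (hc : 0 < c) (hε : 0 < ε)
    {ψ : ℝ → ℝ} (hψ : ψ = fun u => (ruinFun c ε (gammaMeasure 2 lam) (expMeasure μ) u).toReal) :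
    ∃ q G : ℝ → ℝ, G 0 = 1 ∧ ∀ u, 0 ≤ u →
      HasDerivWithinAt ψ ((lam * ψ u - lam ^ 2 * q u) / linPremium c ε u) (Ici 0) u ∧
      HasDerivWithinAt q ((lam * q u - G u) / linPremium c ε u) (Ici 0) u ∧
      HasDerivWithinAt G (-μ * G u + μ * ψ u) (Ici 0) u := by
  have : IsProbabilityMeasure (gammaMeasure 2 lam) := isProbabilityMeasure_gammaMeasure two_pos hlam
  have : IsProbabilityMeasure (expMeasure μ) := isProbabilityMeasure_expMeasure hμ
  obtain ⟨G, hG0, hGc, hGeq, hGd⟩ := exists_expMeasure_convolution (ψ := ψ) hμ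
    (hψ ▸ measurable_toReal_ruinFun) (hψ ▸ abs_toReal_ruinFun_le_one) (hψ ▸ toReal_ruinFun_of_neg)
  have hGb : ∀ v, 0 ≤ v → |G v| ≤ 1 := fun v hv => by
    rw [← hGeq v hv, hψ]
    exact abs_integral_toReal_ruinFun_le_one v
  set g : ℝ → ℝ := fun v => linPremium c ε v ^ (-(lam / ε) - 1) * G v with hg
  have hgi : IntegrableOn g (Ioi 0) :=
    (integral_exp_premiumFlow hlam hc hε hGc.continuousOn hGb).1
  obtain ⟨hli, hint⟩ : IntegrableOn (fun v => log (linPremium c ε v) * g v) (Ioi 0) ∧ _ :=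
    integral_erlang_premiumFlow hlam hc hε hGc.continuousOn hGb
  have hψeq : ∀ u ∈ Ici (0 : ℝ), ψ u = lam ^ 2 / ε * linPremium c ε u ^ (lam / ε) *
      ((∫ v in Ioi u, log (linPremium c ε v) * g v) - log (linPremium c ε u) * ∫ v in Ioi u, g v) := by
    intro u hu
    rw [← hint u hu, hψ]
    simp only
    rw [toReal_ruinFun_eq hu, integral_gammaMeasure_two hlam]
    refine setIntegral_congr_fun measurableSet_Ioi fun t ht => ?_
    rw [← hGeq _ (hu.trans (le_premiumFlow hc hε hu (le_of_lt ht))), hψ]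
  have hgc : ContinuousOn g (Ici 0) := fun v hv =>
    ((hasDerivAt_linPremium_rpow _ (linPremium_pos hc hε hv)).continuousAt.mul
      hGc.continuousAt).continuousWithinAt
  have hlc : ContinuousOn (fun v => log (linPremium c ε v)) (Ici 0) := fun v hv =>
    ((hasDerivAt_linPremium c ε v).continuousAt.log (linPremium_pos hc hε hv).ne').continuousWithinAt
  have hdψ : ∀ u, 0 ≤ u → HasDerivWithinAt ψ ((lam * ψ u - lam ^ 2 *
      (linPremium c ε u ^ (lam / ε) * ∫ v in Ioi u, g v)) / linPremium c ε u) (Ici 0) u := by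
    intro u hu
    have hp := linPremium_pos hc hε hu
    refine HasDerivWithinAt.congr ?_ hψeq (hψeq u hu)
    have d1 := ((hasDerivAt_linPremium_rpow (lam / ε) hp).const_mul (lam ^ 2 / ε)).hasDerivWithinAt
      (s := Ici 0)
    have d2 := hasDerivWithinAt_integral_Ioi hli (hlc.mul hgc) hu
    have d3 := hasDerivWithinAt_integral_Ioi hgi hgc hu
    have d4 := ((hasDerivAt_linPremium c ε u).log hp.ne').hasDerivWithinAt (s := Ici 0)
    refine (d1.mul (d2.sub (d4.mul d3))).congr_deriv ?_
    rw [hψeq u hu]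
    simp only [Pi.sub_apply, Pi.mul_apply]
    generalize linPremium c ε u ^ (lam / ε) = P
    generalize linPremium c ε u = p at hp ⊢
    field_simp
    ring
  refine ⟨fun u => linPremium c ε u ^ (lam / ε) * ∫ v in Ioi u, g v, G, hG0, fun u hu =>
    ⟨hdψ u hu, ?_, hGd (fun v hv => (hdψ v hv).continuousWithinAt) u hu⟩⟩
  have hp := linPremium_pos hc hε hu
  refine ((hasDerivAt_linPremium_rpow (lam / ε) hp).hasDerivWithinAt.mul
    (hasDerivWithinAt_integral_Ioi hgi hgc hu)).congr_deriv ?_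
  have h : linPremium c ε u ^ (lam / ε) * linPremium c ε u ^ (-(lam / ε) - 1)
      = (linPremium c ε u)⁻¹ := by
    rw [← rpow_add hp, ← rpow_neg_one]
    congr 1
    ring
  rw [mul_div_cancel₀ _ hε.ne']
  linear_combination (-G u) * h

/-- For exponential interarrival times and Erlang claims, the ruin probability `ψ` and the
probabilities `G` and `H / μ` of ruin when two, respectively one, exponential parts of a claim
are due at once satisfy a linear system. -/
lemma exists_system_erlang_claims {lam μ c ε : ℝ} (hlam : 0 < lam) (hμ : 0 < μ) (hc : 0 < c) (hε : 0 < ε)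
    {ψ : ℝ → ℝ} (hψ : ψ = fun u => (ruinFun c ε (expMeasure lam) (gammaMeasure 2 μ) u).toReal) :
    ∃ G H : ℝ → ℝ, G 0 = 1 ∧ H 0 = μ ∧ ∀ u, 0 ≤ u →
      HasDerivWithinAt ψ ((lam * ψ u - lam * G u) / linPremium c ε u) (Ici 0) u ∧
      HasDerivWithinAt G (-μ * G u + H u) (Ici 0) u ∧
      HasDerivWithinAt H (-μ * H u + μ ^ 2 * ψ u) (Ici 0) u := by
  have : IsProbabilityMeasure (expMeasure lam) := isProbabilityMeasure_expMeasure hlam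
  have : IsProbabilityMeasure (gammaMeasure 2 μ) := isProbabilityMeasure_gammaMeasure two_pos hμ
  obtain ⟨G, H, hG0, hH0, hGc, hGeq, hGd⟩ := exists_gammaMeasure_two_convolution (ψ := ψ) hμ
    (hψ ▸ measurable_toReal_ruinFun) (hψ ▸ abs_toReal_ruinFun_le_one) (hψ ▸ toReal_ruinFun_of_neg)
  have hGb : ∀ v, 0 ≤ v → |G v| ≤ 1 := fun v hv => by
    rw [← hGeq v hv, hψ]
    exact abs_integral_toReal_ruinFun_le_one v
  set g : ℝ → ℝ := fun v => linPremium c ε v ^ (-(lam / ε) - 1) * G v with hg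
  obtain ⟨hgi, hint⟩ : IntegrableOn g (Ioi 0) ∧ _ :=
    integral_exp_premiumFlow hlam hc hε hGc.continuousOn hGb
  have hψeq : ∀ u ∈ Ici (0 : ℝ), ψ u = lam * linPremium c ε u ^ (lam / ε) * ∫ v in Ioi u, g v := by
    intro u hu
    rw [← hint u hu, hψ]
    simp only
    rw [toReal_ruinFun_eq hu, integral_expMeasure hlam]
    refine setIntegral_congr_fun measurableSet_Ioi fun t ht => ?_
    rw [← hGeq _ (hu.trans (le_premiumFlow hc hε hu (le_of_lt ht))), hψ]
  have hgc : ContinuousOn g (Ici 0) := fun v hv =>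
    ((hasDerivAt_linPremium_rpow _ (linPremium_pos hc hε hv)).continuousAt.mul
      hGc.continuousAt).continuousWithinAt
  have hdψ : ∀ u, 0 ≤ u →
      HasDerivWithinAt ψ ((lam * ψ u - lam * G u) / linPremium c ε u) (Ici 0) u := by
    intro u hu
    have hp := linPremium_pos hc hε hu
    refine HasDerivWithinAt.congr ?_ hψeq (hψeq u hu)
    refine (((hasDerivAt_linPremium_rpow (lam / ε) hp).const_mul lam).hasDerivWithinAt.mul
      (hasDerivWithinAt_integral_Ioi hgi hgc hu)).congr_deriv ?_
    have h : linPremium c ε u ^ (lam / ε) * linPremium c ε u ^ (-(lam / ε) - 1)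
        = (linPremium c ε u)⁻¹ := by
      rw [← rpow_add hp, ← rpow_neg_one]
      congr 1
      ring
    rw [hψeq u hu]
    rw [mul_div_cancel₀ _ hε.ne']
    linear_combination (-lam * G u) * h
  exact ⟨G, H, hG0, hH0, fun u hu =>
    ⟨hdψ u hu, hGd (fun v hv => (hdψ v hv).continuousWithinAt) u hu⟩⟩

/-! ### Consequences of the linear systems -/

/-- A solution on `[0, ∞)` of a smooth first-order equation is smooth. -/
lemma contDiffOn_Ici_of_hasDerivWithinAt {E : Type*} [NormedAddCommGroup E] [NormedSpace ℝ E]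
    {F : ℝ × E → E} {y : ℝ → E} (hF : ContDiffOn ℝ ∞ F (Ici 0 ×ˢ univ))
    (hy : ∀ u, 0 ≤ u → HasDerivWithinAt y (F (u, y u)) (Ici 0) u) : ContDiffOn ℝ ∞ y (Ici 0) := by
  have hU : UniqueDiffOn ℝ (Ici (0 : ℝ)) := uniqueDiffOn_Ici 0
  rw [contDiffOn_infty]
  intro n
  induction n with
  | zero => exact contDiffOn_zero.2 fun u hu => (hy u hu).continuousWithinAt
  | succ n ih =>
    rw [Nat.cast_add, Nat.cast_one, contDiffOn_succ_iff_derivWithin hU]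
    refine ⟨fun u hu => (hy u hu).differentiableWithinAt, by simp, ?_⟩
    have h1 : ContDiffOn ℝ n (fun u => F (u, y u)) (Ici 0) :=
      (contDiffOn_infty.1 hF n).comp (contDiffOn_id.prodMk ih) fun u hu => ⟨hu, mem_univ _⟩
    exact h1.congr fun u hu => (hy u hu).derivWithin (hU u hu)

lemma contDiff_linPremium (c ε : ℝ) : ContDiff ℝ ∞ (linPremium c ε) :=
  contDiff_const.add (contDiff_const.mul contDiff_id)

lemma D₀_eq {f : ℝ → ℝ} {d u : ℝ} (hu : 0 ≤ u) (h : HasDerivWithinAt f d (Ici 0) u) : D₀ f u = d :=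
  h.derivWithin (uniqueDiffOn_Ici 0 u hu)

lemma D₀_congr {f g : ℝ → ℝ} {u : ℝ} (hu : 0 ≤ u) (h : ∀ v, 0 ≤ v → f v = g v) : D₀ f u = D₀ g u :=
  derivWithin_congr (fun v hv => h v hv) (h u hu)

section ErlangTimes

variable {lam μ c ε : ℝ} {ψ q G : ℝ → ℝ}

lemma contDiffOn_of_system_erlang_times (hc : 0 < c) (hε : 0 < ε)
    (hs : ∀ u, 0 ≤ u →
      HasDerivWithinAt ψ ((lam * ψ u - lam ^ 2 * q u) / linPremium c ε u) (Ici 0) u ∧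
      HasDerivWithinAt q ((lam * q u - G u) / linPremium c ε u) (Ici 0) u ∧
      HasDerivWithinAt G (-μ * G u + μ * ψ u) (Ici 0) u) : ContDiffOn ℝ ∞ ψ (Ici 0) := by
  have h := contDiffOn_Ici_of_hasDerivWithinAt (y := fun u => (ψ u, q u, G u))
    (F := fun z : ℝ × (ℝ × ℝ × ℝ) => ((lam * z.2.1 - lam ^ 2 * z.2.2.1) / linPremium c ε z.1,
      (lam * z.2.2.1 - z.2.2.2) / linPremium c ε z.1, -μ * z.2.2.2 + μ * z.2.1)) ?_
    fun u hu => (hs u hu).1.prodMk ((hs u hu).2.1.prodMk (hs u hu).2.2)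
  · exact h.fst
  · have hp : ContDiffOn ℝ ∞ (fun z : ℝ × (ℝ × ℝ × ℝ) => linPremium c ε z.1) (Ici 0 ×ˢ univ) :=
      ((contDiff_linPremium c ε).comp contDiff_fst).contDiffOn
    have hp0 : ∀ z ∈ (Ici 0 ×ˢ univ : Set (ℝ × (ℝ × ℝ × ℝ))), linPremium c ε z.1 ≠ 0 :=
      fun z hz => (linPremium_pos hc hε hz.1).ne'
    refine ContDiffOn.prodMk (ContDiffOn.div ?_ hp hp0)
      (ContDiffOn.prodMk (ContDiffOn.div ?_ hp hp0) ?_) <;>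
    · refine ContDiff.contDiffOn ?_
      fun_prop

/-- Each of the three factors of the operator steps along the chain `ψ ↦ λ² q ↦ λ² G ↦ λ² μ ψ` of
the system. -/
lemma premiumOp_of_system_erlang_times (hc : 0 < c) (hε : 0 < ε)
    (hs : ∀ u, 0 ≤ u →
      HasDerivWithinAt ψ ((lam * ψ u - lam ^ 2 * q u) / linPremium c ε u) (Ici 0) u ∧
      HasDerivWithinAt q ((lam * q u - G u) / linPremium c ε u) (Ici 0) u ∧
      HasDerivWithinAt G (-μ * G u + μ * ψ u) (Ici 0) u) {u : ℝ} (hu : 0 ≤ u) :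
    shiftOp μ (premiumOp lam (linPremium c ε) (premiumOp lam (linPremium c ε) ψ)) u
      - lam ^ 2 * μ * ψ u = 0 := by
  have h1 : ∀ v, 0 ≤ v → premiumOp lam (linPremium c ε) ψ v = lam ^ 2 * q v := by
    intro v hv
    have hp := (linPremium_pos hc hε hv).ne'
    rw [premiumOp, D₀_eq hv (hs v hv).1]
    field_simp
    ring
  have h2 : ∀ v, 0 ≤ v → premiumOp lam (linPremium c ε) (premiumOp lam (linPremium c ε) ψ) v
      = lam ^ 2 * G v := by
    intro v hv
    have hp := (linPremium_pos hc hε hv).ne'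
    rw [premiumOp, D₀_congr hv h1, h1 v hv, D₀_eq hv ((hs v hv).2.1.const_mul _)]
    field_simp
    ring
  rw [shiftOp, D₀_congr hu h2, h2 u hu, D₀_eq hu ((hs u hu).2.2.const_mul _)]
  ring

/-- The operator equation expanded: the terms in `ψ` itself cancel, so that it is a second-order
equation for `ψ'`. The derivatives are computed by differentiating the system. -/
lemma solvesODE_of_system_erlang_times (hc : 0 < c) (hε : 0 < ε)
    (hs : ∀ u, 0 ≤ u →
      HasDerivWithinAt ψ ((lam * ψ u - lam ^ 2 * q u) / linPremium c ε u) (Ici 0) u ∧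
      HasDerivWithinAt q ((lam * q u - G u) / linPremium c ε u) (Ici 0) u ∧
      HasDerivWithinAt G (-μ * G u + μ * ψ u) (Ici 0) u) :
    SolvesODE (fun u => linPremium c ε u ^ 2)
      (fun u => 3 * ε * linPremium c ε u - 2 * lam * linPremium c ε u + μ * linPremium c ε u ^ 2)
      (fun u => (lam - ε) ^ 2 + μ * ε * linPremium c ε u - 2 * lam * μ * linPremium c ε u)
      (D₀ ψ) := by
  set p := linPremium c ε with hpdef
  have hp : ∀ u, 0 ≤ u → p u ≠ 0 := fun u hu => (linPremium_pos hc hε hu).ne'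
  have hdp : ∀ u, HasDerivWithinAt p ε (Ici 0) u := fun u =>
    (hasDerivAt_linPremium c ε u).hasDerivWithinAt
  clear_value p
  set ψ₁ : ℝ → ℝ := fun u => (lam * ψ u - lam ^ 2 * q u) / p u with hψ₁
  set q₁ : ℝ → ℝ := fun u => (lam * q u - G u) / p u with hq₁
  set G₁ : ℝ → ℝ := fun u => -μ * G u + μ * ψ u with hG₁
  set ψ₂ : ℝ → ℝ := fun u => (lam * ψ₁ u - lam ^ 2 * q₁ u - ε * ψ₁ u) / p u with hψ₂
  set q₂ : ℝ → ℝ := fun u => (lam * q₁ u - G₁ u - ε * q₁ u) / p u with hq₂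
  have d₁ : ∀ u, 0 ≤ u → HasDerivWithinAt ψ₁ (ψ₂ u) (Ici 0) u := by
    intro u hu
    have hp := hp u hu
    refine ((((hs u hu).1.const_mul lam).sub ((hs u hu).2.1.const_mul (lam ^ 2))).div (hdp u)
      hp).congr_deriv ?_
    simp only [hψ₂, hψ₁, hq₁, Pi.sub_apply]
    field_simp
  have e₁ : ∀ u, 0 ≤ u → HasDerivWithinAt q₁ (q₂ u) (Ici 0) u := by
    intro u hu
    have hp := hp u hu
    refine ((((hs u hu).2.1.const_mul lam).sub (hs u hu).2.2).div (hdp u) hp).congr_deriv ?_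
    simp only [hq₂, hq₁, hG₁, Pi.sub_apply]
    field_simp
  have d₂ : ∀ u, 0 ≤ u → HasDerivWithinAt ψ₂
      ((lam * ψ₂ u - lam ^ 2 * q₂ u - 2 * ε * ψ₂ u) / p u) (Ici 0) u := by
    intro u hu
    have hp := hp u hu
    refine (((((d₁ u hu).const_mul lam).sub ((e₁ u hu).const_mul (lam ^ 2))).sub
      ((d₁ u hu).const_mul ε)).div (hdp u) hp).congr_deriv ?_
    simp only [Pi.sub_apply]
    have : ψ₂ u * p u = lam * ψ₁ u - lam ^ 2 * q₁ u - ε * ψ₁ u := div_mul_cancel₀ _ hp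
    field_simp
    linear_combination ε * this
  have hD : ∀ u, 0 ≤ u → D₀ ψ u = ψ₁ u := fun u hu => D₀_eq hu (hs u hu).1
  refine ⟨ψ₂, _, fun u hu => ⟨(d₁ u hu).congr hD (hD u hu), d₂ u hu, ?_⟩⟩
  have hp := hp u hu
  simp only [hD u hu]
  have a₁ : ψ₁ u * p u = lam * ψ u - lam ^ 2 * q u := div_mul_cancel₀ _ hp
  have a₂ : ψ₂ u * p u = lam * ψ₁ u - lam ^ 2 * q₁ u - ε * ψ₁ u := div_mul_cancel₀ _ hp
  have b₁ : q₁ u * p u = lam * q u - G u := div_mul_cancel₀ _ hp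
  have b₂ : q₂ u * p u = lam * q₁ u - G₁ u - ε * q₁ u := div_mul_cancel₀ _ hp
  have g₁ : G₁ u = -μ * G u + μ * ψ u := rfl
  have a₃ : p u ^ 2 * ((lam * ψ₂ u - lam ^ 2 * q₂ u - 2 * ε * ψ₂ u) / p u)
      = p u * (lam * ψ₂ u - lam ^ 2 * q₂ u - 2 * ε * ψ₂ u) := by field_simp
  rw [a₃]
  linear_combination (ε - lam + μ * p u) * a₂ - lam ^ 2 * b₂ + lam ^ 2 * g₁ - lam * μ * a₁
    - lam ^ 2 * μ * b₁

end ErlangTimes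

section ErlangClaims

variable {lam μ c ε : ℝ} {ψ G H : ℝ → ℝ}

lemma contDiffOn_of_system_erlang_claims (hc : 0 < c) (hε : 0 < ε)
    (hs : ∀ u, 0 ≤ u →
      HasDerivWithinAt ψ ((lam * ψ u - lam * G u) / linPremium c ε u) (Ici 0) u ∧
      HasDerivWithinAt G (-μ * G u + H u) (Ici 0) u ∧
      HasDerivWithinAt H (-μ * H u + μ ^ 2 * ψ u) (Ici 0) u) : ContDiffOn ℝ ∞ ψ (Ici 0) := by
  have h := contDiffOn_Ici_of_hasDerivWithinAt (y := fun u => (ψ u, G u, H u))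
    (F := fun z : ℝ × (ℝ × ℝ × ℝ) => ((lam * z.2.1 - lam * z.2.2.1) / linPremium c ε z.1,
      -μ * z.2.2.1 + z.2.2.2, -μ * z.2.2.2 + μ ^ 2 * z.2.1)) ?_
    fun u hu => (hs u hu).1.prodMk ((hs u hu).2.1.prodMk (hs u hu).2.2)
  · exact h.fst
  · have hp : ContDiffOn ℝ ∞ (fun z : ℝ × (ℝ × ℝ × ℝ) => linPremium c ε z.1) (Ici 0 ×ˢ univ) :=
      ((contDiff_linPremium c ε).comp contDiff_fst).contDiffOn
    have hp0 : ∀ z ∈ (Ici 0 ×ˢ univ : Set (ℝ × (ℝ × ℝ × ℝ))), linPremium c ε z.1 ≠ 0 :=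
      fun z hz => (linPremium_pos hc hε hz.1).ne'
    refine ContDiffOn.prodMk (ContDiffOn.div ?_ hp hp0) (ContDiffOn.prodMk ?_ ?_) <;>
    · refine ContDiff.contDiffOn ?_
      fun_prop

/-- Each of the three factors of the operator steps along the chain `ψ ↦ λ G ↦ λ H ↦ λ μ² ψ` of the
system. -/
lemma premiumOp_of_system_erlang_claims (hc : 0 < c) (hε : 0 < ε)
    (hs : ∀ u, 0 ≤ u →
      HasDerivWithinAt ψ ((lam * ψ u - lam * G u) / linPremium c ε u) (Ici 0) u ∧
      HasDerivWithinAt G (-μ * G u + H u) (Ici 0) u ∧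
      HasDerivWithinAt H (-μ * H u + μ ^ 2 * ψ u) (Ici 0) u) {u : ℝ} (hu : 0 ≤ u) :
    shiftOp μ (shiftOp μ (premiumOp lam (linPremium c ε) ψ)) u - lam * μ ^ 2 * ψ u = 0 := by
  have h1 : ∀ v, 0 ≤ v → premiumOp lam (linPremium c ε) ψ v = lam * G v := by
    intro v hv
    have hp := (linPremium_pos hc hε hv).ne'
    rw [premiumOp, D₀_eq hv (hs v hv).1]
    field_simp
    ring
  have h2 : ∀ v, 0 ≤ v → shiftOp μ (premiumOp lam (linPremium c ε) ψ) v = lam * H v := by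
    intro v hv
    rw [shiftOp, D₀_congr hv h1, h1 v hv, D₀_eq hv ((hs v hv).2.1.const_mul _)]
    ring
  rw [shiftOp, D₀_congr hu h2, h2 u hu, D₀_eq hu ((hs u hu).2.2.const_mul _)]
  ring

/-- As in `solvesODE_of_system_erlang_times`, the terms in `ψ` itself cancel in the operator equation. -/
lemma solvesODE_of_system_erlang_claims (hc : 0 < c) (hε : 0 < ε)
    (hs : ∀ u, 0 ≤ u →
      HasDerivWithinAt ψ ((lam * ψ u - lam * G u) / linPremium c ε u) (Ici 0) u ∧
      HasDerivWithinAt G (-μ * G u + H u) (Ici 0) u ∧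
      HasDerivWithinAt H (-μ * H u + μ ^ 2 * ψ u) (Ici 0) u) :
    SolvesODE (linPremium c ε) (fun u => 2 * ε + 2 * μ * linPremium c ε u - lam)
      (fun u => 2 * μ * ε + μ ^ 2 * linPremium c ε u - 2 * μ * lam) (D₀ ψ) := by
  set p := linPremium c ε with hpdef
  have hp : ∀ u, 0 ≤ u → p u ≠ 0 := fun u hu => (linPremium_pos hc hε hu).ne'
  have hdp : ∀ u, HasDerivWithinAt p ε (Ici 0) u := fun u =>
    (hasDerivAt_linPremium c ε u).hasDerivWithinAt
  clear_value p
  set ψ₁ : ℝ → ℝ := fun u => (lam * ψ u - lam * G u) / p u with hψ₁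
  set G₁ : ℝ → ℝ := fun u => -μ * G u + H u with hG₁
  set H₁ : ℝ → ℝ := fun u => -μ * H u + μ ^ 2 * ψ u with hH₁
  set ψ₂ : ℝ → ℝ := fun u => (lam * ψ₁ u - lam * G₁ u - ε * ψ₁ u) / p u with hψ₂
  set G₂ : ℝ → ℝ := fun u => -μ * G₁ u + H₁ u with hG₂
  have d₁ : ∀ u, 0 ≤ u → HasDerivWithinAt ψ₁ (ψ₂ u) (Ici 0) u := by
    intro u hu
    have hp := hp u hu
    refine ((((hs u hu).1.const_mul lam).sub ((hs u hu).2.1.const_mul lam)).div (hdp u)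
      hp).congr_deriv ?_
    simp only [hψ₂, hψ₁, hG₁, Pi.sub_apply]
    field_simp
  have e₁ : ∀ u, 0 ≤ u → HasDerivWithinAt G₁ (G₂ u) (Ici 0) u := fun u hu =>
    ((hs u hu).2.1.const_mul (-μ)).add (hs u hu).2.2
  have d₂ : ∀ u, 0 ≤ u → HasDerivWithinAt ψ₂
      ((lam * ψ₂ u - lam * G₂ u - 2 * ε * ψ₂ u) / p u) (Ici 0) u := by
    intro u hu
    have hp := hp u hu
    refine (((((d₁ u hu).const_mul lam).sub ((e₁ u hu).const_mul lam)).sub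
      ((d₁ u hu).const_mul ε)).div (hdp u) hp).congr_deriv ?_
    simp only [Pi.sub_apply]
    have : ψ₂ u * p u = lam * ψ₁ u - lam * G₁ u - ε * ψ₁ u := div_mul_cancel₀ _ hp
    field_simp
    linear_combination ε * this
  have hD : ∀ u, 0 ≤ u → D₀ ψ u = ψ₁ u := fun u hu => D₀_eq hu (hs u hu).1
  refine ⟨ψ₂, _, fun u hu => ⟨(d₁ u hu).congr hD (hD u hu), d₂ u hu, ?_⟩⟩
  have hp := hp u hu
  simp only [hD u hu]
  have a₁ : ψ₁ u * p u = lam * ψ u - lam * G u := div_mul_cancel₀ _ hp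
  have a₂ : ψ₂ u * p u = lam * ψ₁ u - lam * G₁ u - ε * ψ₁ u := div_mul_cancel₀ _ hp
  have g₁ : G₁ u = -μ * G u + H u := rfl
  have g₂ : G₂ u = -μ * G₁ u + H₁ u := rfl
  have k₁ : H₁ u = -μ * H u + μ ^ 2 * ψ u := rfl
  have a₃ : p u * ((lam * ψ₂ u - lam * G₂ u - 2 * ε * ψ₂ u) / p u)
      = lam * ψ₂ u - lam * G₂ u - 2 * ε * ψ₂ u := by field_simp
  rw [a₃]
  linear_combination 2 * μ * a₂ + μ ^ 2 * a₁ - lam * g₂ - lam * k₁ - lam * μ * g₁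

end ErlangClaims

/-! ### Tail integrals and asymptotics of the ruin probability -/

lemma isEquivalent_integral_Ioi_const_mul {f g : ℝ → ℝ} {a κ : ℝ} (hκ : 0 < κ)
    (hg : IntegrableOn g (Ioi a)) (hg0 : ∀ x, a ≤ x → 0 ≤ g x) (hf : ContinuousOn f (Ici a))
    (h : f ~[atTop] fun y => κ * g y) :
    (fun u => ∫ x in Ioi u, f x) ~[atTop] fun u => κ * ∫ x in Ioi u, g x := by
  have := isEquivalent_integral_Ioi (a := a) (hg.const_mul κ)
    (fun x hx => mul_nonneg hκ.le (hg0 x hx)) hf h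
  simpa only [integral_const_mul] using this

lemma Asymptotics.IsEquivalent.const_mul_div {ψ F S : ℝ → ℝ} {A κ : ℝ} (hκ : κ ≠ 0)
    (hψ : ψ ~[atTop] fun u => A * S u) (hF : F ~[atTop] fun u => κ * S u) :
    ψ ~[atTop] fun u => A / κ * F u := by
  have h1 : (fun u => A / κ * F u) ~[atTop] fun u => A / κ * (κ * S u) :=
    (IsEquivalent.refl (u := fun _ => A / κ)).mul hF
  refine hψ.trans (h1.congr_right (Eventually.of_forall fun u => ?_)).symm
  simp only
  field_simp

lemma Asymptotics.IsEquivalent.add_const_mul_isLittleO {f S T : ℝ → ℝ} {A : ℝ} (hA : A ≠ 0)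
    (hf : f ~[atTop] fun u => A * S u) (hT : T =o[atTop] S) (B : ℝ) :
    f ~[atTop] fun u => A * S u + B * T u := by
  have h1 : (fun u => B * T u) =o[atTop] fun u => A * S u :=
    (hT.const_mul_left B).const_mul_right hA
  exact hf.trans (IsEquivalent.refl.add_isLittleO h1).symm

/-- A function on `[0, ∞)` that vanishes at infinity is minus the tail integral of its
derivative. -/
lemma eq_neg_integral_Ioi {ψ h : ℝ → ℝ} (hψ : ∀ u, 0 ≤ u → HasDerivWithinAt ψ (h u) (Ici 0) u)
    (hh : IntegrableOn h (Ioi 0)) (hlim : Tendsto ψ atTop (𝓝 0)) {u : ℝ} (hu : 0 ≤ u) :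
    ψ u = -∫ v in Ioi u, h v := by
  rw [integral_Ioi_of_hasDerivAt_of_tendsto
    ((hψ u hu).continuousWithinAt.mono (Ici_subset_Ici.2 hu))
    (fun v hv => (hψ v (hu.trans (le_of_lt hv))).hasDerivAt (Ici_mem_nhds (hu.trans_lt hv)))
    (hh.mono_set (Ioi_subset_Ioi hu)) hlim]
  ring

section ErlangTimes

variable {lam μ c ε : ℝ} {ψ q G : ℝ → ℝ}

/-- The non-integrable solution does not contribute to the derivative of the bounded function `ψ`. -/
lemma exists_eq_integral_kummerSolU (hlam : 0 < lam) (hμ : 0 < μ) (hc : 0 < c) (hε : 0 < ε)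
    (hG : G 0 = 1) (hs : ∀ u, 0 ≤ u →
      HasDerivWithinAt ψ ((lam * ψ u - lam ^ 2 * q u) / linPremium c ε u) (Ici 0) u ∧
      HasDerivWithinAt q ((lam * q u - G u) / linPremium c ε u) (Ici 0) u ∧
      HasDerivWithinAt G (-μ * G u + μ * ψ u) (Ici 0) u)
    (hb : ∀ u, |ψ u| ≤ 1) (h0 : ∀ u, 0 ≤ ψ u) (hlim : Tendsto ψ atTop (𝓝 0)) {C₁ C₂ : ℝ}
    (hD : ∀ u, 0 ≤ u → D₀ ψ u = C₁ * kummerSolM μ c ε (-1 + lam / ε) (1 + lam / ε) 1 u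
      + C₂ * kummerSolU μ c ε (-1 + lam / ε) (1 + lam / ε) 1 u) :
    ∃ C : ℝ, 0 < C ∧ ∀ u, 0 ≤ u →
      ψ u = C * ∫ v in Ioi u, kummerSolU μ c ε (-1 + lam / ε) (1 + lam / ε) 1 v := by
  set hM := kummerSolM μ c ε (-1 + lam / ε) (1 + lam / ε) 1
  set hU := kummerSolU μ c ε (-1 + lam / ε) (1 + lam / ε) 1
  have hL : 0 < lam / ε := by positivity
  have hMc : ContinuousOn hM (Ici 0) := continuousOn_kummerSolM hc hε (by positivity) one_pos
  have hUc : ContinuousOn hU (Ici 0) :=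
    continuousOn_kummerSolU hμ hc hε (by positivity) (by linarith)
  have hUi : IntegrableOn hU (Ioi 0) :=
    integrableOn_kummerSolU hμ hc hε (by positivity) (by linarith) (by ring)
  have hUpos : ∀ u, 0 ≤ u → 0 < hU u := fun u hu =>
    kummerSolU_pos hμ hc hε (by positivity) (by linarith) hu
  have hψ : ∀ u, 0 ≤ u → HasDerivWithinAt ψ (C₁ * hM u + C₂ * hU u) (Ici 0) u := fun u hu => by
    rw [← hD u hu, D₀_eq hu (hs u hu).1]
    exact (hs u hu).1
  have hC₁ : C₁ = 0 := by
    by_contra hne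
    refine not_integrableOn_kummerSolM (s := -1 + lam / ε) (a := 1 + lam / ε) (b := 1) hμ hc hε
      one_pos (by linarith) (by linarith) ?_
    have hii : ∀ f : ℝ → ℝ, ContinuousOn f (Ici 0) → ∀ b, 0 ≤ b → IntervalIntegrable f volume 0 b :=
      fun f hf b hb => ContinuousOn.intervalIntegrable (hf.mono fun x hx => by
        rw [uIcc_of_le hb] at hx
        exact hx.1)
    refine integrableOn_Ioi_of_intervalIntegral_norm_bounded
      ((2 + |C₂| * ∫ v in Ioi 0, hU v) / |C₁|) 0 (b := id) (l := atTop) (fun i => ?_) tendsto_id ?_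
    · exact (hMc.mono Icc_subset_Ici_self).integrableOn_Icc.mono_set Ioc_subset_Icc_self
    · filter_upwards [eventually_ge_atTop 0] with b hb0
      rw [id]
      have e1 : ∫ x in (0 : ℝ)..b, ‖kummerSolM μ c ε (-1 + lam / ε) (1 + lam / ε) 1 x‖
          = ∫ x in (0 : ℝ)..b, hM x := by
        refine intervalIntegral.integral_congr fun x hx => ?_
        rw [uIcc_of_le hb0] at hx
        refine Real.norm_of_nonneg ((rpow_nonneg (linPremium_pos hc hε hx.1).le _).trans
          (rpow_le_kummerSolM (s := -1 + lam / ε) hμ hc hε one_pos (by linarith) hx.1))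
      have e2 : ∫ x in (0 : ℝ)..b, (C₁ * hM x + C₂ * hU x) = ψ b - ψ 0 := by
        refine intervalIntegral.integral_eq_sub_of_hasDerivAt_of_le hb0
          (fun x hx => (hψ x hx.1).continuousWithinAt.mono Icc_subset_Ici_self)
          (fun x hx => (hψ x hx.1.le).hasDerivAt (Ici_mem_nhds hx.1)) ?_
        exact ((hii hM hMc b hb0).const_mul C₁).add ((hii hU hUc b hb0).const_mul C₂)
      rw [intervalIntegral.integral_add ((hii hM hMc b hb0).const_mul C₁)
        ((hii hU hUc b hb0).const_mul C₂), intervalIntegral.integral_const_mul,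
        intervalIntegral.integral_const_mul] at e2
      have e3 := integral_Ioi_eq_sub hb0 hUi
      have e4 : 0 ≤ ∫ x in Ioi b, hU x :=
        setIntegral_nonneg measurableSet_Ioi fun x hx => (hUpos x (hb0.trans (le_of_lt hx))).le
      have e5 : 0 ≤ ∫ x in (0 : ℝ)..b, hU x :=
        intervalIntegral.integral_nonneg hb0 fun x hx => (hUpos x hx.1).le
      rw [e1, le_div_iff₀ (abs_pos.2 hne)]
      calc (∫ x in (0 : ℝ)..b, hM x) * |C₁| ≤ |(∫ x in (0 : ℝ)..b, hM x) * C₁| := by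
            rw [abs_mul]
            exact mul_le_mul_of_nonneg_right (le_abs_self _) (abs_nonneg _)
        _ = |ψ b - ψ 0 - C₂ * ∫ x in (0 : ℝ)..b, hU x| := by
            congr 1
            linear_combination e2
        _ ≤ |ψ b - ψ 0| + |C₂ * ∫ x in (0 : ℝ)..b, hU x| := abs_sub _ _
        _ ≤ (|ψ b| + |ψ 0|) + |C₂| * ∫ x in (0 : ℝ)..b, hU x := by
            rw [abs_mul, abs_of_nonneg e5]
            gcongr
            exact abs_sub _ _
        _ ≤ (1 + 1) + |C₂| * ∫ x in Ioi 0, hU x := by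
            gcongr
            · exact hb b
            · exact hb 0
            · linarith
        _ = _ := by ring
  have hψ' : ∀ u, 0 ≤ u → HasDerivWithinAt ψ (C₂ * hU u) (Ici 0) u := fun u hu => by
    simpa only [hC₁, zero_mul, zero_add] using hψ u hu
  have hrep : ∀ u, 0 ≤ u → ψ u = -C₂ * ∫ v in Ioi u, hU v := fun u hu => by
    rw [eq_neg_integral_Ioi hψ' (hUi.const_mul C₂) hlim hu, integral_const_mul]
    ring
  have hpos : 0 < ∫ v in Ioi 0, hU v := integral_Ioi_pos hUi fun x hx => hUpos x (le_of_lt hx)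
  refine ⟨-C₂, lt_of_le_of_ne ?_ ?_, hrep⟩
  · by_contra! hneg
    have h1 := h0 0
    rw [hrep 0 le_rfl] at h1
    nlinarith
  · -- if `ψ` vanished, so would `q` and `G`, but `G 0 = 1`
    intro hzero
    have hψ0 : ∀ u, 0 ≤ u → ψ u = 0 := fun u hu => by rw [hrep u hu, ← hzero, zero_mul]
    have hq0 : ∀ u, 0 ≤ u → q u = 0 := by
      intro u hu
      have hp := (linPremium_pos hc hε hu).ne'
      have h1 := D₀_eq hu (hs u hu).1
      rw [D₀_eq hu (hψ' u hu), hψ0 u hu, neg_eq_zero.1 hzero.symm] at h1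
      field_simp at h1
      have : lam ^ 2 * q u = 0 := by linarith
      simpa [hlam.ne'] using this
    have h1 := D₀_eq le_rfl (hs 0 le_rfl).2.1
    have h2 : D₀ q 0 = 0 := by
      rw [D₀_congr (g := fun _ => 0) le_rfl hq0, D₀_eq le_rfl (hasDerivWithinAt_const _ _ _)]
    have hp := (linPremium_pos hc hε le_rfl).ne'
    rw [h2, hq0 0 le_rfl, hG] at h1
    field_simp at h1
    linarith

end ErlangTimes

section ErlangClaims

variable {lam μ c ε : ℝ} {ψ G H : ℝ → ℝ}

lemma isEquivalent_integral_besselSolI (hlam : 0 < lam) (hμ : 0 < μ) (hc : 0 < c) (hε : 0 < ε) :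
    (fun u => ∫ v in Ioi u, besselSolI lam μ c ε v) ~[atTop] fun u =>
      √(ε / 2) / √(2 * π * √(lam * μ)) * exp (-(μ * c / ε)) *
        ∫ y in Ioi u, sqrtTail 1 lam μ c ε y :=
  isEquivalent_integral_Ioi_const_mul (by positivity) (integrableOn_sqrtTail le_rfl hlam hμ hc hε)
    (fun _ hx => (sqrtTail_pos _ _ _ hc hε hx).le) (continuousOn_besselSolI hlam hμ hc hε)
    (besselSolI_isEquivalent hlam hμ hc hε)

lemma isLittleO_integral_sqrtTail (hlam : 0 < lam) (hμ : 0 < μ) (hc : 0 < c) (hε : 0 < ε) :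
    (fun u => ∫ y in Ioi u, sqrtTail (-1) lam μ c ε y) =o[atTop]
      fun u => ∫ y in Ioi u, sqrtTail 1 lam μ c ε y :=
  isLittleO_integral_Ioi (integrableOn_sqrtTail le_rfl hlam hμ hc hε)
    (fun _ hx => (sqrtTail_pos _ _ _ hc hε hx).le) (isLittleO_sqrtTail hlam hμ hc hε)

lemma isLittleO_integral_besselSolK (hlam : 0 < lam) (hμ : 0 < μ) (hc : 0 < c) (hε : 0 < ε) :
    (fun u => ∫ v in Ioi u, besselSolK lam μ c ε v) =o[atTop]
      fun u => ∫ y in Ioi u, sqrtTail 1 lam μ c ε y :=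
  isLittleO_integral_Ioi (integrableOn_sqrtTail le_rfl hlam hμ hc hε)
    (fun _ hx => (sqrtTail_pos _ _ _ hc hε hx).le)
    ((besselSolK_isEquivalent hlam hμ hc hε).isBigO.trans_isLittleO
      ((isLittleO_sqrtTail hlam hμ hc hε).const_mul_left _))

lemma isEquivalent_integral_bessel (hlam : 0 < lam) (hμ : 0 < μ) (hc : 0 < c) (hε : 0 < ε)
    {C₁ : ℝ} (hC₁ : C₁ ≠ 0) (C₂ : ℝ) :
    (fun u => C₁ * (∫ v in Ioi u, besselSolI lam μ c ε v)
      + C₂ * ∫ v in Ioi u, besselSolK lam μ c ε v) ~[atTop] fun u =>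
      C₁ * (√(ε / 2) / √(2 * π * √(lam * μ)) * exp (-(μ * c / ε))) *
        ∫ y in Ioi u, sqrtTail 1 lam μ c ε y := by
  have hk : 0 < √(ε / 2) / √(2 * π * √(lam * μ)) * exp (-(μ * c / ε)) := by positivity
  have h1 : (fun u => C₁ * ∫ v in Ioi u, besselSolI lam μ c ε v) ~[atTop] fun u =>
      C₁ * (√(ε / 2) / √(2 * π * √(lam * μ)) * exp (-(μ * c / ε))) *
        ∫ y in Ioi u, sqrtTail 1 lam μ c ε y :=
    ((IsEquivalent.refl (u := fun _ => C₁)).mul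
      (isEquivalent_integral_besselSolI hlam hμ hc hε)).congr_right
      (Eventually.of_forall fun u => by simp only [Pi.mul_apply]; ring)
  exact h1.add_isLittleO (((isLittleO_integral_besselSolK hlam hμ hc hε).const_mul_left C₂).const_mul_right
    (mul_ne_zero hC₁ hk.ne'))

/-- Both Bessel-type solutions are integrable, so `ψ → 0` alone leaves two constants free. Positivity
of the first one uses in addition that `ψ ≥ 0` and the initial values `G 0 = 1`, `H 0 = μ`. -/
lemma exists_eq_integral_besselSol (hlam : 0 < lam) (hμ : 0 < μ) (hc : 0 < c) (hε : 0 < ε)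
    (hG : G 0 = 1) (hH : H 0 = μ) (hs : ∀ u, 0 ≤ u →
      HasDerivWithinAt ψ ((lam * ψ u - lam * G u) / linPremium c ε u) (Ici 0) u ∧
      HasDerivWithinAt G (-μ * G u + H u) (Ici 0) u ∧
      HasDerivWithinAt H (-μ * H u + μ ^ 2 * ψ u) (Ici 0) u)
    (h0 : ∀ u, 0 ≤ ψ u) (hlim : Tendsto ψ atTop (𝓝 0)) :
    ∃ C₁ C₂ : ℝ, 0 < C₁ ∧ ∀ u, 0 ≤ u → ψ u = C₁ * (∫ v in Ioi u, besselSolI lam μ c ε v)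
      + C₂ * ∫ v in Ioi u, besselSolK lam μ c ε v := by
  obtain ⟨C₁, C₂, hD⟩ := (solvesODE_iff_besselSol hlam hμ hc hε (D₀ ψ)).1
    (solvesODE_of_system_erlang_claims hc hε hs)
  have hIi := integrableOn_besselSolI hlam hμ hc hε
  have hKi := integrableOn_besselSolK hlam hμ hc hε
  have hψ : ∀ u, 0 ≤ u → HasDerivWithinAt ψ
      (C₁ * besselSolI lam μ c ε u + C₂ * besselSolK lam μ c ε u) (Ici 0) u := fun u hu => by
    rw [← hD u hu, D₀_eq hu (hs u hu).1]
    exact (hs u hu).1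
  have hrep : ∀ u, 0 ≤ u → ψ u = -C₁ * (∫ v in Ioi u, besselSolI lam μ c ε v)
      + -C₂ * ∫ v in Ioi u, besselSolK lam μ c ε v := fun u hu => by
    have hI' : IntegrableOn (fun v => C₁ * besselSolI lam μ c ε v) (Ioi u) :=
      (hIi.mono_set (Ioi_subset_Ioi hu)).const_mul C₁
    have hK' : IntegrableOn (fun v => C₂ * besselSolK lam μ c ε v) (Ioi u) :=
      (hKi.mono_set (Ioi_subset_Ioi hu)).const_mul C₂
    rw [eq_neg_integral_Ioi hψ ((hIi.const_mul C₁).add (hKi.const_mul C₂)) hlim hu,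
      integral_add hI' hK', integral_const_mul, integral_const_mul]
    ring
  refine ⟨-C₁, -C₂, lt_of_le_of_ne ?_ ?_, hrep⟩
  · -- the first integral dominates and `ψ` is nonnegative
    by_contra! hneg
    have hS : ∀ u, 0 ≤ u → 0 < ∫ y in Ioi u, sqrtTail 1 lam μ c ε y := fun u hu =>
      integral_Ioi_pos ((integrableOn_sqrtTail le_rfl hlam hμ hc hε).mono_set (Ioi_subset_Ioi hu))
        fun x hx => sqrtTail_pos _ _ _ hc hε (hu.trans (le_of_lt hx))
    have h1 := isEquivalent_integral_bessel hlam hμ hc hε hneg.ne (-C₂)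
    set k := √(ε / 2) / √(2 * π * √(lam * μ)) * exp (-(μ * c / ε)) with hk
    have hk0 : 0 < k := by positivity
    have h2 := (isLittleO_iff.1 h1.isLittleO) (c := 1 / 2) (by norm_num)
    obtain ⟨u, hu, hu0⟩ := (h2.and (eventually_ge_atTop 0)).exists
    have h3 : -C₁ * k * (∫ y in Ioi u, sqrtTail 1 lam μ c ε y) < 0 :=
      mul_neg_of_neg_of_pos (mul_neg_of_neg_of_pos hneg hk0) (hS u hu0)
    simp only [Pi.sub_apply, ← hrep u hu0, Real.norm_eq_abs, abs_of_neg h3] at hu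
    have h4 := h0 u
    have h5 := le_abs_self (ψ u - -C₁ * k * ∫ y in Ioi u, sqrtTail 1 lam μ c ε y)
    linarith
  · -- otherwise `ψ'` is a multiple of `besselSolK`, whose derivative at `0` is incompatible with
    -- the derivative `-μ G(0) + H(0) = 0` of `G`
    intro hzero
    obtain ⟨d, hd, hlt⟩ := exists_hasDerivWithinAt_besselSolK hlam hμ hc hε
    have hC₁ : C₁ = 0 := neg_eq_zero.1 hzero.symm
    have hψK : ∀ u, 0 ≤ u → linPremium c ε u * (C₂ * besselSolK lam μ c ε u)
        = lam * ψ u - lam * G u := by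
      intro u hu
      have hp := (linPremium_pos hc hε hu).ne'
      have h1 := hD u hu
      rw [D₀_eq hu (hs u hu).1, hC₁, zero_mul, zero_add] at h1
      rw [← h1]
      field_simp
    have h1 := D₀_eq le_rfl (((hs 0 le_rfl).1.const_mul lam).sub ((hs 0 le_rfl).2.1.const_mul lam))
    have h2 := D₀_eq le_rfl
      ((hasDerivAt_linPremium c ε 0).hasDerivWithinAt.mul (hd.const_mul C₂))
    have h3 := D₀_congr le_rfl hψK
    have hK0 := hψK 0 le_rfl
    have hp0 : linPremium c ε 0 = c := by simp [linPremium]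
    have h4 : ε * (C₂ * besselSolK lam μ c ε 0) + c * (C₂ * d)
        = lam * (C₂ * besselSolK lam μ c ε 0) := by
      have h5 : (lam * ψ 0 - lam * G 0) / linPremium c ε 0 = C₂ * besselSolK lam μ c ε 0 := by
        rw [← hK0, hp0]
        field_simp
      rw [h5, hG, hH] at h1
      rw [hp0] at h2
      calc _ = D₀ (fun u => linPremium c ε u * (C₂ * besselSolK lam μ c ε u)) 0 := h2.symm
        _ = D₀ (fun u => lam * ψ u - lam * G u) 0 := h3
        _ = _ := h1
        _ = _ := by ring
    have hC₂ : C₂ = 0 := by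
      have : C₂ * ((lam - ε) * besselSolK lam μ c ε 0 - c * d) = 0 := by linear_combination -h4
      rcases mul_eq_zero.1 this with h | h
      · exact h
      · linarith
    have hψ0 : ψ 0 = 0 := by rw [hrep 0 le_rfl, hC₁, hC₂]; simp
    rw [hC₂, hψ0, hG] at hK0
    linarith

end ErlangClaims

/-! ### The equations and laws of the two risk models -/

section KummerParameters

variable {lam μ c ε : ℝ}

lemma solvesODE_iff_erlang_times (hlam : 0 < lam) (hμ : 0 < μ) (hc : 0 < c) (hε : 0 < ε)
    (h : ℝ → ℝ) :
    SolvesODE (fun u => linPremium c ε u ^ 2)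
      (fun u => 3 * ε * linPremium c ε u - 2 * lam * linPremium c ε u + μ * linPremium c ε u ^ 2)
      (fun u => (lam - ε) ^ 2 + μ * ε * linPremium c ε u - 2 * lam * μ * linPremium c ε u) h ↔
      ∃ C₁ C₂ : ℝ, ∀ u, 0 ≤ u → h u = C₁ * kummerSolM μ c ε (-1 + lam / ε) (1 + lam / ε) 1 u
        + C₂ * kummerSolU μ c ε (-1 + lam / ε) (1 + lam / ε) 1 u := by
  have hL : 0 < lam / ε := by positivity
  refine solvesODE_iff_kummerSol (β := 3 * ε - 2 * lam) (γ₀ := (lam - ε) ^ 2)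
    (γ₁ := μ * ε - 2 * lam * μ) hμ hc hε (by positivity) one_pos (by linarith) (fun u => rfl)
    (fun u => by ring) (fun u => by ring) ?_ ?_ ?_ h
  all_goals
    field_simp
    ring

/-- Here `s` and `s - r` are the exponents of the equation at the zero of the premium, that is, the
roots of `x² + (1 - 2λ/ε) x + (λ/ε)² - 2λ/ε = 0`; this is where the square root `r` comes from. -/
lemma solvesODE_iff_erlang_times_abridged (hlam : 0 < lam) (hμ : 0 < μ) (hc : 0 < c) (hε : 0 < ε)
    {r s a : ℝ} (hr : r ^ 2 = 1 + 4 * lam / ε) (hr1 : 1 ≤ r) (hs : s = -1 / 2 + lam / ε + r / 2)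
    (ha : a = s + 2) (h : ℝ → ℝ) :
    SolvesODE (fun u => linPremium c ε u ^ 2)
      (fun u => 2 * ε * linPremium c ε u - 2 * lam * linPremium c ε u + μ * linPremium c ε u ^ 2)
      (fun u => lam ^ 2 - 2 * lam * ε - 2 * lam * μ * linPremium c ε u) h ↔
      ∃ C₁ C₂ : ℝ, ∀ u, 0 ≤ u → h u = C₁ * kummerSolM μ c ε s a (1 + r) u
        + C₂ * kummerSolU μ c ε s a (1 + r) u := by
  obtain ⟨L, rfl⟩ : ∃ L, lam = L * ε := ⟨lam / ε, by field_simp⟩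
  have hL : 0 < L := pos_of_mul_pos_left hlam hε.le
  have e1 : L * ε / ε = L := by field_simp
  have e2 : 4 * (L * ε) / ε = 4 * L := by field_simp
  rw [e1] at hs
  rw [e2] at hr
  have hrL : r ≤ 1 + 2 * L := abs_le_of_sq_le_sq' (by nlinarith) (by positivity) |>.2
  refine solvesODE_iff_kummerSol (β := 2 * ε - 2 * (L * ε)) (γ₀ := (L * ε) ^ 2 - 2 * (L * ε) * ε)
    (γ₁ := -(2 * (L * ε) * μ)) hμ hc hε (by linarith) (by linarith) (by linarith) (fun u => rfl)
    (fun u => by ring) (fun u => by ring) ?_ ?_ ?_ h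
  · rw [hs]
    ring
  · rw [hs]
    linear_combination ε ^ 2 / 4 * hr
  · rw [ha]
    ring

end KummerParameters

section ExpRoot

variable {lam μ c ε : ℝ}

/-- The discriminant is `μ² + 2μ(ε + 2λ)/p + (5ε² - 4ελ)/p²`, which need not be positive near `0`. -/
lemma exists_expRoot_isEquivalent_erlang_times (hlam : 0 < lam) (hμ : 0 < μ) (hc : 0 < c)
    (hε : 0 < ε) {q₁ q₀ : ℝ → ℝ} {u₀ : ℝ} (hu₀ : 0 ≤ u₀)
    (hq₁ : ∀ u, q₁ u = (3 * ε * linPremium c ε u - 2 * lam * linPremium c ε u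
      + μ * linPremium c ε u ^ 2) / linPremium c ε u ^ 2)
    (hq₀ : ∀ u, q₀ u = ((lam - ε) ^ 2 + μ * ε * linPremium c ε u
      - 2 * lam * μ * linPremium c ε u) / linPremium c ε u ^ 2)
    (hpos : ∀ u, u₀ ≤ u → 0 < charDiscr q₁ q₀ u) :
    (∃ κ : ℝ, 0 < κ ∧ expRoot (-1) q₁ q₀ u₀ ~[atTop] fun y => κ * expTail μ c ε y) ∧
      ContinuousOn (expRoot (-1) q₁ q₀ u₀) (Ici u₀) := by
  refine exists_expRoot_isEquivalent_expTail (A := 3 * ε - 2 * lam) (β := ε + 2 * lam)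
    (γ := 5 * ε ^ 2 - 4 * ε * lam) hμ hc hε (by positivity) hu₀ (by ring)
    (fun u hp => ?_) (fun u hp => ?_) hpos
  · rw [hq₁]
    field_simp
    ring
  · rw [charDiscr, hq₁, hq₀]
    field_simp
    ring

/-- The discriminant is `μ² + 4μ(ε + λ)/p + 4ε²/p²`, positive on the whole half-line. -/
lemma exists_expRoot_isEquivalent_erlang_times_abridged (hlam : 0 < lam) (hμ : 0 < μ) (hc : 0 < c)
    (hε : 0 < ε) {q₁ q₀ : ℝ → ℝ}
    (hq₁ : ∀ u, q₁ u = (2 * ε * linPremium c ε u - 2 * lam * linPremium c ε u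
      + μ * linPremium c ε u ^ 2) / linPremium c ε u ^ 2)
    (hq₀ : ∀ u, q₀ u = (lam ^ 2 - 2 * lam * ε - 2 * lam * μ * linPremium c ε u)
      / linPremium c ε u ^ 2) :
    (∃ κ : ℝ, 0 < κ ∧ expRoot (-1) q₁ q₀ 0 ~[atTop] fun y => κ * expTail μ c ε y) ∧
      ContinuousOn (expRoot (-1) q₁ q₀ 0) (Ici 0) := by
  have hΔ : ∀ u, 0 < linPremium c ε u → charDiscr q₁ q₀ u
      = μ ^ 2 + 2 * μ * (2 * (ε + lam)) / linPremium c ε u + 4 * ε ^ 2 / linPremium c ε u ^ 2 := by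
    intro u hp
    rw [charDiscr, hq₁, hq₀]
    field_simp
    ring
  refine exists_expRoot_isEquivalent_expTail (A := 2 * ε - 2 * lam) hμ hc hε (by positivity) le_rfl
    (by ring) (fun u hp => ?_) hΔ fun u hu => ?_
  · rw [hq₁]
    field_simp
    ring
  · have hp := linPremium_pos hc hε hu
    rw [hΔ u hp]
    positivity

lemma exists_expRoot_isEquivalent_erlang_claims (hlam : 0 < lam) (hμ : 0 < μ) (hc : 0 < c)
    (hε : 0 < ε) {σ : ℝ} (hσ : σ = 1 ∨ σ = -1) {q₁ q₀ : ℝ → ℝ}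
    (hq₁ : ∀ u, q₁ u = (2 * ε + 2 * μ * linPremium c ε u - lam) / linPremium c ε u)
    (hq₀ : ∀ u, q₀ u = (2 * μ * ε + μ ^ 2 * linPremium c ε u - 2 * μ * lam) / linPremium c ε u) :
    (∃ κ : ℝ, 0 < κ ∧ expRoot σ q₁ q₀ 0 ~[atTop] fun y => κ * sqrtTail σ lam μ c ε y) ∧
      ContinuousOn (expRoot σ q₁ q₀ 0) (Ici 0) := by
  refine exists_expRoot_isEquivalent_sqrtTail hlam hμ hc hε hσ rfl (fun u hp => ?_) fun u hp => ?_
  · rw [hq₁]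
    field_simp
    ring
  · rw [charDiscr, hq₁, hq₀]
    field_simp
    ring

/-- Tail integrals of functions equivalent to `expTail` describe the decay of `ψ` equally well. -/
lemma exists_isEquivalent_const_mul_integral (hμ : 0 < μ) (hc : 0 < c) (hε : 0 < ε)
    {ψ E : ℝ → ℝ} {A u₀ : ℝ} (hA : 0 < A) (hu₀ : 0 ≤ u₀)
    (hψ : ψ ~[atTop] fun u => A * ∫ y in Ioi u, expTail μ c ε y)
    (hE : (∃ κ : ℝ, 0 < κ ∧ E ~[atTop] fun y => κ * expTail μ c ε y) ∧ ContinuousOn E (Ici u₀)) :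
    ∃ C : ℝ, 0 < C ∧ ψ ~[atTop] fun u => C * ∫ y in Ioi u, E y := by
  obtain ⟨⟨κ, hκ, hEκ⟩, hEc⟩ := hE
  exact ⟨A / κ, by positivity, hψ.const_mul_div hκ.ne' (isEquivalent_integral_Ioi_const_mul hκ
    ((integrableOn_expTail hμ hc hε).mono_set (Ioi_subset_Ioi hu₀))
    (fun x hx => (expTail_pos μ hc hε (hu₀.trans hx)).le) hEc hEκ)⟩

end ExpRoot

section Transfer

variable {Ω : Type*} [MeasurableSpace Ω] {P : Measure Ω} [IsProbabilityMeasure P]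
  {lam μ c ε : ℝ} {τ X : ℕ → Ω → ℝ} {U : ℝ → ℝ → Ω → ℝ}

lemma ruinProb_erlang_times (hlam : 0 < lam) (hμ : 0 < μ) (hc : 0 < c) (hε : 0 < ε)
    (h : IsRiskModel P (linPremium c ε) (gammaMeasure 2 lam) (expMeasure μ) τ X U) {u : ℝ}
    (hu : 0 ≤ u) :
    ruinProb P U u = (ruinFun c ε (gammaMeasure 2 lam) (expMeasure μ) u).toReal := by
  have : IsProbabilityMeasure (gammaMeasure 2 lam) := isProbabilityMeasure_gammaMeasure two_pos hlam
  have : IsProbabilityMeasure (expMeasure μ) := isProbabilityMeasure_expMeasure hμ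
  exact ruinProb_eq_ruinFun hc hε (ae_gammaMeasure_pos 2 lam) h hu

lemma ruinProb_erlang_claims (hlam : 0 < lam) (hμ : 0 < μ) (hc : 0 < c) (hε : 0 < ε)
    (h : IsRiskModel P (linPremium c ε) (expMeasure lam) (gammaMeasure 2 μ) τ X U) {u : ℝ}
    (hu : 0 ≤ u) :
    ruinProb P U u = (ruinFun c ε (expMeasure lam) (gammaMeasure 2 μ) u).toReal := by
  have : IsProbabilityMeasure (expMeasure lam) := isProbabilityMeasure_expMeasure hlam
  have : IsProbabilityMeasure (gammaMeasure 2 μ) := isProbabilityMeasure_gammaMeasure two_pos hμ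
  exact ruinProb_eq_ruinFun (νT := expMeasure lam) hc hε (ae_gammaMeasure_pos 1 lam) h hu

end Transfer

lemma tendsto_ruinFun_erlang_times {lam μ c ε : ℝ} (hlam : 0 < lam) (hμ : 0 < μ) (hc : 0 < c)
    (hε : 0 < ε) :
    Tendsto (fun u => (ruinFun c ε (gammaMeasure 2 lam) (expMeasure μ) u).toReal) atTop (𝓝 0) := by
  have : IsProbabilityMeasure (gammaMeasure 2 lam) := isProbabilityMeasure_gammaMeasure two_pos hlam
  have : IsProbabilityMeasure (expMeasure μ) := isProbabilityMeasure_expMeasure hμ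
  exact tendsto_ruinFun hc hε (ae_gammaMeasure_pos 2 lam) (half_pos hμ)
    (lintegral_exp_half_mul_gammaMeasure one_pos hμ)

lemma tendsto_ruinFun_erlang_claims {lam μ c ε : ℝ} (hlam : 0 < lam) (hμ : 0 < μ) (hc : 0 < c)
    (hε : 0 < ε) :
    Tendsto (fun u => (ruinFun c ε (expMeasure lam) (gammaMeasure 2 μ) u).toReal) atTop (𝓝 0) := by
  have : IsProbabilityMeasure (expMeasure lam) := isProbabilityMeasure_expMeasure hlam
  have : IsProbabilityMeasure (gammaMeasure 2 μ) := isProbabilityMeasure_gammaMeasure two_pos hμ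
  exact tendsto_ruinFun hc hε (ae_gammaMeasure_pos 1 lam) (half_pos hμ)
    (lintegral_exp_half_mul_gammaMeasure two_pos hμ)

theorem mainTheorem3 (lam μ c ε : ℝ) (hlam : 0 < lam) (hμ : 0 < μ) (hc : 0 < c) (hε : 0 < ε) :
    let p : ℝ → ℝ := linPremium c ε
    -- the equation of the derivative for Erlang interarrival times: `a₂ h'' + a₁ h' + a₀ h = 0`
    let a₂ : ℝ → ℝ := fun u => p u ^ 2
    let a₁ : ℝ → ℝ := fun u => 3 * ε * p u - 2 * lam * p u + μ * p u ^ 2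
    let a₀ : ℝ → ℝ := fun u => (lam - ε) ^ 2 + μ * ε * p u - 2 * lam * μ * p u
    -- the abridged equation `a₂ h'' + b₁ h' + b₀ h = 0` (the terms `ε p h'` and `(ε² + μ ε p) h` dropped)
    let b₁ : ℝ → ℝ := fun u => 2 * ε * p u - 2 * lam * p u + μ * p u ^ 2
    let b₀ : ℝ → ℝ := fun u => lam ^ 2 - 2 * lam * ε - 2 * lam * μ * p u
    -- the equation of the derivative for Erlang claims: `p h'' + d₁ h' + d₀ h = 0`
    let d₁ : ℝ → ℝ := fun u => 2 * ε + 2 * μ * p u - lam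
    let d₀ : ℝ → ℝ := fun u => 2 * μ * ε + μ ^ 2 * p u - 2 * μ * lam
    -- Kummer-type solutions of the equation and of the abridged equation
    let hM : ℝ → ℝ := kummerSolM μ c ε (-1 + lam / ε) (1 + lam / ε) 1
    let hU : ℝ → ℝ := kummerSolU μ c ε (-1 + lam / ε) (1 + lam / ε) 1
    let r : ℝ := √(1 + 4 * lam / ε)
    let s : ℝ := -1 / 2 + lam / ε + r / 2
    let a : ℝ := 1 + (ε + 2 * lam + ε * r) / (2 * ε)
    let kM : ℝ → ℝ := kummerSolM μ c ε s a (1 + r)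
    let kU : ℝ → ℝ := kummerSolU μ c ε s a (1 + r)
    let hI : ℝ → ℝ := besselSolI lam μ c ε
    let hK : ℝ → ℝ := besselSolK lam μ c ε
    -- Part A: Erlang(2, lam) interarrival times, Exp(μ) claims
    ((∀ h : ℝ → ℝ, SolvesODE a₂ a₁ a₀ h ↔
        ∃ C₁ C₂ : ℝ, ∀ u, 0 ≤ u → h u = C₁ * hM u + C₂ * hU u) ∧
      ¬ IntegrableOn hM (Ioi 0) ∧ IntegrableOn hU (Ioi 0) ∧
      (∀ h : ℝ → ℝ, SolvesODE a₂ b₁ b₀ h ↔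
        ∃ C₁ C₂ : ℝ, ∀ u, 0 ≤ u → h u = C₁ * kM u + C₂ * kU u) ∧
      Tendsto kM atTop atTop ∧ Tendsto kU atTop (𝓝 0) ∧ IntegrableOn kU (Ioi 0) ∧
      (∀ u, 0 ≤ u →
        (∫ y in Ioi u, expTail μ c ε y)
            = 1 / ε * (exp (-(μ * u)) / p u - μ * ∫ v in Ioi u, exp (-(μ * v)) / p v) ∧
        (∫ y in Ioi u, expTail μ c ε y)
            = 1 / ε * (exp (-(μ * u)) / p u
                - μ / ε * exp (μ / ε * c) * upperGamma (μ / ε * p u) 0)) ∧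
      (∃ κ : ℝ, 0 < κ ∧
        expRoot (-1) (fun u => b₁ u / a₂ u) (fun u => b₀ u / a₂ u) 0
          ~[atTop] fun y => κ * expTail μ c ε y) ∧
      (∀ u₀ : ℝ, 0 ≤ u₀ →
        (∀ u, u₀ ≤ u → 0 < charDiscr (fun u => a₁ u / a₂ u) (fun u => a₀ u / a₂ u) u) →
        ∃ κ : ℝ, 0 < κ ∧
          expRoot (-1) (fun u => a₁ u / a₂ u) (fun u => a₀ u / a₂ u) u₀
            ~[atTop] fun y => κ * expTail μ c ε y) ∧
      ∃ C : ℝ, 0 < C ∧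
        ∀ {Ω : Type*} [MeasurableSpace Ω] (P : Measure Ω) [IsProbabilityMeasure P]
          (τ X : ℕ → Ω → ℝ) (U : ℝ → ℝ → Ω → ℝ),
          IsRiskModel P p (gammaMeasure 2 lam) (expMeasure μ) τ X U →
          let ψ : ℝ → ℝ := ruinProb P U
          ContDiffOn ℝ ∞ ψ (Ici 0) ∧ Tendsto ψ atTop (𝓝 0) ∧
          (∀ u, 0 ≤ u →
            shiftOp μ (premiumOp lam p (premiumOp lam p ψ)) u - lam ^ 2 * μ * ψ u = 0) ∧
          SolvesODE a₂ a₁ a₀ (D₀ ψ) ∧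
          (∀ u, 0 ≤ u → ψ u = C * ∫ v in Ioi u, hU v) ∧
          (ψ ~[atTop] fun u =>
            C * (μ / ε) ^ (-(1 + lam / ε)) * ∫ y in Ioi u, expTail μ c ε y) ∧
          (∃ C' : ℝ, 0 < C' ∧
            (ψ ~[atTop] fun u => C' * ∫ v in Ioi u, kU v) ∧
            (ψ ~[atTop] fun u => C' * (μ / ε) ^ (-a) * ∫ y in Ioi u, expTail μ c ε y)) ∧
          (∃ C₃ : ℝ, 0 < C₃ ∧
            ψ ~[atTop] fun u => C₃ *
              ∫ y in Ioi u, expRoot (-1) (fun u => b₁ u / a₂ u) (fun u => b₀ u / a₂ u) 0 y) ∧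
          (∀ u₀ : ℝ, 0 ≤ u₀ →
            (∀ u, u₀ ≤ u → 0 < charDiscr (fun u => a₁ u / a₂ u) (fun u => a₀ u / a₂ u) u) →
            ∃ C₃ : ℝ, 0 < C₃ ∧
              ψ ~[atTop] fun u => C₃ *
                ∫ y in Ioi u,
                  expRoot (-1) (fun u => a₁ u / a₂ u) (fun u => a₀ u / a₂ u) u₀ y)) ∧
    -- Part B: Exp(lam) interarrival times, Erlang(2, μ) claims
    ((∀ h : ℝ → ℝ, SolvesODE p d₁ d₀ h ↔
        ∃ C₁ C₂ : ℝ, ∀ u, 0 ≤ u → h u = C₁ * hI u + C₂ * hK u) ∧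
      IntegrableOn hI (Ioi 0) ∧ IntegrableOn hK (Ioi 0) ∧
      (∀ σ : ℝ, σ = 1 ∨ σ = -1 → ∃ κ : ℝ, 0 < κ ∧
        expRoot σ (fun u => d₁ u / p u) (fun u => d₀ u / p u) 0
          ~[atTop] fun y => κ * sqrtTail σ lam μ c ε y) ∧
      ∃ C₁ C₂ : ℝ, 0 < C₁ ∧
        ∀ {Ω : Type*} [MeasurableSpace Ω] (P : Measure Ω) [IsProbabilityMeasure P]
          (τ X : ℕ → Ω → ℝ) (U : ℝ → ℝ → Ω → ℝ),
          IsRiskModel P p (expMeasure lam) (gammaMeasure 2 μ) τ X U →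
          let ψ : ℝ → ℝ := ruinProb P U
          ContDiffOn ℝ ∞ ψ (Ici 0) ∧ Tendsto ψ atTop (𝓝 0) ∧
          (∀ u, 0 ≤ u →
            shiftOp μ (shiftOp μ (premiumOp lam p ψ)) u - lam * μ ^ 2 * ψ u = 0) ∧
          SolvesODE p d₁ d₀ (D₀ ψ) ∧
          (∀ u, 0 ≤ u → ψ u = C₁ * (∫ v in Ioi u, hI v) + C₂ * ∫ v in Ioi u, hK v) ∧
          (ψ ~[atTop] fun u =>
            C₁ * √(ε / 2) / √(2 * π * √(lam * μ)) * exp (-(μ * c / ε)) *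
                (∫ y in Ioi u, sqrtTail 1 lam μ c ε y) +
              C₂ * √(ε / 2) * √(π / (2 * √(lam * μ))) * exp (-(μ * c / ε)) *
                ∫ y in Ioi u, sqrtTail (-1) lam μ c ε y) ∧
          (∃ C₃ C₄ : ℝ, 0 < C₄ ∧
            ψ ~[atTop] fun u =>
              C₃ * (∫ y in Ioi u,
                expRoot (-1) (fun u => d₁ u / p u) (fun u => d₀ u / p u) 0 y) +
              C₄ * ∫ y in Ioi u,
                expRoot 1 (fun u => d₁ u / p u) (fun u => d₀ u / p u) 0 y)) := by
  intro p a₂ a₁ a₀ b₁ b₀ d₁ d₀ hM hU r s a kM kU hI hK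
  have hL : 0 < lam / ε := by positivity
  have hr : r ^ 2 = 1 + 4 * lam / ε := sq_sqrt (by positivity)
  have hr1 : 1 ≤ r := one_le_sqrt.2 (by
    have : 0 < 4 * lam / ε := by positivity
    linarith)
  have ha : a = s + 2 := by
    simp only [a, s]
    field_simp
    ring
  have hs0 : 0 < s := by
    simp only [s]
    linarith
  have hra : 1 + r ≤ a := by
    have hrL : r ≤ 1 + 2 * (lam / ε) := abs_le_of_sq_le_sq'
      (by rw [hr, mul_div_assoc]; nlinarith) (by positivity) |>.2
    have h1 : s = -1 / 2 + lam / ε + r / 2 := rfl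
    linarith
  have hsa : s - a = -2 := by linarith
  have hUiso : hU ~[atTop] fun y => (μ / ε) ^ (-(1 + lam / ε)) * expTail μ c ε y :=
    kummerSolU_isEquivalent hμ hc hε (by positivity) (by linarith) (by ring)
  have hUc : ContinuousOn hU (Ici 0) :=
    continuousOn_kummerSolU hμ hc hε (by positivity) (by linarith)
  have kUiso : kU ~[atTop] fun y => (μ / ε) ^ (-a) * expTail μ c ε y :=
    kummerSolU_isEquivalent hμ hc hε (by linarith) (by linarith) hsa
  have kUc : ContinuousOn kU (Ici 0) :=
    continuousOn_kummerSolU hμ hc hε (by linarith) (by linarith)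
  have htail := integrableOn_expTail hμ hc hε
  have htail0 : ∀ x, 0 ≤ x → 0 ≤ expTail μ c ε x := fun x hx => (expTail_pos μ hc hε hx).le
  have hEb := exists_expRoot_isEquivalent_erlang_times_abridged hlam hμ hc hε
    (q₁ := fun u => b₁ u / a₂ u) (q₀ := fun u => b₀ u / a₂ u) (fun u => rfl) fun u => rfl
  have hEa : ∀ u₀ : ℝ, 0 ≤ u₀ → (∀ u, u₀ ≤ u →
      0 < charDiscr (fun u => a₁ u / a₂ u) (fun u => a₀ u / a₂ u) u) → _ := fun u₀ hu₀ hpos =>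
    exists_expRoot_isEquivalent_erlang_times hlam hμ hc hε
      (q₁ := fun u => a₁ u / a₂ u) (q₀ := fun u => a₀ u / a₂ u) hu₀ (fun u => rfl) (fun u => rfl) hpos
  have hEd : ∀ σ : ℝ, σ = 1 ∨ σ = -1 → _ := fun σ hσ =>
    exists_expRoot_isEquivalent_erlang_claims hlam hμ hc hε hσ
      (q₁ := fun u => d₁ u / p u) (q₀ := fun u => d₀ u / p u) (fun u => rfl) fun u => rfl
  refine ⟨⟨solvesODE_iff_erlang_times hlam hμ hc hε,
    not_integrableOn_kummerSolM hμ hc hε one_pos (by linarith) (by linarith),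
    integrableOn_kummerSolU hμ hc hε (by positivity) (by linarith) (by ring),
    solvesODE_iff_erlang_times_abridged hlam hμ hc hε hr hr1 rfl ha,
    tendsto_kummerSolM hμ hc hε (by linarith) hra hs0,
    tendsto_kummerSolU hμ hc hε (by linarith) (by linarith) hsa,
    integrableOn_kummerSolU hμ hc hε (by linarith) (by linarith) hsa,
    fun u hu => ⟨integral_expTail hμ hc hε hu, ?_⟩, hEb.1, fun u₀ hu₀ hpos => (hEa u₀ hu₀ hpos).1,
    ?_⟩, ⟨solvesODE_iff_besselSol hlam hμ hc hε, integrableOn_besselSolI hlam hμ hc hε,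
    integrableOn_besselSolK hlam hμ hc hε, fun σ hσ => (hEd σ hσ).1, ?_⟩⟩
  · rw [integral_expTail hμ hc hε hu, upperGamma_linPremium hμ hc hε hu]
    simp only [p]
    ring
  · have : IsProbabilityMeasure (gammaMeasure 2 lam) :=
      isProbabilityMeasure_gammaMeasure two_pos hlam
    have : IsProbabilityMeasure (expMeasure μ) := isProbabilityMeasure_expMeasure hμ
    obtain ⟨q, G, hG, hs⟩ := exists_system_erlang_times hlam hμ hc hε rfl
    -- this function depends on the laws only, so the constant is fixed before the model is given
    set ψ₀ : ℝ → ℝ := fun u => (ruinFun c ε (gammaMeasure 2 lam) (expMeasure μ) u).toReal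
    have hlim : Tendsto ψ₀ atTop (𝓝 0) := tendsto_ruinFun_erlang_times hlam hμ hc hε
    obtain ⟨C₁, C₂, hD⟩ := (solvesODE_iff_erlang_times hlam hμ hc hε (D₀ ψ₀)).1
      (solvesODE_of_system_erlang_times hc hε hs)
    obtain ⟨C, hC, hrep⟩ := exists_eq_integral_kummerSolU hlam hμ hc hε hG hs
      abs_toReal_ruinFun_le_one (fun u => ENNReal.toReal_nonneg) hlim hD
    refine ⟨C, hC, ?_⟩
    intro Ω _ P _ τ X U hmodel ψ
    have hψ : ∀ u, 0 ≤ u → ψ u = ψ₀ u := fun u hu =>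
      ruinProb_erlang_times hlam hμ hc hε hmodel hu
    have hs' : ∀ u, 0 ≤ u →
        HasDerivWithinAt ψ ((lam * ψ u - lam ^ 2 * q u) / linPremium c ε u) (Ici 0) u ∧
        HasDerivWithinAt q ((lam * q u - G u) / linPremium c ε u) (Ici 0) u ∧
        HasDerivWithinAt G (-μ * G u + μ * ψ u) (Ici 0) u := fun u hu => by
      rw [hψ u hu]
      exact ⟨(hs u hu).1.congr hψ (hψ u hu), (hs u hu).2⟩
    have hrep' : ∀ u, 0 ≤ u → ψ u = C * ∫ v in Ioi u, hU v := fun u hu => by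
      rw [hψ u hu, hrep u hu]
    have hasym : ψ ~[atTop] fun u =>
        C * (μ / ε) ^ (-(1 + lam / ε)) * ∫ y in Ioi u, expTail μ c ε y := by
      have h1 := isEquivalent_integral_Ioi_const_mul (by positivity) htail htail0 hUc hUiso
      refine ((IsEquivalent.refl (u := fun _ => C)).mul h1).congr_left ?_ |>.congr_right ?_
      · filter_upwards [eventually_ge_atTop 0] with u hu
        rw [hrep' u hu]
        rfl
      · exact Eventually.of_forall fun u => by simp only [Pi.mul_apply]; ring
    have hApos : 0 < C * (μ / ε) ^ (-(1 + lam / ε)) := by positivity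
    have hkpos : 0 < (μ / ε) ^ (-a) := by positivity
    refine ⟨contDiffOn_of_system_erlang_times hc hε hs',
      hlim.congr' ((eventually_ge_atTop 0).mono fun u hu => (hψ u hu).symm),
      fun u hu => premiumOp_of_system_erlang_times hc hε hs' hu,
      solvesODE_of_system_erlang_times hc hε hs', hrep', hasym,
      ⟨C * (μ / ε) ^ (-(1 + lam / ε)) / (μ / ε) ^ (-a), by positivity, ?_, ?_⟩,
      exists_isEquivalent_const_mul_integral hμ hc hε hApos le_rfl hasym hEb,
      fun u₀ hu₀ hpos =>
        exists_isEquivalent_const_mul_integral hμ hc hε hApos hu₀ hasym (hEa u₀ hu₀ hpos)⟩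
    · exact hasym.const_mul_div hkpos.ne'
        (isEquivalent_integral_Ioi_const_mul hkpos htail htail0 kUc kUiso)
    · rw [div_mul_cancel₀ _ hkpos.ne']
      exact hasym
  · obtain ⟨G, H, hG, hH, hs⟩ := exists_system_erlang_claims hlam hμ hc hε rfl
    set ψ₀ : ℝ → ℝ := fun u => (ruinFun c ε (expMeasure lam) (gammaMeasure 2 μ) u).toReal
    have hlim : Tendsto ψ₀ atTop (𝓝 0) := tendsto_ruinFun_erlang_claims hlam hμ hc hε
    obtain ⟨C₁, C₂, hC₁, hrep⟩ := exists_eq_integral_besselSol hlam hμ hc hε hG hH hs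
      (fun u => ENNReal.toReal_nonneg) hlim
    refine ⟨C₁, C₂, hC₁, ?_⟩
    intro Ω _ P _ τ X U hmodel ψ
    have hψ : ∀ u, 0 ≤ u → ψ u = ψ₀ u := fun u hu =>
      ruinProb_erlang_claims hlam hμ hc hε hmodel hu
    have hs' : ∀ u, 0 ≤ u →
        HasDerivWithinAt ψ ((lam * ψ u - lam * G u) / linPremium c ε u) (Ici 0) u ∧
        HasDerivWithinAt G (-μ * G u + H u) (Ici 0) u ∧
        HasDerivWithinAt H (-μ * H u + μ ^ 2 * ψ u) (Ici 0) u := fun u hu => by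
      rw [hψ u hu]
      exact ⟨(hs u hu).1.congr hψ (hψ u hu), (hs u hu).2⟩
    have hrep' : ∀ u, 0 ≤ u → ψ u = C₁ * (∫ v in Ioi u, hI v) + C₂ * ∫ v in Ioi u, hK v :=
      fun u hu => by rw [hψ u hu, hrep u hu]
    set k := √(ε / 2) / √(2 * π * √(lam * μ)) * exp (-(μ * c / ε)) with hk
    have hk0 : 0 < k := by positivity
    have hasym : ψ ~[atTop] fun u => C₁ * k * ∫ y in Ioi u, sqrtTail 1 lam μ c ε y := by
      refine (isEquivalent_integral_bessel hlam hμ hc hε hC₁.ne' C₂).congr_left ?_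
      filter_upwards [eventually_ge_atTop 0] with u hu
      exact (hrep' u hu).symm
    refine ⟨contDiffOn_of_system_erlang_claims hc hε hs',
      hlim.congr' ((eventually_ge_atTop 0).mono fun u hu => (hψ u hu).symm),
      fun u hu => premiumOp_of_system_erlang_claims hc hε hs' hu,
      solvesODE_of_system_erlang_claims hc hε hs', hrep', ?_, ?_⟩
    · refine (hasym.add_const_mul_isLittleO (by positivity)
        (isLittleO_integral_sqrtTail hlam hμ hc hε)
        (C₂ * (√(ε / 2) * √(π / (2 * √(lam * μ))) * exp (-(μ * c / ε))))).congr_right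
        (Eventually.of_forall fun u => ?_)
      rw [hk]
      ring
    · obtain ⟨⟨κ₁, hκ₁, hE₁⟩, hEc₁⟩ := hEd 1 (Or.inl rfl)
      obtain ⟨⟨κ₂, hκ₂, hE₂⟩, hEc₂⟩ := hEd (-1) (Or.inr rfl)
      have ht₁ := isEquivalent_integral_Ioi_const_mul hκ₁ (integrableOn_sqrtTail le_rfl hlam hμ hc hε)
        (fun _ hx => (sqrtTail_pos _ _ _ hc hε hx).le) hEc₁ hE₁
      have ht₂ := isEquivalent_integral_Ioi_const_mul hκ₂
        (integrableOn_sqrtTail (by norm_num) hlam hμ hc hε)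
        (fun _ hx => (sqrtTail_pos _ _ _ hc hε hx).le) hEc₂ hE₂
      have ho : (fun u => ∫ y in Ioi u, expRoot (-1) (fun u => d₁ u / p u) (fun u => d₀ u / p u) 0 y)
          =o[atTop] fun u =>
            ∫ y in Ioi u, expRoot 1 (fun u => d₁ u / p u) (fun u => d₀ u / p u) 0 y :=
        (ht₂.isBigO.trans_isLittleO (((isLittleO_integral_sqrtTail hlam hμ hc hε).const_mul_left
          κ₂).const_mul_right hκ₁.ne')).trans_isBigO ht₁.isBigO_symm
      refine ⟨C₂ * (√(ε / 2) * √(π / (2 * √(lam * μ))) * exp (-(μ * c / ε))) / κ₂, C₁ * k / κ₁,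
        by positivity, ?_⟩
      exact ((hasym.const_mul_div hκ₁.ne' ht₁).add_const_mul_isLittleO (by positivity) ho
        _).congr_right (Eventually.of_forall fun u => add_comm _ _)
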